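/- Work over $\mathbb C$, let $n\ge 1$, and let $\mathbb G_a^n=(\mathbb C^n,+)$ as an algebraic group; its algebraic group automorphisms are the linear automorphisms of $\mathbb C^n$. Consider pairs $(\tilde\rho,v)$, where $\tilde\rho:\mathbb G_a^n\to \operatorname{PGL}_{n+2}(\mathbb C)$ is a homomorphism of algebraic groups and $v\in\mathbb C^{n+2}$ is a nonzero cyclic vector, i.e. the lines $\tilde\rho(a)\langle v\rangle$, $a\in\mathbb G_a^n$, span $\mathbb C^{n+2}$. Two pairs $(\tilde\rho,v)$ and $(\tilde\rho',v')$ are isomorphic if there are $g\in\operatorname{GL}_{n+2}(\mathbb C)$ and an automorphism $\sigma$ of the algebraic group $\mathbb G_a^n$ with $gv=v'$ and $\tilde\rho'(\sigma(a))=[g]\,\tilde\rho(a)\,[g]^{-1}$ for all $a$. For a rational linear representation $\rho:\mathbb G_a^n\to\operatorname{GL}_{n+2}(\mathbb C)$ and a vector $v$ let $\tau:\mathbb C[S_1,\dots,S_n]\to \operatorname{Mat}_{n+2}(\mathbb C)$ be the homomorphism which sends $S_i$ to $d\rho(e_i)$, the derivative of $\rho$ at $0$ in the direction of the $i$-th basis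 vector, and let $I_{\rho,v}=\{f:\tau(f)v=0\}$. Let $$J_n=\bigl(S_k^2-S_l^2,\; S_iS_j,\; S_k^3 \;\bigm|\; 1\le i,j,k,l\le n,\ i\ne j\bigr)\subset\mathbb C[S_1,\dots,S_n];$$ for $n\ge2$ the generators $S_k^3$ are redundant, so that $J_n=(S_k^2-S_l^2,\,S_iS_j\mid i\neq j)$, and $J_1=(S_1^3)$. Then the following holds. 1. Up to isomorphism there is exactly one pair $(\tilde\rho,v)$ such that the closure of the orbit of $\langle v\rangle$ in $\mathbb P^{n+1}$ is a nondegenerate quadric. 2. For each such pair, $\tilde\rho$ lifts to a unique rational representation $\rho:\mathbb G_a^n\to\operatorname{GL}_{n+2}(\mathbb C)$, and the algebras $\mathbb C[S_1,\dots,S_n]/I_{\rho,v}$ and $\mathbb C[S_1,\dots,S_n]/J_n$ are isomorphic. There is such a pair with $I_{\rho,v}=J_n$. 3. Let $Q_n\subset\mathbb P^{n+1}$ be a nondegenerate quadric. There is an algebraic action of $\mathbb G_a^n$ on the variety $Q_n$ which is locally transitive, i.e. has a (Zariski) open orbit, and any two such actions are carried to each other by an automorphism of the variety $Q_n$ together with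 an automorphism of the algebraic group $\mathbb G_a^n$. Every locally transitive action of $\mathbb G_a^n$ on $Q_n$ is the restriction to $Q_n$ of the action on $\mathbb P^{n+1}$ given by a pair $(\tilde\rho,v)$ for which the closure of the orbit of $\langle v\rangle$ is $Q_n$, and every pair with this orbit closure restricts to a locally transitive action on $Q_n$. -/

import Mathlib

open scoped LinearAlgebra.Projectivization MatrixGroups

namespace QuadricAction

noncomputable section

/-! ### Subsets of projective space and regular maps -/

/-- The Zariski closure of a subset `S` of the projective space `ℙ(ℂ^m)`: the common zero locus of
all homogeneous polynomials which vanish on `S`. -/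
def zariskiClosure {m : ℕ} (S : Set (ℙ ℂ (Fin m → ℂ))) : Set (ℙ ℂ (Fin m → ℂ)) :=
  {x | ∀ (d : ℕ) (f : MvPolynomial (Fin m) ℂ), f.IsHomogeneous d →
    (∀ s ∈ S, MvPolynomial.eval s.rep f = 0) → MvPolynomial.eval x.rep f = 0}

/-- Zariski closed subsets of projective space. -/
def IsZariskiClosed {m : ℕ} (S : Set (ℙ ℂ (Fin m → ℂ))) : Prop :=
  zariskiClosure S = S

/-- The projective quadric `{⟨u⟩ : q(u) = 0}`. -/
def quadric {m : ℕ} (q : QuadraticForm ℂ (Fin m → ℂ)) : Set (ℙ ℂ (Fin m → ℂ)) :=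
  {x | q x.rep = 0}

/-- Regular maps (morphisms of varieties) between subvarieties `X`, `Y` of projective spaces:
near every point the map is given by homogeneous polynomials of one degree which do not all vanish
at that point. (A tuple which describes the map only on a smaller neighbourhood of the point may be
multiplied by a homogeneous polynomial that vanishes outside that neighbourhood, so it is no
restriction to ask that it describes the map wherever it does not vanish.) -/
def IsRegularMap {l m : ℕ} {X : Set (ℙ ℂ (Fin l → ℂ))} {Y : Set (ℙ ℂ (Fin m → ℂ))}
    (f : X → Y) : Prop :=
  ∀ x₀ : X, ∃ (d : ℕ) (F : Fin m → MvPolynomial (Fin l) ℂ),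
    (∀ j, (F j).IsHomogeneous d) ∧
    (fun j => MvPolynomial.eval x₀.1.rep (F j)) ≠ 0 ∧
    ∀ (x : X) (h : (fun j => MvPolynomial.eval x.1.rep (F j)) ≠ 0),
      (f x).1 = Projectivization.mk ℂ (fun j => MvPolynomial.eval x.1.rep (F j)) h

/-- The value at `(a, y)` of a polynomial in `y` whose coefficients are polynomials in `a`. -/
def evalTwo {n l : ℕ} (a : Fin n → ℂ) (y : Fin l → ℂ)
    (F : MvPolynomial (Fin l) (MvPolynomial (Fin n) ℂ)) : ℂ :=
  MvPolynomial.eval y (MvPolynomial.map (MvPolynomial.eval a) F)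

/-- Regular maps `𝔸ⁿ × X → Y`, where `X`, `Y` are subvarieties of projective spaces: near every
point the map is given by polynomials in `(a, y)` which are homogeneous in `y` of one degree and do
not all vanish at that point. -/
def IsRegularFamily {n l m : ℕ} {X : Set (ℙ ℂ (Fin l → ℂ))} {Y : Set (ℙ ℂ (Fin m → ℂ))}
    (f : (Fin n → ℂ) → X → Y) : Prop :=
  ∀ (a₀ : Fin n → ℂ) (x₀ : X),
    ∃ (d : ℕ) (F : Fin m → MvPolynomial (Fin l) (MvPolynomial (Fin n) ℂ)),
      (∀ j, (F j).IsHomogeneous d) ∧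
      (fun j => evalTwo a₀ x₀.1.rep (F j)) ≠ 0 ∧
      ∀ (a : Fin n → ℂ) (x : X) (h : (fun j => evalTwo a x.1.rep (F j)) ≠ 0),
        (f a x).1 = Projectivization.mk ℂ (fun j => evalTwo a x.1.rep (F j)) h

/-! ### Actions of `𝔾ₐⁿ = (ℂⁿ, +)` on projective varieties -/

/-- An algebraic action of `𝔾ₐⁿ` on a subvariety `X` of a projective space. -/
structure AlgAction (n : ℕ) {l : ℕ} (X : Set (ℙ ℂ (Fin l → ℂ))) where
  act : (Fin n → ℂ) → X → X
  zero_act : ∀ x, act 0 x = x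
  add_act : ∀ a b x, act (a + b) x = act a (act b x)
  regular : IsRegularFamily act

namespace AlgAction

variable {n l : ℕ} {X : Set (ℙ ℂ (Fin l → ℂ))}

/-- The action has a Zariski open orbit on `X`. -/
def LocallyTransitive (A : AlgAction n X) : Prop :=
  ∃ (x : X) (Z : Set (ℙ ℂ (Fin l → ℂ))), IsZariskiClosed Z ∧
    {y | ∃ a, y = (A.act a x).1} = X \ Z

/-- Two actions on `X` are isomorphic if an automorphism of the variety `X` carries one to the
other up to an automorphism of the algebraic group `𝔾ₐⁿ`. The automorphisms of the algebraic group
`𝔾ₐⁿ` over `ℂ` are the linear automorphisms of `ℂⁿ`. -/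
def Iso (A B : AlgAction n X) : Prop :=
  ∃ (φ : X ≃ X) (σ : (Fin n → ℂ) ≃ₗ[ℂ] (Fin n → ℂ)),
    IsRegularMap φ ∧ IsRegularMap φ.symm ∧
      ∀ a x, φ (A.act a x) = B.act (σ a) (φ x)

end AlgAction

/-! ### Projective representations with a cyclic vector -/

/-- A group homomorphism `𝔾ₐⁿ → PGL_l(ℂ)` is regular if near every point it is given by an
invertible matrix of polynomials. -/
def IsRegularToPGL {n l : ℕ} (ρ : Multiplicative (Fin n → ℂ) →* PGL(Fin l, ℂ)) : Prop :=
  ∀ a₀ : Fin n → ℂ, ∃ P : Matrix (Fin l) (Fin l) (MvPolynomial (Fin n) ℂ),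
    (P.map (MvPolynomial.eval a₀)).det ≠ 0 ∧
    ∀ (a : Fin n → ℂ) (h : (P.map (MvPolynomial.eval a)).det ≠ 0),
      ρ (Multiplicative.ofAdd a) =
        Matrix.ProjGenLinGroup.mk (Matrix.GeneralLinearGroup.mkOfDetNeZero _ h)

/-- A pair `(ρ, v)` of a projective representation `ρ : 𝔾ₐⁿ → PGL_l(ℂ)` of algebraic groups and a
cyclic vector `v ∈ ℂ^l`: the lines of the orbit of `⟨v⟩` span `ℂ^l`. -/
structure CyclicPair (n l : ℕ) where
  ρ : Multiplicative (Fin n → ℂ) →* PGL(Fin l, ℂ)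
  regular : IsRegularToPGL ρ
  v : Fin l → ℂ
  v_ne_zero : v ≠ 0
  cyclic : (⨆ a, (ρ a • Projectivization.mk ℂ v v_ne_zero).submodule) = ⊤

namespace CyclicPair

variable {n l : ℕ}

/-- The line `⟨v⟩` as a point of projective space. -/
def line (p : CyclicPair n l) : ℙ ℂ (Fin l → ℂ) := Projectivization.mk ℂ p.v p.v_ne_zero

/-- The closure of the orbit of the line `⟨v⟩`. -/
def orbitClosure (p : CyclicPair n l) : Set (ℙ ℂ (Fin l → ℂ)) :=
  zariskiClosure (Set.range fun a => p.ρ a • p.line)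

/-- The orbit closure of `⟨v⟩` is a nondegenerate quadric. -/
def HasQuadricClosure (p : CyclicPair n l) : Prop :=
  ∃ q : QuadraticForm ℂ (Fin l → ℂ), q.Nondegenerate ∧ p.orbitClosure = quadric q

/-- Isomorphism of pairs: a linear isomorphism which carries the cyclic vector to the cyclic vector
and the representations to each other, up to an automorphism of the algebraic group `𝔾ₐⁿ`, that is,
a linear automorphism of `ℂⁿ`. -/
def Iso (p p' : CyclicPair n l) : Prop :=
  ∃ (g : GL (Fin l) ℂ) (σ : (Fin n → ℂ) ≃ₗ[ℂ] (Fin n → ℂ)),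
    g.1.mulVec p.v = p'.v ∧
    ∀ a : Fin n → ℂ, p'.ρ (Multiplicative.ofAdd (σ a)) * Matrix.ProjGenLinGroup.mk g =
      Matrix.ProjGenLinGroup.mk g * p.ρ (Multiplicative.ofAdd a)

end CyclicPair

/-! ### Linear representations and the associated algebras -/

/-- A rational representation `𝔾ₐⁿ → GL_l(ℂ)`: a matrix of polynomial functions `ρ(a)` on `ℂⁿ` with
`ρ(0) = 1` and `ρ(a + b) = ρ(a) ρ(b)`. -/
structure RationalRep (n l : ℕ) where
  mat : Matrix (Fin l) (Fin l) (MvPolynomial (Fin n) ℂ)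
  map_zero : mat.map (MvPolynomial.eval 0) = 1
  map_add : ∀ a b : Fin n → ℂ, mat.map (MvPolynomial.eval (a + b)) =
    mat.map (MvPolynomial.eval a) * mat.map (MvPolynomial.eval b)

namespace RationalRep

variable {n l : ℕ} (ρ : RationalRep n l)

/-- The linear representation `ρ` is a lift of the projective representation `ρ'`. -/
def Lifts (ρ' : Multiplicative (Fin n → ℂ) →* PGL(Fin l, ℂ)) : Prop :=
  ∀ a : Fin n → ℂ, ∃ g : GL (Fin l) ℂ, g.1 = ρ.mat.map (MvPolynomial.eval a) ∧
    Matrix.ProjGenLinGroup.mk g = ρ' (Multiplicative.ofAdd a)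

/-- The operator `dρ(S_i)`, where `S_1, …, S_n` is the standard basis of `Lie 𝔾ₐⁿ`: the partial
derivative at `0` of `ρ` in the `i`-th direction. -/
def infGen (i : Fin n) : Matrix (Fin l) (Fin l) ℂ :=
  ρ.mat.map fun p => MvPolynomial.eval 0 (MvPolynomial.pderiv i p)

lemma infGen_comm_of_comm (i : Fin n) (M : Matrix (Fin l) (Fin l) ℂ)
    (hM : ∀ a, ρ.mat.map (MvPolynomial.eval a) * M = M * ρ.mat.map (MvPolynomial.eval a)) :
    ρ.infGen i * M = M * ρ.infGen i := by
  have h : ρ.mat * M.map MvPolynomial.C = M.map MvPolynomial.C * ρ.mat := by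
    ext1 j k
    apply MvPolynomial.funext
    intro a
    have := congrFun (congrFun (hM a) j) k
    simpa [Matrix.mul_apply] using this
  ext j k
  have h2 := congrArg (fun p => MvPolynomial.eval 0 (MvPolynomial.pderiv i p))
    (congrFun (congrFun h j) k)
  simpa [Matrix.mul_apply, infGen, Derivation.leibniz, mul_comm] using h2

lemma infGen_comm (i j : Fin n) : ρ.infGen i * ρ.infGen j = ρ.infGen j * ρ.infGen i := by
  apply infGen_comm_of_comm
  intro a
  symm
  apply infGen_comm_of_comm
  intro b
  rw [← ρ.map_add, ← ρ.map_add, add_comm]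

/-- The homomorphism `τ : U(Lie 𝔾ₐⁿ) = ℂ[S_1, …, S_n] → Mat_l(ℂ)` with `τ(S_i) = dρ(S_i)`; it takes
values in the commutative subalgebra generated by the operators `dρ(S_i)`. -/
def tau : MvPolynomial (Fin n) ℂ →ₐ[ℂ] Matrix (Fin l) (Fin l) ℂ :=
  letI : IsMulCommutative (Algebra.adjoin ℂ (Set.range ρ.infGen)) :=
    Algebra.isMulCommutative_adjoin ℂ (by
      rintro _ ⟨i, rfl⟩ _ ⟨j, rfl⟩
      exact ρ.infGen_comm i j)
  letI : CommRing (Algebra.adjoin ℂ (Set.range ρ.infGen)) :=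
    { (inferInstance : Ring (Algebra.adjoin ℂ (Set.range ρ.infGen))) with
      mul_comm := IsMulCommutative.is_comm.comm }
  (Algebra.adjoin ℂ (Set.range ρ.infGen)).val.comp
    (MvPolynomial.aeval fun i => ⟨ρ.infGen i, Algebra.subset_adjoin ⟨i, rfl⟩⟩)

lemma tau_X (i : Fin n) : ρ.tau (MvPolynomial.X i) = ρ.infGen i := by
  simp [tau]

/-- The ideal `I = {f ∈ ℂ[S_1, …, S_n] : τ(f) v = 0}`. The algebra `ℂ[S_1, …, S_n] / I` is the
algebra that corresponds to the pair `(ρ, v)`. -/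
def annIdeal (v : Fin l → ℂ) : Ideal (MvPolynomial (Fin n) ℂ) where
  carrier := {f | (ρ.tau f).mulVec v = 0}
  zero_mem' := by simp
  add_mem' := by
    intro f g hf hg
    simp only [Set.mem_ofPred_eq] at hf hg ⊢
    rw [_root_.map_add, Matrix.add_mulVec, hf, hg, add_zero]
  smul_mem' := by
    intro c f hf
    simp only [Set.mem_ofPred_eq, smul_eq_mul] at hf ⊢
    rw [map_mul, ← Matrix.mulVec_mulVec, hf, Matrix.mulVec_zero]

end RationalRep

/-- The ideal of `ℂ[S_1, …, S_n]` generated by the polynomials `S_k² - S_l²`, `S_i S_j` (`i ≠ j`)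
and `S_k³`. The cubes are needed only for `n = 1`, where the ideal is `(S_1³)`. -/
def quadricIdeal (n : ℕ) : Ideal (MvPolynomial (Fin n) ℂ) :=
  Ideal.span ({f | ∃ k l, f = MvPolynomial.X k ^ 2 - MvPolynomial.X l ^ 2} ∪
    {f | ∃ i j, i ≠ j ∧ f = MvPolynomial.X i * MvPolynomial.X j} ∪
    {f | ∃ k, f = MvPolynomial.X k ^ 3})

/-- For `n ≥ 2` the cubes are redundant generators. -/
lemma quadricIdeal_eq (n : ℕ) (hn : 2 ≤ n) : quadricIdeal n =
    Ideal.span ({f | ∃ k l, f = MvPolynomial.X k ^ 2 - MvPolynomial.X l ^ 2} ∪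
      {f | ∃ i j, i ≠ j ∧ f = MvPolynomial.X i * MvPolynomial.X j}) := by
  apply le_antisymm
  · refine Ideal.span_le.2 (Set.union_subset Ideal.subset_span ?_)
    rintro _ ⟨k, rfl⟩
    have : Nontrivial (Fin n) := Fin.nontrivial_iff_two_le.2 hn
    obtain ⟨l, hl⟩ := exists_ne k
    have e : (MvPolynomial.X k ^ 3 : MvPolynomial (Fin n) ℂ) =
        MvPolynomial.X k * (MvPolynomial.X k ^ 2 - MvPolynomial.X l ^ 2) +
          MvPolynomial.X l * (MvPolynomial.X k * MvPolynomial.X l) := by ring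
    rw [e]
    exact Ideal.add_mem _
      (Ideal.mul_mem_left _ _ (Ideal.subset_span (Or.inl ⟨k, l, rfl⟩)))
      (Ideal.mul_mem_left _ _ (Ideal.subset_span (Or.inr ⟨k, l, hl.symm, rfl⟩)))
  · exact Ideal.span_mono Set.subset_union_left

end

end QuadricAction

namespace QuadricAction

noncomputable section

/-! ### Polynomial functions -/

/-! On the affine part `x = 1` of the quadric `∑ zᵢ² = 2xy` the group can act by translations of
`z`; this action extends to the linear maps `translate`, and its orbit is dense. The theorem says
that every other case is this one after a change of coordinates and of the parameter.

A recurring tool is that a polynomial function on `ℂᵐ` without zeros is constant. It makes a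
projective representation lift to exactly one rational representation (`exists_lifts`,
`lifts_unique`), which is the exponential of commuting nilpotent operators `dρ(a)` (`exists_exp`).
It also makes the lift preserve `q` itself, and not only up to a character (`form_ev`), so the
`dρ(a)` are skew.

The core is a rigidity argument. A nilpotent self-adjoint `D` commuting with the group, with `v`
orthogonal to `D v`, yields a quadratic form vanishing on the orbit. That form is a multiple of `q`,
so `D` is scalar and hence zero (`eq_zero_of_selfAdjoint`). Therefore all products `dρ(a) dρ(b)` lie
on one line `ℂ s` (`exists_socle`), with coefficient a bilinear form in `a` and `b`. Cyclicity of
`v` and nondegeneracy of `q` show that `s² = 0`, that `s dρ(b) v = 0`, that `v`, `s v`, `dρ(z) v`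
give coordinates, and that the form on the Lie algebra is nondegenerate. Diagonalizing it gives the
normal form (`exists_frame_translate`). Uniqueness of the pair and its annihilator are then read off
from the explicit operators.

An abstract action on the quadric has to be linearized first. The charts `x ≠ 0` and `y ≠ 0` are
glued by `z ↦ z / (½ ∑ zᵢ²)`, and in each the action is given by coprime polynomials. Comparing the
two bounds the degree in `z`: the components are combinations of `1`, `zᵢ` and `½ ∑ zᵢ²`
(`eval_eq_quadratic`), hence linear in homogeneous coordinates. Since a matrix fixing all points of
the quadric is scalar (`exists_eq_smul_of_eigen`), these matrices multiply correctly in `PGL`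
(`exists_projective_extension`), and an open orbit makes the resulting pair have the quadric as
orbit closure. -/

/-- Polynomial functions on the affine space `ℂ^σ`. -/
def IsPolyFun {σ : Type*} (f : (σ → ℂ) → ℂ) : Prop :=
  ∃ p : MvPolynomial σ ℂ, ∀ v, MvPolynomial.eval v p = f v

namespace IsPolyFun

variable {σ τ : Type*} {f g h : (σ → ℂ) → ℂ}

lemma eval (p : MvPolynomial σ ℂ) : IsPolyFun fun v => MvPolynomial.eval v p := ⟨p, fun _ => rfl⟩

lemma const (c : ℂ) : IsPolyFun fun _ : σ → ℂ => c := ⟨MvPolynomial.C c, by simp⟩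

lemma coord (i : σ) : IsPolyFun fun v : σ → ℂ => v i := ⟨MvPolynomial.X i, by simp⟩

lemma add (hf : IsPolyFun f) (hg : IsPolyFun g) : IsPolyFun fun v => f v + g v := by
  obtain ⟨p, hp⟩ := hf
  obtain ⟨q, hq⟩ := hg
  exact ⟨p + q, by simp [hp, hq]⟩

lemma mul (hf : IsPolyFun f) (hg : IsPolyFun g) : IsPolyFun fun v => f v * g v := by
  obtain ⟨p, hp⟩ := hf
  obtain ⟨q, hq⟩ := hg
  exact ⟨p * q, by simp [hp, hq]⟩

lemma sub (hf : IsPolyFun f) (hg : IsPolyFun g) : IsPolyFun fun v => f v - g v := by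
  obtain ⟨p, hp⟩ := hf
  obtain ⟨q, hq⟩ := hg
  exact ⟨p - q, by simp [hp, hq]⟩

lemma neg (hf : IsPolyFun f) : IsPolyFun fun v => - f v := by
  obtain ⟨p, hp⟩ := hf
  exact ⟨-p, by simp [hp]⟩

lemma pow (hf : IsPolyFun f) (k : ℕ) : IsPolyFun fun v => f v ^ k := by
  obtain ⟨p, hp⟩ := hf
  exact ⟨p ^ k, by simp [hp]⟩

lemma sum {ι : Type*} (s : Finset ι) {f : ι → (σ → ℂ) → ℂ} (hf : ∀ i ∈ s, IsPolyFun (f i)) :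
    IsPolyFun fun v => ∑ i ∈ s, f i v := by
  classical
  induction s using Finset.induction_on with
  | empty => simpa using const 0
  | insert i s hi ih =>
    simp only [Finset.sum_insert hi]
    exact (hf i (by simp)).add (ih fun j hj => hf j (by simp [hj]))

lemma prod {ι : Type*} (s : Finset ι) {f : ι → (σ → ℂ) → ℂ} (hf : ∀ i ∈ s, IsPolyFun (f i)) :
    IsPolyFun fun v => ∏ i ∈ s, f i v := by
  classical
  induction s using Finset.induction_on with
  | empty => simpa using const 1
  | insert i s hi ih =>
    simp only [Finset.prod_insert hi]
    exact (hf i (by simp)).mul (ih fun j hj => hf j (by simp [hj]))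

lemma comp {F : (τ → ℂ) → ℂ} (hF : IsPolyFun F) {f : τ → (σ → ℂ) → ℂ}
    (hf : ∀ i, IsPolyFun (f i)) : IsPolyFun fun v => F fun i => f i v := by
  obtain ⟨p, hp⟩ := hF
  choose P hP using hf
  refine ⟨MvPolynomial.bind₁ P p, fun v => ?_⟩
  have h := MvPolynomial.aeval_bind₁ v P p
  simp only [MvPolynomial.aeval_eq_eval] at h
  simpa [hP, hp] using h

lemma linear [Fintype σ] (Λ : (σ → ℂ) →ₗ[ℂ] ℂ) : IsPolyFun fun v => Λ v := by
  classical
  have : (fun v => Λ v) = fun v : σ → ℂ => ∑ i, v i * Λ (Pi.single i 1) := by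
    funext v
    conv_lhs => rw [pi_eq_sum_univ' v]
    simp [map_sum]
  rw [this]
  exact sum _ fun i _ => (coord i).mul (const _)

lemma det {ι : Type*} [Fintype ι] [DecidableEq ι] {A : (σ → ℂ) → Matrix ι ι ℂ}
    (hA : ∀ i j, IsPolyFun fun v => A v i j) : IsPolyFun fun v => (A v).det := by
  simp only [Matrix.det_apply']
  exact sum _ fun s _ => (const _).mul (prod _ fun i _ => hA _ _)

lemma adjugate {ι : Type*} [Fintype ι] [DecidableEq ι] {A : (σ → ℂ) → Matrix ι ι ℂ}
    (hA : ∀ i j, IsPolyFun fun v => A v i j) (i j : ι) :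
    IsPolyFun fun v => (A v).adjugate i j := by
  simp only [Matrix.adjugate_apply]
  apply det
  intro k l
  by_cases hk : k = j
  · subst hk
    simpa using const _
  · simpa [Matrix.updateRow_apply, hk] using hA k l

lemma matrix_mul {ι : Type*} [Fintype ι] {A B : (σ → ℂ) → Matrix ι ι ℂ}
    (hA : ∀ i j, IsPolyFun fun v => A v i j) (hB : ∀ i j, IsPolyFun fun v => B v i j) (i j : ι) :
    IsPolyFun fun v => (A v * B v) i j := by
  simp only [Matrix.mul_apply]
  exact sum _ fun k _ => (hA _ _).mul (hB _ _)

lemma mulVec {ι : Type*} [Fintype ι] {A : (σ → ℂ) → Matrix ι ι ℂ} {w : (σ → ℂ) → ι → ℂ}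
    (hA : ∀ i j, IsPolyFun fun v => A v i j) (hw : ∀ i, IsPolyFun fun v => w v i) (i : ι) :
    IsPolyFun fun v => (A v).mulVec (w v) i := by
  simp only [Matrix.mulVec, dotProduct]
  exact sum _ fun k _ => (hA _ _).mul (hw _)

/-- The affine space is irreducible. -/
lemma exists_mul_ne_zero (hf : IsPolyFun f) (hg : IsPolyFun g) {a b : σ → ℂ} (ha : f a ≠ 0)
    (hb : g b ≠ 0) : ∃ c, f c ≠ 0 ∧ g c ≠ 0 := by
  obtain ⟨p, hp⟩ := hf
  obtain ⟨q, hq⟩ := hg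
  by_contra! H
  have : p * q = 0 := by
    apply MvPolynomial.funext
    intro c
    by_cases hc : f c = 0
    · simp [hp, hc]
    · simp [hq, H c hc]
  rcases mul_eq_zero.1 this with h | h
  · exact ha (by simp [← hp, h])
  · exact hb (by simp [← hq, h])

/-- The complement of a hypersurface in affine space is dense, so an identity of polynomials need
only be checked there. -/
lemma eq_of_forall_ne_zero (hf : IsPolyFun f) (hg : IsPolyFun g) (hh : IsPolyFun h) {b : σ → ℂ}
    (hb : h b ≠ 0) (H : ∀ v, h v ≠ 0 → f v = g v) (v : σ → ℂ) : f v = g v := by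
  by_contra hv
  obtain ⟨c, hc, hc'⟩ := (hf.sub hg).exists_mul_ne_zero hh (sub_ne_zero.2 hv) hb
  exact hc (sub_eq_zero.2 (H c hc'))

/-- The restriction of a polynomial to a parametrized line. -/
lemma exists_line (hf : IsPolyFun f) (a b : σ → ℂ) :
    ∃ p : Polynomial ℂ, ∀ t, p.eval t = f (a + t • b) := by
  obtain ⟨p, hp⟩ := hf
  refine ⟨MvPolynomial.aeval (fun i => Polynomial.C (a i) + Polynomial.X * Polynomial.C (b i)) p,
    fun t => ?_⟩
  have h := MvPolynomial.comp_aeval_apply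
    (fun i => Polynomial.C (a i) + Polynomial.X * Polynomial.C (b i)) (Polynomial.aeval t) p
  simp only [Polynomial.coe_aeval_eq_eval, MvPolynomial.aeval_eq_eval] at h
  rw [h, ← hp]
  congr 2
  funext i
  simpa using _root_.mul_comm _ _

/-- A polynomial function over `ℂ` without zeros is constant. -/
lemma const_of_ne_zero (hf : IsPolyFun f) (h0 : ∀ v, f v ≠ 0) (u v : σ → ℂ) : f u = f v := by
  obtain ⟨p, hp⟩ := hf.exists_line u (v - u)
  have hd : p.degree = 0 := by
    by_contra hd
    obtain ⟨t, ht⟩ := IsAlgClosed.exists_root p hd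
    exact h0 _ (by rw [← hp t]; exact ht)
  rw [Polynomial.eq_C_of_degree_eq_zero hd] at hp
  have h1 := hp 0
  have h2 := hp 1
  simp only [Polynomial.eval_C, zero_smul, add_zero, one_smul, add_sub_cancel] at h1 h2
  rw [← h1, ← h2]

end IsPolyFun

/-- The linear term of a polynomial along a line. -/
lemma exists_line_coeff_one {σ : Type*} [Fintype σ] (p : MvPolynomial σ ℂ) (a b : σ → ℂ) :
    ∃ P : Polynomial ℂ, (∀ t, P.eval t = MvPolynomial.eval (a + t • b) p) ∧
      P.coeff 1 = ∑ i, b i * MvPolynomial.eval a (MvPolynomial.pderiv i p) := by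
  classical
  induction p using MvPolynomial.induction_on with
  | C c => exact ⟨Polynomial.C c, by simp, by simp⟩
  | add p q hp hq =>
    obtain ⟨P, hP, hP1⟩ := hp
    obtain ⟨Q, hQ, hQ1⟩ := hq
    exact ⟨P + Q, by simp [hP, hQ], by simp [hP1, hQ1, mul_add, Finset.sum_add_distrib]⟩
  | mul_X p j hp =>
    obtain ⟨P, hP, hP1⟩ := hp
    refine ⟨P * (Polynomial.C (a j) + Polynomial.C (b j) * Polynomial.X), fun t => ?_, ?_⟩
    · simp [hP, mul_comm t]
    · have h0 : P.coeff 0 = MvPolynomial.eval a p := by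
        rw [Polynomial.coeff_zero_eq_eval_zero, hP]; simp
      rw [mul_add, Polynomial.coeff_add, Polynomial.coeff_mul_C, ← mul_assoc,
        Polynomial.coeff_mul_X (n := 0), Polynomial.coeff_mul_C, hP1, h0]
      have e : ∀ i, MvPolynomial.eval a (MvPolynomial.pderiv i (p * MvPolynomial.X j)) =
          (if i = j then MvPolynomial.eval a p else 0) +
            a j * MvPolynomial.eval a (MvPolynomial.pderiv i p) := by
        intro i
        simp only [Derivation.leibniz, smul_eq_mul, map_add, map_mul, MvPolynomial.eval_X,
          MvPolynomial.pderiv_X]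
        by_cases hij : i = j
        · subst hij; simp
        · simp [hij, Ne.symm hij]
      simp only [e, mul_add, Finset.sum_add_distrib, mul_ite, mul_zero, Finset.sum_ite_eq',
        Finset.mem_univ, if_true, Finset.sum_mul]
      rw [add_comm, mul_comm (b j)]
      congr 1
      exact Finset.sum_congr rfl fun i _ => by ring

/-- If `p(t) = t² g(1/t)`, then `p` is at most quadratic with leading coefficient `g(0)`. -/
lemma coeff_of_eval_eq_sq_mul_eval_inv {p g : Polynomial ℂ}
    (h : ∀ t : ℂ, t ≠ 0 → p.eval t = t ^ 2 * g.eval t⁻¹) :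
    p.coeff 2 = g.coeff 0 ∧ ∀ k, 2 < k → p.coeff k = 0 := by
  have key : p * Polynomial.X ^ g.natDegree = g.reverse * Polynomial.X ^ 2 := by
    -- The extra factor `X` makes the identity trivial at `t = 0`, where the hypothesis says
    -- nothing.
    have hz :
        (p * Polynomial.X ^ g.natDegree - g.reverse * Polynomial.X ^ 2) * Polynomial.X = 0 := by
      apply Polynomial.funext
      intro t
      by_cases ht : t = 0
      · simp [ht]
      · let _ : Invertible t⁻¹ := ⟨t, mul_inv_cancel₀ ht, inv_mul_cancel₀ ht⟩
        have e := Polynomial.eval₂_reverse_mul_pow (RingHom.id ℂ) t⁻¹ g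
        change Polynomial.eval₂ (RingHom.id ℂ) t g.reverse * _ = _ at e
        rw [Polynomial.eval₂_id, Polynomial.eval₂_id] at e
        simp only [Polynomial.eval_mul, Polynomial.eval_sub, Polynomial.eval_pow,
          Polynomial.eval_X, h t ht, ← e, Polynomial.eval_zero, inv_pow]
        field_simp
        ring
    exact sub_eq_zero.1 ((mul_eq_zero.1 hz).resolve_right Polynomial.X_ne_zero)
  have hc : ∀ k, 2 ≤ k → p.coeff k = g.reverse.coeff (g.natDegree + (k - 2)) := by
    intro k hk
    have := congrArg (fun r => r.coeff (k + g.natDegree)) key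
    simp only [Polynomial.coeff_mul_X_pow] at this
    rw [this, show k + g.natDegree = (g.natDegree + (k - 2)) + 2 by omega,
      Polynomial.coeff_mul_X_pow]
  refine ⟨?_, fun k hk => ?_⟩
  · rw [hc 2 le_rfl, Polynomial.coeff_reverse, Polynomial.revAt_le (by simp)]
    simp
  · rw [hc k hk.le]
    exact Polynomial.coeff_eq_zero_of_natDegree_lt
      (lt_of_le_of_lt (Polynomial.reverse_natDegree_le g) (by omega))

/-! ### Maps to projective space which are locally given by polynomials -/

/-- A family which is proportional to a coprime family is a multiple of it. -/
lemma exists_mul_of_proportional {R κ : Type*} [CommRing R] [IsDomain R]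
    [UniqueFactorizationMonoid R] [Finite κ] {F G : κ → R} (hF : ∀ d, (∀ k, d ∣ F k) → IsUnit d)
    (h : ∀ j k, F j * G k = F k * G j) : ∃ c : R, ∀ k, G k = c * F k := by
  classical
  have := Fintype.ofFinite κ
  let _ : StrongNormalizationMonoid R := UniqueFactorizationMonoid.strongNormalizationMonoid
  let _ := UniqueFactorizationMonoid.toStrongNormalizedGCDMonoid R
  have h1 : IsUnit (Finset.univ.gcd F) := hF _ fun k => Finset.gcd_dvd (Finset.mem_univ k)
  have hd : ∀ k, F k ∣ G k := by
    intro k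
    -- Proportionality makes `F k` divide every `G k * F j`, hence their gcd, which is `G k` times
    -- the gcd of `F`, a unit.
    have h2 : F k ∣ Finset.univ.gcd fun j => G k * F j := by
      refine Finset.dvd_gcd fun j _ => ?_
      rw [mul_comm, h j k]
      exact dvd_mul_right _ _
    have h3 := h2.trans (Finset.gcd_mul_left' Finset.univ F (G k)).dvd
    exact h1.dvd_mul_right.1 h3
  have hne : ∃ k, F k ≠ 0 := by
    by_contra! H
    exact not_isUnit_zero (hF 0 fun k => by rw [H k])
  obtain ⟨k, hk⟩ := hne
  obtain ⟨c, hc⟩ := hd k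
  refine ⟨c, fun j => mul_left_cancel₀ hk ?_⟩
  rw [h k j, hc]
  ring

lemma exists_coprime_of_ne_zero {R κ : Type*} [CommRing R] [IsDomain R]
    [UniqueFactorizationMonoid R] [Finite κ] {F : κ → R} (hF : F ≠ 0) :
    ∃ (c : R) (G : κ → R), c ≠ 0 ∧ (∀ k, F k = c * G k) ∧ ∀ d, (∀ k, d ∣ G k) → IsUnit d := by
  classical
  have := Fintype.ofFinite κ
  let _ : StrongNormalizationMonoid R := UniqueFactorizationMonoid.strongNormalizationMonoid
  let _ := UniqueFactorizationMonoid.toStrongNormalizedGCDMonoid R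
  obtain ⟨k, hk⟩ := Function.ne_iff.1 hF
  obtain ⟨G, hG, hG1⟩ := Finset.extract_gcd (s := Finset.univ) F ⟨k, Finset.mem_univ k⟩
  refine ⟨Finset.univ.gcd F, G, ?_, fun k => hG k (Finset.mem_univ k), fun d hd => ?_⟩
  · intro h
    exact hk (Finset.gcd_eq_zero_iff.1 h k (Finset.mem_univ k))
  · rw [isUnit_iff_dvd_one, ← hG1]
    exact Finset.dvd_gcd fun k _ => hd k

/-- A map from an affine space to a projective space which is locally given by polynomials is
globally given by polynomials without common factors. -/
theorem exists_coprime_polynomial_rep {σ κ : Type*} [Finite κ] (φ : (σ → ℂ) → κ → ℂ)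
    (h0 : ∀ v, φ v ≠ 0)
    (hloc : ∀ v₀, ∃ (D : MvPolynomial σ ℂ) (F : κ → MvPolynomial σ ℂ),
      MvPolynomial.eval v₀ D ≠ 0 ∧ ∀ v, MvPolynomial.eval v D ≠ 0 →
        ∃ c : ℂ, c ≠ 0 ∧ ∀ k, MvPolynomial.eval v (F k) = c * φ v k) :
    ∃ F : κ → MvPolynomial σ ℂ, (∀ d, (∀ k, d ∣ F k) → IsUnit d) ∧
      ∀ v, ∃ c : ℂ, c ≠ 0 ∧ ∀ k, MvPolynomial.eval v (F k) = c * φ v k := by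
  obtain ⟨D, F, hD, hF⟩ := hloc 0
  have hF0 : F ≠ 0 := by
    rintro rfl
    obtain ⟨c, hc, h⟩ := hF 0 hD
    apply h0 0
    funext k
    simpa [hc] using (h k).symm
  obtain ⟨g, G, hg, hFG, hG⟩ := exists_coprime_of_ne_zero hF0
  refine ⟨G, hG, fun v₁ => ?_⟩
  obtain ⟨D', F', hD', hF'⟩ := hloc v₁
  -- Both tuples are proportional to `φ` off the zeros of `D * D'`; multiplying by `D * D' * g`
  -- turns this into an identity of polynomials from which the nonzero factor can be cancelled.
  have hprop : ∀ j k, G j * F' k = G k * F' j := by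
    intro j k
    have hz : (D * D' * g) * (G j * F' k - G k * F' j) = 0 := by
      apply MvPolynomial.funext
      intro v
      by_cases h1 : MvPolynomial.eval v D = 0
      · simp [h1]
      by_cases h2 : MvPolynomial.eval v D' = 0
      · simp [h2]
      obtain ⟨c, -, hc⟩ := hF v h1
      obtain ⟨c', -, hc'⟩ := hF' v h2
      have e : ∀ i, MvPolynomial.eval v g * MvPolynomial.eval v (G i) = c * φ v i := by
        intro i
        rw [← hc, hFG, map_mul]
      simp only [map_mul, map_sub, map_zero, hc']
      linear_combination (MvPolynomial.eval v D * MvPolynomial.eval v D') *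
        (c' * φ v k * e j - c' * φ v j * e k)
    have hne : D * D' * g ≠ 0 := by
      refine mul_ne_zero (mul_ne_zero ?_ ?_) hg
      · rintro rfl; simp at hD
      · rintro rfl; simp at hD'
    exact sub_eq_zero.1 ((mul_eq_zero.1 hz).resolve_left hne)
  obtain ⟨h, hh⟩ := exists_mul_of_proportional hG hprop
  obtain ⟨c, hc, hcφ⟩ := hF' v₁ hD'
  -- `F' = h G` does not vanish at `v₁`, so neither does `h`, and `G` describes `φ` there as well.
  have hv : MvPolynomial.eval v₁ h ≠ 0 := by
    intro hv
    apply h0 v₁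
    funext k
    have := hcφ k
    rw [hh, map_mul, hv, zero_mul] at this
    exact (mul_eq_zero.1 this.symm).resolve_left hc
  refine ⟨c / MvPolynomial.eval v₁ h, div_ne_zero hc hv, fun k => ?_⟩
  have := hcφ k
  rw [hh, map_mul] at this
  field_simp
  rw [mul_comm, this]

end

noncomputable section

variable {n l : ℕ}

/-! ### Homogeneous polynomials and points of projective space -/

lemma eval_smul_of_isHomogeneous {d : ℕ} {f : MvPolynomial (Fin l) ℂ} (hf : f.IsHomogeneous d)
    (c : ℂ) (v : Fin l → ℂ) :
    MvPolynomial.eval (c • v) f = c ^ d * MvPolynomial.eval v f := by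
  rw [MvPolynomial.eval_eq, MvPolynomial.eval_eq, Finset.mul_sum]
  refine Finset.sum_congr rfl fun m hm => ?_
  have := hf (MvPolynomial.mem_support_iff.1 hm)
  rw [← this, Finsupp.weight_apply, Finsupp.sum]
  simp [mul_pow, Finset.prod_mul_distrib, Finset.prod_pow_eq_pow_sum]
  ring

lemma exists_rep_eq_smul {v : Fin l → ℂ} (hv : v ≠ 0) :
    ∃ c : ℂ, c ≠ 0 ∧ (Projectivization.mk ℂ v hv).rep = c • v := by
  obtain ⟨a, ha⟩ := Projectivization.exists_smul_eq_mk_rep ℂ v hv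
  exact ⟨a, a.ne_zero, ha.symm⟩

lemma mk_eq_mk_of_smul {v w : Fin l → ℂ} (hv : v ≠ 0) (hw : w ≠ 0) {c : ℂ} (h : v = c • w) :
    Projectivization.mk ℂ v hv = Projectivization.mk ℂ w hw :=
  (Projectivization.mk_eq_mk_iff' _ _ _ _ _).2 ⟨c, h.symm⟩

lemma eval_rep_eq_zero_iff {d : ℕ} {f : MvPolynomial (Fin l) ℂ} (hf : f.IsHomogeneous d)
    {v : Fin l → ℂ} (hv : v ≠ 0) :
    MvPolynomial.eval (Projectivization.mk ℂ v hv).rep f = 0 ↔ MvPolynomial.eval v f = 0 := by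
  obtain ⟨c, hc, h⟩ := exists_rep_eq_smul hv
  rw [h, eval_smul_of_isHomogeneous hf]
  simp [hc]

lemma mk_mem_quadric {q : QuadraticForm ℂ (Fin l → ℂ)} {v : Fin l → ℂ} (hv : v ≠ 0) :
    Projectivization.mk ℂ v hv ∈ quadric q ↔ q v = 0 := by
  obtain ⟨c, hc, h⟩ := exists_rep_eq_smul hv
  change q _ = 0 ↔ _
  rw [h, QuadraticMap.map_smul]
  simp [hc]

lemma mk_mem_zariskiClosure_range {ι : Type*} {γ : ι → Fin l → ℂ} (hγ : ∀ a, γ a ≠ 0)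
    {v : Fin l → ℂ} (hv : v ≠ 0) :
    Projectivization.mk ℂ v hv ∈
        zariskiClosure (Set.range fun a => Projectivization.mk ℂ (γ a) (hγ a)) ↔
      ∀ (d : ℕ) (f : MvPolynomial (Fin l) ℂ), f.IsHomogeneous d →
        (∀ a, MvPolynomial.eval (γ a) f = 0) → MvPolynomial.eval v f = 0 := by
  refine forall_congr' fun d => forall_congr' fun f => forall_congr' fun hf => ?_
  rw [Set.forall_mem_range, eval_rep_eq_zero_iff hf]
  simp only [eval_rep_eq_zero_iff hf]

lemma exists_isHomogeneous_linear (Λ : (Fin l → ℂ) →ₗ[ℂ] ℂ) :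
    ∃ f : MvPolynomial (Fin l) ℂ, f.IsHomogeneous 1 ∧ ∀ v, MvPolynomial.eval v f = Λ v := by
  refine ⟨∑ i, MvPolynomial.C (Λ (Pi.single i 1)) * MvPolynomial.X i, ?_, fun v => ?_⟩
  · refine MvPolynomial.IsHomogeneous.sum _ _ _ fun i _ => ?_
    simpa using (MvPolynomial.isHomogeneous_C (Fin l) (Λ (Pi.single i 1))).mul
      (MvPolynomial.isHomogeneous_X ℂ i)
  · conv_rhs => rw [pi_eq_sum_univ' v]
    simp [map_sum, mul_comm]

lemma exists_isHomogeneous_bilin (B : LinearMap.BilinForm ℂ (Fin l → ℂ)) :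
    ∃ f : MvPolynomial (Fin l) ℂ, f.IsHomogeneous 2 ∧ ∀ v, MvPolynomial.eval v f = B v v := by
  choose f hf hf' using fun i => exists_isHomogeneous_linear (B (Pi.single i 1))
  refine ⟨∑ i, MvPolynomial.X i * f i, ?_, fun v => ?_⟩
  · exact MvPolynomial.IsHomogeneous.sum _ _ _ fun i _ =>
      (MvPolynomial.isHomogeneous_X ℂ i).mul (hf i)
  · conv_rhs => enter [1]; rw [pi_eq_sum_univ' v]
    simp [map_sum, hf']

lemma exists_isHomogeneous_quadraticForm (q : QuadraticForm ℂ (Fin l → ℂ)) :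
    ∃ f : MvPolynomial (Fin l) ℂ, f.IsHomogeneous 2 ∧ ∀ v, MvPolynomial.eval v f = q v := by
  obtain ⟨f, hf, h⟩ := exists_isHomogeneous_bilin (QuadraticMap.associated q)
  exact ⟨f, hf, fun v => by rw [h]; exact QuadraticMap.associated_eq_self_apply ℂ q v⟩

/-! ### Hyperbolic coordinates on a nondegenerate quadric -/

/-- Linear coordinates `(x, y, z)` in which the quadratic form is `∑ zᵢ² - 2xy`. -/
structure Frame (n : ℕ) {l : ℕ} (q : QuadraticForm ℂ (Fin l → ℂ)) where
  equiv : (ℂ × ℂ × (Fin n → ℂ)) ≃ₗ[ℂ] (Fin l → ℂ)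
  form : ∀ x y z, q (equiv (x, y, z)) = (∑ i, z i ^ 2) - 2 * x * y

/-- The coordinates `(x, y, z)` in which a sum of squares is `∑ zᵢ² - 2xy`. -/
def sumSquaresCoords (n : ℕ) : (ℂ × ℂ × (Fin n → ℂ)) ≃ₗ[ℂ] (Fin (n + 2) → ℂ) where
  toFun w := Matrix.vecCons (w.1 - w.2.1 / 2)
    (Matrix.vecCons (Complex.I * (w.1 + w.2.1 / 2)) w.2.2)
  invFun v := ((v 0 - Complex.I * v 1) / 2, -(v 0 + Complex.I * v 1), fun i => v i.succ.succ)
  map_add' u w := by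
    funext i
    refine Fin.cases ?_ (fun i => Fin.cases ?_ (fun i => ?_) i) i
    · simp; ring
    · simp; ring
    · simp
  map_smul' c w := by
    funext i
    refine Fin.cases ?_ (fun i => Fin.cases ?_ (fun i => ?_) i) i
    · simp; ring
    · simp; ring
    · simp
  left_inv w := by
    obtain ⟨x, y, z⟩ := w
    have := Complex.I_mul_I
    refine Prod.ext ?_ (Prod.ext ?_ ?_)
    · simp
      linear_combination (-(x + y / 2) / 2) * this
    · simp
      linear_combination (-(x + y / 2)) * this
    · funext i
      simp
  right_inv v := by
    have := Complex.I_mul_I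
    funext i
    refine Fin.cases ?_ (fun i => Fin.cases ?_ (fun i => ?_) i) i
    · simp; ring
    · simp
      linear_combination (- v 1) * this
    · simp

lemma sumSquares_nondegenerate (m : ℕ) :
    (QuadraticMap.weightedSumSquares ℂ (1 : Fin m → ℂ)).Nondegenerate := by
  rw [QuadraticMap.nondegenerate_iff_radical_eq_bot, QuadraticForm.radical_weightedSumSquares]
  ext v
  simp [Pi.mem_spanSubset_iff, funext_iff]

/-- Over `ℂ` every nondegenerate form is a sum of squares, and two of the squares combine to the
hyperbolic plane `-2xy`. -/
theorem exists_frame {q : QuadraticForm ℂ (Fin (n + 2) → ℂ)} (hq : q.Nondegenerate) :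
    Nonempty (Frame n q) := by
  obtain ⟨e⟩ := QuadraticForm.equivalent_of_isAlgClosed
    (QuadraticMap.weightedSumSquares ℂ (1 : Fin (n + 2) → ℂ)) q
    (QuadraticMap.nondegenerate_associated_iff.2 (sumSquares_nondegenerate _)).1
    (QuadraticMap.nondegenerate_associated_iff.2 hq).1
  refine ⟨⟨(sumSquaresCoords n).trans e.toLinearEquiv, fun x y z => ?_⟩⟩
  have h := e.map_app (sumSquaresCoords n (x, y, z))
  have h2 : e (sumSquaresCoords n (x, y, z)) =
    ((sumSquaresCoords n).trans e.toLinearEquiv) (x, y, z) := rfl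
  rw [← h2, h, QuadraticMap.weightedSumSquares_apply, Fin.sum_univ_succ, Fin.sum_univ_succ]
  simp [sumSquaresCoords, ← pow_two]
  linear_combination (x + y / 2) ^ 2 * Complex.I_mul_I

namespace Frame

variable {q : QuadraticForm ℂ (Fin l → ℂ)}

lemma polar (F : Frame n q) (x y : ℂ) (z : Fin n → ℂ) (x' y' : ℂ) (z' : Fin n → ℂ) :
    QuadraticMap.polar q (F.equiv (x, y, z)) (F.equiv (x', y', z')) =
      2 * (∑ i, z i * z' i) - 2 * x * y' - 2 * x' * y := by
  rw [QuadraticMap.polar, ← map_add, Prod.mk_add_mk, Prod.mk_add_mk, F.form, F.form, F.form,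
    Finset.mul_sum]
  have : ∑ i, (z + z') i ^ 2 = ∑ i, z i ^ 2 + ∑ i, z' i ^ 2 + ∑ i, 2 * (z i * z' i) := by
    rw [← Finset.sum_add_distrib, ← Finset.sum_add_distrib]
    exact Finset.sum_congr rfl fun i _ => by simp; ring
  rw [this]
  ring

lemma polar_nondegenerate (F : Frame n q) {u : Fin l → ℂ}
    (h : ∀ w, QuadraticMap.polar q u w = 0) : u = 0 := by
  obtain ⟨⟨x, y, z⟩, rfl⟩ := F.equiv.surjective u
  have h1 := h (F.equiv (1, 0, 0))
  have h2 := h (F.equiv (0, 1, 0))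
  have h3 := fun i => h (F.equiv (0, 0, Pi.single i 1))
  simp only [F.polar] at h1 h2 h3
  simp at h1 h2
  have h4 : z = 0 := by
    funext i
    simpa [Pi.single_apply] using h3 i
  simp [h1, h2, h4]

/-- A quadratic form which vanishes on a nondegenerate quadric is a multiple of its equation. -/
theorem exists_eq_mul_of_vanish (F : Frame n q) (q' : QuadraticForm ℂ (Fin l → ℂ))
    (h : ∀ x, q x = 0 → q' x = 0) : ∃ c : ℂ, ∀ x, q' x = c * q x := by
  set b := QuadraticMap.polar q' (F.equiv (1, 0, 0)) (F.equiv (0, 1, 0)) with hb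
  have expand : ∀ (x y : ℂ) (z : Fin n → ℂ), q' (F.equiv (x, y, z)) =
      x ^ 2 * q' (F.equiv (1, 0, 0)) + y ^ 2 * q' (F.equiv (0, 1, 0)) +
      q' (F.equiv (0, 0, z)) + x * y * b +
      x * QuadraticMap.polar q' (F.equiv (1, 0, 0)) (F.equiv (0, 0, z)) +
      y * QuadraticMap.polar q' (F.equiv (0, 1, 0)) (F.equiv (0, 0, z)) := by
    intro x y z
    have e : F.equiv (x, y, z) =
        x • F.equiv (1, 0, 0) + y • F.equiv (0, 1, 0) + F.equiv (0, 0, z) := by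
      simp [← map_smul, ← map_add]
    rw [e, QuadraticMap.map_add q', QuadraticMap.map_add q', QuadraticMap.map_smul,
      QuadraticMap.map_smul, QuadraticMap.polar_add_left]
    simp only [QuadraticMap.polar_smul_left, QuadraticMap.polar_smul_right, smul_eq_mul, hb]
    ring
  have h0 : q' (F.equiv (1, 0, 0)) = 0 := h _ (by simp [F.form])
  have h1 : q' (F.equiv (0, 1, 0)) = 0 := h _ (by simp [F.form])
  refine ⟨-b / 2, fun u => ?_⟩
  obtain ⟨⟨x, y, z⟩, rfl⟩ := F.equiv.surjective u
  set R := ∑ i, z i ^ 2 with hR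
  have hv := fun (x y : ℂ) (hxy : R = 2 * x * y) =>
    (expand x y z).symm.trans (h _ (by rw [F.form, ← hR, hxy, sub_self]))
  rw [expand, h0, h1, F.form, ← hR]
  rw [h0, h1] at hv
  set B0 := QuadraticMap.polar q' (F.equiv (1, 0, 0)) (F.equiv (0, 0, z))
  set B1 := QuadraticMap.polar q' (F.equiv (0, 1, 0)) (F.equiv (0, 0, z))
  -- Four points of the quadric over the same `z`, all with `xy = R/2`. The first two differ by a
  -- sign, so their sum isolates the part even in `(x, y)`; the others kill the linear terms `B0`
  -- and `B1`.
  have e1 := hv 1 (R / 2) (by ring)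
  have e2 := hv (-1) (-R / 2) (by ring)
  have e3 := hv 2 (R / 4) (by ring)
  have e4 := hv (R / 2) 1 (by ring)
  have eB0 : B0 = 0 := by linear_combination (2 / 3) * e3 - (1 / 2) * e1 - (1 / 6) * e2
  have eB1 : B1 = 0 := by linear_combination e4 - (e1 + e2) / 2 - R / 2 * eB0
  linear_combination (e1 + e2) / 2 + x * eB0 + y * eB1

/-- An operator for which all vectors of a nondegenerate quadric are eigenvectors is scalar. -/
theorem exists_eq_smul_of_eigen (F : Frame n q) (hn : 1 ≤ n) (M : (Fin l → ℂ) →ₗ[ℂ] (Fin l → ℂ))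
    (h : ∀ x, q x = 0 → ∃ μ : ℂ, M x = μ • x) : ∃ c : ℂ, ∀ x, M x = c • x := by
  set N := F.equiv.symm.toLinearMap ∘ₗ M ∘ₗ F.equiv.toLinearMap with hN
  have hNM : ∀ w, M (F.equiv w) = F.equiv (N w) := by
    intro w
    simp [hN]
  have hNe : ∀ x y z, (∑ i, z i ^ 2) = 2 * x * y →
      ∃ μ : ℂ, N (x, y, z) = μ • (x, y, z) := by
    intro x y z hz
    obtain ⟨μ, hμ⟩ := h (F.equiv (x, y, z)) (by rw [F.form, hz, sub_self])
    exact ⟨μ, F.equiv.injective (by rw [← hNM, hμ, map_smul])⟩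
  obtain ⟨a, ha⟩ := hNe 1 0 0 (by simp)
  obtain ⟨b, hb⟩ := hNe 0 1 0 (by simp)
  have split : ∀ x y z, N (x, y, z) = x • N (1, 0, 0) + y • N (0, 1, 0) + N (0, 0, z) := by
    intro x y z
    rw [← map_smul, ← map_smul, ← map_add, ← map_add]
    simp
  have hz : ∀ i, N (0, 0, Pi.single i 1) = a • (0, 0, Pi.single i 1) ∧ a = b := by
    intro i
    have hR : ∑ j, (Pi.single i 1 : Fin n → ℂ) j ^ 2 = 1 := by
      simp [Pi.single_apply]
    -- The points `(±1, ±1/2, eᵢ)` have the same `z`-component, so their eigenvalues agree. The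
    -- difference of the two equations identifies this value with `a` and `b`, and the sum shows
    -- that `eᵢ` is an eigenvector.
    obtain ⟨μ, h1⟩ := hNe 1 (1 / 2) (Pi.single i 1) (by rw [hR]; ring)
    obtain ⟨ν, h2⟩ := hNe (-1) (-(1 / 2)) (Pi.single i 1) (by rw [hR]; ring)
    rw [split, ha, hb] at h1 h2
    generalize N (0, 0, Pi.single i 1) = w at h1 h2 ⊢
    obtain ⟨α, β, ζ⟩ := w
    simp only [Prod.smul_mk, Prod.mk_add_mk, Prod.mk.injEq, smul_eq_mul, smul_zero, add_zero,
      zero_add, mul_zero, mul_one] at h1 h2 ⊢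
    obtain ⟨h11, h12, h13⟩ := h1
    obtain ⟨h21, h22, h23⟩ := h2
    have e : μ = ν := by
      have := congrFun (h13.symm.trans h23) i
      simpa using this
    subst e
    have hμ : a = μ := by linear_combination (h11 - h21) / 2
    have hμ' : b = μ := by linear_combination h12 - h22
    refine ⟨⟨by linear_combination (h11 + h21) / 2, by linear_combination (h12 + h22) / 2, ?_⟩,
      hμ.trans hμ'.symm⟩
    rw [h13, hμ]
  have hab : a = b := (hz ⟨0, hn⟩).2
  refine ⟨a, fun u => ?_⟩
  obtain ⟨⟨x, y, z⟩, rfl⟩ := F.equiv.surjective u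
  rw [hNM, ← map_smul]
  congr 1
  have hz' : N (0, 0, z) = a • (0, 0, z) := by
    have key : N ∘ₗ LinearMap.inr ℂ ℂ _ ∘ₗ LinearMap.inr ℂ ℂ _ =
        a • (LinearMap.inr ℂ ℂ _ ∘ₗ LinearMap.inr ℂ ℂ (Fin n → ℂ)) := by
      refine LinearMap.pi_ext' fun i => LinearMap.ext_ring ?_
      simpa using (hz i).1
    simpa using LinearMap.congr_fun key z
  rw [split, ha, hb, hz', ← hab]
  simp [mul_comm]

variable (F : Frame n q)

/-- The parametrization of the affine part `x ≠ 0` of the quadric. -/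
def chart (z : Fin n → ℂ) : Fin l → ℂ := F.equiv (1, (∑ i, z i ^ 2) / 2, z)

/-- The coordinate `x`. -/
def X : (Fin l → ℂ) →ₗ[ℂ] ℂ := LinearMap.fst ℂ _ _ ∘ₗ F.equiv.symm.toLinearMap

@[simp] lemma X_chart (z : Fin n → ℂ) : F.X (F.chart z) = 1 := by simp [X, chart]

@[simp] lemma form_chart (z : Fin n → ℂ) : q (F.chart z) = 0 := by
  rw [chart, F.form]; ring

lemma chart_ne_zero (z : Fin n → ℂ) : F.chart z ≠ 0 := by
  intro h
  simpa [h] using F.X_chart z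

lemma isPolyFun_chart (j : Fin l) : IsPolyFun fun z => F.chart z j := by
  have : (fun z => F.chart z j) = fun z => F.equiv (1, 0, 0) j +
      ((∑ i, z i ^ 2) * (1 / 2)) * F.equiv (0, 1, 0) j +
      (LinearMap.proj j ∘ₗ F.equiv.toLinearMap ∘ₗ LinearMap.inr ℂ ℂ _ ∘ₗ
        LinearMap.inr ℂ ℂ _) z := by
    funext z
    have e : F.chart z = F.equiv (1, 0, 0) + ((∑ i, z i ^ 2) * (1 / 2)) • F.equiv (0, 1, 0) +
        F.equiv (0, 0, z) := by
      simp only [← map_smul, ← map_add, chart]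
      congr 1
      simp [div_eq_mul_inv]
    rw [e]
    simp
  rw [this]
  exact ((IsPolyFun.const _).add (((IsPolyFun.sum _ fun i _ => (IsPolyFun.coord i).pow 2).mul
    (IsPolyFun.const _)).mul (IsPolyFun.const _))).add (IsPolyFun.linear _)

lemma exists_eq_smul_chart {x : Fin l → ℂ} (hx : q x = 0) (h : F.X x ≠ 0) :
    ∃ z, x = F.X x • F.chart z := by
  obtain ⟨⟨x, y, z⟩, rfl⟩ := F.equiv.surjective x
  have hX : F.X (F.equiv (x, y, z)) = x := by simp [X]
  rw [hX] at h ⊢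
  rw [F.form] at hx
  refine ⟨fun i => z i / x, ?_⟩
  rw [chart, ← map_smul]
  congr 1
  refine Prod.ext (by simp) (Prod.ext ?_ ?_)
  · simp only [Prod.smul_mk, smul_eq_mul, div_pow, ← Finset.sum_div]
    field_simp
    linear_combination -hx
  · funext i
    simp
    field_simp

/-- Already the points with `z = 0` and `z = ±eᵢ` detect every coordinate of `u`. -/
lemma exists_polar_chart_ne_zero (hn : 1 ≤ n) {u : Fin l → ℂ} (hu : u ≠ 0) :
    ∃ z, QuadraticMap.polar q (F.chart z) u ≠ 0 := by
  by_contra! H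
  apply hu
  obtain ⟨⟨x, y, z⟩, rfl⟩ := F.equiv.surjective u
  simp only [chart, F.polar] at H
  have h1 := H 0
  simp at h1
  have h2 := fun i => H (Pi.single i 1)
  have h3 := fun i => H (Pi.single i (-1))
  simp [Pi.single_apply, h1] at h2 h3
  have h5 : z = 0 := by
    funext i
    simp only [Pi.zero_apply]
    linear_combination (h2 i - h3 i) / 4
  have h4 : x = 0 := by
    linear_combination -(h2 ⟨0, hn⟩ + h3 ⟨0, hn⟩) / 2
  simp [h1, h4, h5]

/-- The affine part `x ≠ 0` is dense in the quadric. -/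
theorem exists_chart_ne_zero (hn : 1 ≤ n) {f : (Fin l → ℂ) → ℂ} (hf : IsPolyFun f) {d : ℕ}
    (hd : ∀ (c : ℂ) v, f (c • v) = c ^ d * f v) {x : Fin l → ℂ} (hx : q x = 0) (hx0 : x ≠ 0)
    (h : f x ≠ 0) : ∃ z, f (F.chart z) ≠ 0 := by
  obtain ⟨z₁, h₁⟩ := F.exists_polar_chart_ne_zero hn hx0
  obtain ⟨z₂, h₂⟩ := F.exists_polar_chart_ne_zero hn (F.chart_ne_zero z₁)
  set p := F.chart z₁ with hp
  -- `Φ v` is the second intersection of the quadric with the line through `p` and `v`, and a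
  -- multiple of `v` if `q v = 0`. So the cone over the quadric is parametrized by an irreducible
  -- affine space, in which two nonempty open conditions can be met at once.
  set Φ : (Fin l → ℂ) → Fin l → ℂ := fun v => q v • p - QuadraticMap.polar q p v • v with hΦ
  have hΦq : ∀ v, q (Φ v) = 0 := by
    intro v
    have e := QuadraticMap.map_add q (q v • p) (-(QuadraticMap.polar q p v • v))
    rw [← sub_eq_add_neg] at e
    change q (q v • p - QuadraticMap.polar q p v • v) = 0
    have e' : q p = 0 := F.form_chart z₁
    simp only [e, e', QuadraticMap.map_neg, QuadraticMap.map_smul, QuadraticMap.polar_neg_right,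
      QuadraticMap.polar_smul_left, QuadraticMap.polar_smul_right, smul_eq_mul]
    ring
  have hpolar : IsPolyFun fun v => QuadraticMap.polar q p v :=
    IsPolyFun.linear (QuadraticMap.polarBilin q p)
  have hqpoly : IsPolyFun fun v => q v := by
    obtain ⟨g, -, hg⟩ := exists_isHomogeneous_quadraticForm q
    exact ⟨g, hg⟩
  have hΦpoly : ∀ j, IsPolyFun fun v => Φ v j := fun j =>
    (hqpoly.mul (IsPolyFun.const _)).sub (hpolar.mul (IsPolyFun.coord j))
  have hΦx : ∀ v, q v = 0 → Φ v = -QuadraticMap.polar q p v • v := by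
    intro v hv
    simp [hΦ, hv]
  have hk1 : f (Φ x) ≠ 0 := by
    rw [hΦx x hx, hd]
    exact mul_ne_zero (pow_ne_zero _ (neg_ne_zero.2 h₁)) h
  have hk2 : F.X (Φ (F.chart z₂)) ≠ 0 := by
    rw [hΦx _ (F.form_chart _), map_smul, X_chart, smul_eq_mul, mul_one, QuadraticMap.polar_comm]
    exact neg_ne_zero.2 h₂
  obtain ⟨v, hv, hv'⟩ := (hf.comp hΦpoly).exists_mul_ne_zero
    ((IsPolyFun.linear F.X).comp hΦpoly) hk1 hk2
  obtain ⟨z, hz⟩ := F.exists_eq_smul_chart (hΦq v) hv'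
  refine ⟨z, fun hz0 => hv ?_⟩
  change f (Φ v) = 0
  rw [hz, hd, hz0, mul_zero]

end Frame

end

noncomputable section

variable {n l : ℕ}

/-! ### The projective linear group -/

lemma GL_mulVec_ne_zero (g : GL (Fin l) ℂ) {v : Fin l → ℂ} (hv : v ≠ 0) : g.1.mulVec v ≠ 0 :=
  (smul_ne_zero_iff_ne g).2 hv

lemma mk_smul_mk (g : GL (Fin l) ℂ) {v : Fin l → ℂ} (hv : v ≠ 0) :
    Matrix.ProjGenLinGroup.mk g • Projectivization.mk ℂ v hv =
      Projectivization.mk ℂ (g.1.mulVec v) (GL_mulVec_ne_zero g hv) := rfl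

lemma mk_eq_mk_of_eq_smul {g h : GL (Fin l) ℂ} {c : ℂ} (hc : c ≠ 0) (e : g.1 = c • h.1) :
    Matrix.ProjGenLinGroup.mk g = Matrix.ProjGenLinGroup.mk h := by
  refine (Matrix.ProjGenLinGroup.mk_eq_mk_iff.2 ⟨Units.mk0 c hc, Units.ext ?_⟩).symm
  rw [Units.val_mul, Matrix.GeneralLinearGroup.coe_scalar, e]
  simp [Matrix.scalar_apply, ← Matrix.smul_one_eq_diagonal]

lemma exists_eq_smul_of_mk_eq {g h : GL (Fin l) ℂ}
    (e : Matrix.ProjGenLinGroup.mk g = Matrix.ProjGenLinGroup.mk h) :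
    ∃ c : ℂ, c ≠ 0 ∧ g.1 = c • h.1 := by
  obtain ⟨u, hu⟩ := Matrix.ProjGenLinGroup.mk_eq_mk_iff.1 e.symm
  refine ⟨u, u.ne_zero, ?_⟩
  rw [← hu, Units.val_mul, Matrix.GeneralLinearGroup.coe_scalar]
  simp [Matrix.scalar_apply, ← Matrix.smul_one_eq_diagonal]

namespace RationalRep

/-! ### Values and the derivative of a rational representation -/

/-- The value `ρ(a)`. -/
def ev (ρ : RationalRep n l) (a : Fin n → ℂ) : Matrix (Fin l) (Fin l) ℂ :=
  ρ.mat.map (MvPolynomial.eval a)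

lemma isPolyFun_ev (ρ : RationalRep n l) (i j : Fin l) : IsPolyFun fun a => ρ.ev a i j :=
  ⟨ρ.mat i j, fun _ => rfl⟩

@[simp] lemma ev_zero (ρ : RationalRep n l) : ρ.ev 0 = 1 := ρ.map_zero

lemma ev_add (ρ : RationalRep n l) (a b : Fin n → ℂ) : ρ.ev (a + b) = ρ.ev a * ρ.ev b :=
  ρ.map_add a b

lemma ev_neg_mul (ρ : RationalRep n l) (a : Fin n → ℂ) : ρ.ev (-a) * ρ.ev a = 1 := by
  rw [← ev_add, neg_add_cancel, ev_zero]

lemma ev_mul_neg (ρ : RationalRep n l) (a : Fin n → ℂ) : ρ.ev a * ρ.ev (-a) = 1 := by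
  rw [← ev_add, add_neg_cancel, ev_zero]

lemma ev_ext {ρ ρ' : RationalRep n l} (h : ∀ a, ρ.ev a = ρ'.ev a) : ρ = ρ' := by
  have : ρ.mat = ρ'.mat := by
    ext1 i j
    exact MvPolynomial.funext fun a => congrFun (congrFun (h a) i) j
  cases ρ
  cases ρ'
  congr

/-- A matrix-valued polynomial function which is a homomorphism is a rational representation. -/
lemma exists_of_isPolyFun {A : (Fin n → ℂ) → Matrix (Fin l) (Fin l) ℂ}
    (hA : ∀ i j, IsPolyFun fun a => A a i j) (h0 : A 0 = 1)
    (hadd : ∀ a b, A (a + b) = A a * A b) : ∃ ρ : RationalRep n l, ∀ a, ρ.ev a = A a := by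
  choose P hP using hA
  have e : ∀ a, (Matrix.of P).map (MvPolynomial.eval a) = A a := by
    intro a
    ext i j
    exact hP i j a
  exact ⟨⟨Matrix.of P, by rw [e, h0], fun a b => by rw [e, e, e, hadd]⟩, e⟩

/-- The invertible matrix `ρ(a)`. -/
def toGL (ρ : RationalRep n l) (a : Fin n → ℂ) : GL (Fin l) ℂ :=
  ⟨ρ.ev a, ρ.ev (-a), ρ.ev_mul_neg a, ρ.ev_neg_mul a⟩

lemma lifts_iff {ρ : RationalRep n l} {ρ' : Multiplicative (Fin n → ℂ) →* PGL(Fin l, ℂ)} :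
    ρ.Lifts ρ' ↔ ∀ a, Matrix.ProjGenLinGroup.mk (ρ.toGL a) = ρ' (Multiplicative.ofAdd a) := by
  refine forall_congr' fun a => ⟨?_, fun h => ⟨_, rfl, h⟩⟩
  rintro ⟨g, hg, hg'⟩
  rw [← hg']
  congr 1
  exact Units.ext hg.symm

/-- The derivative of `ρ` at `0` in the direction `a`. -/
def deriv (ρ : RationalRep n l) (a : Fin n → ℂ) : Matrix (Fin l) (Fin l) ℂ :=
  ∑ i, a i • ρ.infGen i

lemma deriv_add (ρ : RationalRep n l) (a b : Fin n → ℂ) :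
    ρ.deriv (a + b) = ρ.deriv a + ρ.deriv b := by
  simp [deriv, add_smul, Finset.sum_add_distrib]

lemma deriv_smul (ρ : RationalRep n l) (c : ℂ) (a : Fin n → ℂ) :
    ρ.deriv (c • a) = c • ρ.deriv a := by
  simp [deriv, mul_smul, Finset.smul_sum]

lemma deriv_comm (ρ : RationalRep n l) (a b : Fin n → ℂ) :
    ρ.deriv a * ρ.deriv b = ρ.deriv b * ρ.deriv a := by
  refine Commute.sum_left _ _ _ fun i _ => Commute.sum_right _ _ _ fun j _ => ?_
  exact (Commute.smul_left (show Commute _ _ from ρ.infGen_comm i j) _).smul_right _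

/-- A rational representation is the exponential of its derivative, which is nilpotent. -/
theorem exists_exp (ρ : RationalRep n l) (a : Fin n → ℂ) : ∃ N : ℕ, 2 ≤ N ∧ ρ.deriv a ^ N = 0 ∧
    ∀ t : ℂ, ρ.ev (t • a) =
      ∑ k ∈ Finset.range N, (t ^ k * (k.factorial : ℂ)⁻¹) • ρ.deriv a ^ k := by
  choose P hP hP1 using fun i j => exists_line_coeff_one (ρ.mat i j) 0 a
  have hP' : ∀ i j t, (P i j).eval t = ρ.ev (t • a) i j := by
    intro i j t
    rw [hP, zero_add]; rfl
  -- The coefficient of `t ^ k` in the matrix polynomial `ρ(t a)`.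
  set X : ℕ → Matrix (Fin l) (Fin l) ℂ := fun k => Matrix.of fun i j => (P i j).coeff k with hX
  have hX0 : X 0 = 1 := by
    ext i j
    change (P i j).coeff 0 = _
    rw [Polynomial.coeff_zero_eq_eval_zero, hP', zero_smul, ev_zero]
  have hX1 : ∀ i j, (P i j).coeff 1 = ρ.deriv a i j := by
    intro i j
    rw [hP1]
    simp [deriv, Matrix.sum_apply, infGen]
  -- The derivative of `ρ((s + t) a) = ρ(s a) ρ(t a)` at `s = 0` is the differential equation `P' =
  -- dρ(a) P`; this is its form for the coefficients.
  have hrec : ∀ k : ℕ, ((k : ℂ) + 1) • X (k + 1) = ρ.deriv a * X k := by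
    have hd : ∀ i j, Polynomial.derivative (P i j) =
        ∑ k, Polynomial.C (ρ.deriv a i k) * P k j := by
      intro i j
      apply Polynomial.funext
      intro t
      have e : Polynomial.taylor t (P i j) = ∑ k, P i k * Polynomial.C ((P k j).eval t) := by
        apply Polynomial.funext
        intro s
        simp [Polynomial.taylor_eval, Polynomial.eval_finsetSum, hP', add_smul, ev_add,
          Matrix.mul_apply]
      rw [← Polynomial.taylor_coeff_one, e]
      simp [Polynomial.finsetSum_coeff, Polynomial.eval_finsetSum, hX1]
    intro k
    ext i j
    have := congrArg (fun p => p.coeff k) (hd i j)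
    simp only [Polynomial.coeff_derivative, Polynomial.finsetSum_coeff,
      Polynomial.coeff_C_mul] at this
    simp only [hX, Matrix.smul_apply, Matrix.of_apply, Matrix.mul_apply, smul_eq_mul]
    rw [← this, mul_comm]
  have hXk : ∀ k, X k = (k.factorial : ℂ)⁻¹ • ρ.deriv a ^ k := by
    intro k
    induction k with
    | zero => simp [hX0]
    | succ k ih =>
      have hk : (k : ℂ) + 1 ≠ 0 := by exact_mod_cast k.succ_ne_zero
      have := hrec k
      rw [ih, Matrix.mul_smul, ← pow_succ'] at this
      rw [Nat.factorial_succ, Nat.cast_mul, mul_inv, mul_smul, ← this, smul_smul]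
      push_cast
      rw [inv_mul_cancel₀ hk, one_smul]
  -- Beyond all degrees, so that `X N = 0` gives nilpotency, and at least 2, so that the sum always
  -- contains the linear term.
  set N := (Finset.univ.sup fun i => Finset.univ.sup fun j => (P i j).natDegree) + 2 with hN
  have hdeg : ∀ i j, (P i j).natDegree < N := by
    intro i j
    have h1 : (P i j).natDegree ≤ Finset.univ.sup fun j => (P i j).natDegree :=
      Finset.le_sup (f := fun j => (P i j).natDegree) (Finset.mem_univ j)
    have h2 := Finset.le_sup (f := fun i => Finset.univ.sup fun j => (P i j).natDegree)
      (Finset.mem_univ i)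
    change (Finset.univ.sup fun j => (P i j).natDegree) ≤ _ at h2
    omega
  refine ⟨N, by omega, ?_, fun t => ?_⟩
  · have h0 : X N = 0 := by
      ext i j
      exact Polynomial.coeff_eq_zero_of_natDegree_lt (hdeg i j)
    rw [hXk] at h0
    exact (smul_eq_zero.1 h0).resolve_left (inv_ne_zero (by exact_mod_cast N.factorial_ne_zero))
  · ext i j
    rw [← hP', Polynomial.eval_eq_sum_range' (hdeg i j), Matrix.sum_apply]
    refine Finset.sum_congr rfl fun k _ => ?_
    have := congrFun (congrFun (hXk k) i) j
    simp only [hX, Matrix.of_apply] at this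
    rw [this, mul_smul]
    simp [mul_comm]

lemma isNilpotent_deriv (ρ : RationalRep n l) (a : Fin n → ℂ) : IsNilpotent (ρ.deriv a) :=
  let ⟨N, _, h, _⟩ := ρ.exists_exp a
  ⟨N, h⟩

/-- A subspace invariant under the derivative of `ρ` is invariant under `ρ`. -/
lemma ev_mulVec_mem (ρ : RationalRep n l) {W : Submodule ℂ (Fin l → ℂ)}
    (hW : ∀ a, ∀ w ∈ W, (ρ.deriv a).mulVec w ∈ W) (a : Fin n → ℂ) {w : Fin l → ℂ} (hw : w ∈ W) :
    (ρ.ev a).mulVec w ∈ W := by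
  obtain ⟨N, -, -, h⟩ := ρ.exists_exp a
  have h1 := h 1
  rw [one_smul] at h1
  rw [h1, Matrix.sum_mulVec]
  refine Submodule.sum_mem _ fun k hk => ?_
  clear hk
  rw [Matrix.smul_mulVec]
  refine Submodule.smul_mem _ _ ?_
  induction k with
  | zero => simpa
  | succ k ih =>
    rw [pow_succ', ← Matrix.mulVec_mulVec]
    exact hW _ _ ih

/-- Allows identities between values of a representation to be differentiated by comparing
coefficients of polynomials in `t`. -/
lemma exists_polynomial_apply (ρ : RationalRep n l) (a : Fin n → ℂ)
    (Λ : Matrix (Fin l) (Fin l) ℂ →ₗ[ℂ] ℂ) :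
    ∃ p : Polynomial ℂ, (∀ t, p.eval t = Λ (ρ.ev (t • a))) ∧ p.coeff 1 = Λ (ρ.deriv a) := by
  obtain ⟨N, hN, -, h⟩ := ρ.exists_exp a
  refine ⟨∑ k ∈ Finset.range N, Polynomial.monomial k
    ((k.factorial : ℂ)⁻¹ * Λ (ρ.deriv a ^ k)), fun t => ?_, ?_⟩
  · rw [h, map_sum, Polynomial.eval_finsetSum]
    refine Finset.sum_congr rfl fun k _ => ?_
    rw [Polynomial.eval_monomial, map_smul, smul_eq_mul]
    ring
  · rw [Polynomial.finsetSum_coeff, Finset.sum_eq_single 1]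
    · simp
    · intro k _ hk
      simp [Polynomial.coeff_monomial, hk]
    · intro h
      simp at h
      omega

/-- Linear relations between values of representations may be differentiated. -/
lemma deriv_relation {m : ℕ} (ρ : RationalRep n l) (ρ' : RationalRep n m) {a b : Fin n → ℂ}
    {Λ : Matrix (Fin l) (Fin l) ℂ →ₗ[ℂ] ℂ} {Λ' : Matrix (Fin m) (Fin m) ℂ →ₗ[ℂ] ℂ}
    (h : ∀ t : ℂ, Λ (ρ.ev (t • a)) = Λ' (ρ'.ev (t • b))) : Λ (ρ.deriv a) = Λ' (ρ'.deriv b) := by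
  obtain ⟨p, hp, hp1⟩ := ρ.exists_polynomial_apply a Λ
  obtain ⟨p', hp', hp1'⟩ := ρ'.exists_polynomial_apply b Λ'
  have e : p = p' := Polynomial.funext fun t => by rw [hp, hp', h]
  rw [← hp1, ← hp1', e]

/-- The derivative is the linear term of `ρ`. -/
lemma deriv_mulVec_eq_of_expansion (ρ : RationalRep n l) {a : Fin n → ℂ} {x y z : Fin l → ℂ}
    (h : ∀ t : ℂ, (ρ.ev (t • a)).mulVec x = x + t • y + t ^ 2 • z) :
    (ρ.deriv a).mulVec x = y := by
  funext j
  obtain ⟨p, hp, hp1⟩ := ρ.exists_polynomial_apply a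
    (LinearMap.proj j ∘ₗ (Matrix.mulVecBilin ℂ ℂ).flip x)
  have e : p = Polynomial.C (x j) + Polynomial.C (y j) * Polynomial.X +
      Polynomial.C (z j) * Polynomial.X ^ 2 := by
    apply Polynomial.funext
    intro t
    have := congrFun (h t) j
    rw [hp]
    simp at this ⊢
    rw [this]
    ring
  rw [e] at hp1
  simp [Polynomial.coeff_C, Polynomial.coeff_X_pow] at hp1
  exact hp1.symm

/-! ### Lifting projective representations -/

/-- Coprime polynomial entries represent the map globally. Their determinant has no zeros, so it is
constant; after normalization at `0` the factor by which the matrix function fails to be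
multiplicative is a polynomial on `ℂⁿ × ℂⁿ` without zeros, so it is constantly 1. -/
theorem exists_lifts (hl : 0 < l) (ρ' : Multiplicative (Fin n → ℂ) →* PGL(Fin l, ℂ))
    (hρ : IsRegularToPGL ρ') : ∃ ρ : RationalRep n l, ρ.Lifts ρ' := by
  choose g hg using fun a => Matrix.ProjGenLinGroup.mk_surjective (ρ' (Multiplicative.ofAdd a))
  have hmap : ∀ (P : Matrix (Fin l) (Fin l) (MvPolynomial (Fin n) ℂ)) a,
      MvPolynomial.eval a P.det = (P.map (MvPolynomial.eval a)).det := fun P a =>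
    RingHom.map_det _ _
  obtain ⟨F, -, hF⟩ := exists_coprime_polynomial_rep
    (φ := fun a (k : Fin l × Fin l) => (g a).1 k.1 k.2) (by
      intro a h0
      refine (g a).det_ne_zero ?_
      have : (g a).1 = 0 := by
        ext i j
        exact congrFun h0 (i, j)
      rw [this]
      have : Nonempty (Fin l) := ⟨⟨0, hl⟩⟩
      exact Matrix.det_zero) (by
      intro a₀
      obtain ⟨P, hP, h⟩ := hρ a₀
      refine ⟨P.det, fun k => P k.1 k.2, by rwa [hmap], fun a ha => ?_⟩
      rw [hmap] at ha
      obtain ⟨c, hc, e⟩ := exists_eq_smul_of_mk_eq ((h a ha).symm.trans (hg a).symm)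
      exact ⟨c, hc, fun k => congrFun (congrFun e k.1) k.2⟩)
  choose c hc hcF using hF
  set A : (Fin n → ℂ) → Matrix (Fin l) (Fin l) ℂ := fun a =>
    Matrix.of fun i j => MvPolynomial.eval a (F (i, j)) with hA
  have hAg : ∀ a, A a = c a • (g a).1 := by
    intro a
    ext i j
    exact hcF a (i, j)
  obtain ⟨κ, hκ, hκ0⟩ : ∃ κ : ℂ, κ ≠ 0 ∧ A 0 = κ • 1 := by
    obtain ⟨d, hd, e⟩ := exists_eq_smul_of_mk_eq (g := g 0) (h := 1) (by rw [hg]; simp)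
    exact ⟨c 0 * d, mul_ne_zero (hc 0) hd, by rw [hAg, e, smul_smul]; rfl⟩
  set B : (Fin n → ℂ) → Matrix (Fin l) (Fin l) ℂ := fun a => κ⁻¹ • A a with hB
  have hB0 : B 0 = 1 := by
    change κ⁻¹ • A 0 = 1
    rw [hκ0, smul_smul, inv_mul_cancel₀ hκ, one_smul]
  have hBpoly : ∀ i j, IsPolyFun fun a => B a i j := fun i j =>
    (IsPolyFun.const κ⁻¹).mul (IsPolyFun.eval (F (i, j)))
  have hBg : ∀ a, B a = (κ⁻¹ * c a) • (g a).1 := by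
    intro a
    change κ⁻¹ • A a = _
    rw [hAg, smul_smul]
  have hBc : ∀ a, κ⁻¹ * c a ≠ 0 := fun a => mul_ne_zero (inv_ne_zero hκ) (hc a)
  have hdet : ∀ a, (B a).det = 1 := by
    intro a
    have h := (IsPolyFun.det hBpoly).const_of_ne_zero (fun a => by
      rw [hBg, Matrix.det_smul]
      exact mul_ne_zero (pow_ne_zero _ (hBc a)) (g a).det_ne_zero) a 0
    rw [h, hB0, Matrix.det_one]
  have hadj : ∀ a, B a * (B a).adjugate = 1 := fun a => by
    rw [Matrix.mul_adjugate, hdet, one_smul]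
  -- `χ` is the defect of multiplicativity at the pair of points encoded in `w`; it exists because
  -- `B` represents a homomorphism to `PGL`.
  have hχ : ∀ w : Fin n ⊕ Fin n → ℂ, ∃ χ : ℂ, χ ≠ 0 ∧
      B ((fun i => w (.inl i)) + fun i => w (.inr i)) =
        χ • (B (fun i => w (.inl i)) * B (fun i => w (.inr i))) := by
    intro w
    set a := fun i => w (.inl i)
    set b := fun i => w (.inr i)
    obtain ⟨d, hd, e⟩ := exists_eq_smul_of_mk_eq (g := g (a + b)) (h := g a * g b) (by
      rw [map_mul, hg, hg, hg, ofAdd_add, map_mul])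
    refine ⟨(κ⁻¹ * c (a + b)) * d * ((κ⁻¹ * c a)⁻¹ * (κ⁻¹ * c b)⁻¹), ?_, ?_⟩
    · exact mul_ne_zero (mul_ne_zero (hBc _) hd)
        (mul_ne_zero (inv_ne_zero (hBc _)) (inv_ne_zero (hBc _)))
    · rw [hBg, hBg a, hBg b, e, Matrix.smul_mul, Matrix.mul_smul, smul_smul, smul_smul, smul_smul,
        Units.val_mul]
      congr 1
      have h1 := hBc a
      have h2 := hBc b
      generalize κ⁻¹ * c a = α at *
      generalize κ⁻¹ * c b = β at *
      field_simp
  choose χ hχ0 hχ1 using hχ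
  -- Since the determinants are 1, the adjugates are the inverses, and they are polynomial. Hence so
  -- is `χ`, which is read off from one diagonal entry.
  have e : ∀ w, χ w = (B ((fun i => w (.inl i)) + fun i => w (.inr i)) *
      ((B fun i => w (.inr i)).adjugate * (B fun i => w (.inl i)).adjugate))
        ⟨0, hl⟩ ⟨0, hl⟩ := by
    intro w
    rw [hχ1, Matrix.smul_mul, Matrix.mul_assoc, ← Matrix.mul_assoc (B _) (B _).adjugate, hadj,
      Matrix.one_mul, hadj]
    simp
  have hχpoly : IsPolyFun χ := by
    rw [funext e]
    refine IsPolyFun.matrix_mul (fun i j => ?_) (IsPolyFun.matrix_mul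
      (IsPolyFun.adjugate fun i j => ?_) (IsPolyFun.adjugate fun i j => ?_)) _ _
    · exact (hBpoly i j).comp fun i =>
        (IsPolyFun.coord (Sum.inl i)).add (IsPolyFun.coord (Sum.inr i))
    · exact (hBpoly i j).comp fun i => IsPolyFun.coord (Sum.inr i)
    · exact (hBpoly i j).comp fun i => IsPolyFun.coord (Sum.inl i)
  have hχ2 : ∀ w, χ w = 1 := by
    intro w
    rw [hχpoly.const_of_ne_zero hχ0 w 0, e]
    simp only [Pi.zero_apply]
    change (B (0 + 0) * ((B 0).adjugate * (B 0).adjugate)) _ _ = 1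
    simp [hB0]
  obtain ⟨ρ, hρB⟩ := exists_of_isPolyFun hBpoly hB0 fun a b => by
    have := hχ1 (Sum.elim a b)
    rw [hχ2, one_smul] at this
    exact this
  refine ⟨ρ, lifts_iff.2 fun a => ?_⟩
  rw [← hg a]
  exact mk_eq_mk_of_eq_smul (hBc a) ((hρB a).trans (hBg a))

/-- The ratio of two lifts is a polynomial without zeros with value 1 at `0`. -/
theorem lifts_unique (hl : 0 < l) {ρ' : Multiplicative (Fin n → ℂ) →* PGL(Fin l, ℂ)}
    {ρ₁ ρ₂ : RationalRep n l} (h₁ : ρ₁.Lifts ρ') (h₂ : ρ₂.Lifts ρ') : ρ₁ = ρ₂ := by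
  rw [lifts_iff] at h₁ h₂
  have key : ∀ a, ∃ c : ℂ, c ≠ 0 ∧ ρ₁.ev a = c • ρ₂.ev a := fun a =>
    exists_eq_smul_of_mk_eq ((h₁ a).trans (h₂ a).symm)
  choose c hc hcρ using key
  have e : ∀ a, c a = (ρ₁.ev a * ρ₂.ev (-a)) ⟨0, hl⟩ ⟨0, hl⟩ := by
    intro a
    rw [hcρ, Matrix.smul_mul, ev_mul_neg]
    simp
  have hpoly : IsPolyFun c := by
    rw [funext e]
    exact IsPolyFun.matrix_mul ρ₁.isPolyFun_ev
      (fun i j => (ρ₂.isPolyFun_ev i j).comp fun i => (IsPolyFun.coord i).neg) _ _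
  refine ev_ext fun a => ?_
  have h1 : c 0 = 1 := by rw [e]; simp
  rw [hcρ, hpoly.const_of_ne_zero hc a 0, h1, one_smul]

end RationalRep

end

/-! ### Representations with a dense orbit on a quadric: invariance and rigidity -/

noncomputable section

variable {n l : ℕ}

/-- The quadric spans the space: it contains `(1, 0, 0)` and `(0, 1, 0)`, and every `z` extends to a
point of it. -/
lemma Frame.eq_zero_of_vanish {q : QuadraticForm ℂ (Fin l → ℂ)} (F : Frame n q)
    {Λ : (Fin l → ℂ) →ₗ[ℂ] ℂ} (h : ∀ x, q x = 0 → Λ x = 0) : Λ = 0 := by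
  have h0 : Λ (F.equiv (1, 0, 0)) = 0 := h _ (by simp [F.form])
  have h1 : Λ (F.equiv (0, 1, 0)) = 0 := h _ (by simp [F.form])
  refine LinearMap.ext fun u => ?_
  obtain ⟨⟨x, y, z⟩, rfl⟩ := F.equiv.surjective u
  have e : ∀ x y : ℂ, F.equiv (x, y, z) =
      x • F.equiv (1, 0, 0) + y • F.equiv (0, 1, 0) + F.equiv (0, 0, z) := by
    intro x y
    simp [← map_smul, ← map_add]
  have h2 := h (F.equiv (1, (∑ i, z i ^ 2) / 2, z)) (by rw [F.form]; ring)
  rw [e, map_add, map_add, map_smul, map_smul, h0, h1] at h2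
  rw [e, map_add, map_add, map_smul, map_smul, h0, h1]
  simpa using h2

namespace RationalRep

lemma commute_ev_of_commute_deriv (ρ : RationalRep n l) {D : Matrix (Fin l) (Fin l) ℂ}
    {a : Fin n → ℂ} (h : Commute D (ρ.deriv a)) : Commute D (ρ.ev a) := by
  obtain ⟨N, -, -, e⟩ := ρ.exists_exp a
  have e1 := e 1
  rw [one_smul] at e1
  rw [e1]
  exact Commute.sum_right _ _ _ fun k _ => (h.pow_right k).smul_right _

/-- The exponential series applied to `w` stops after the quadratic term, even if `dρ(a)` has larger
nilpotency order on other vectors. -/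
lemma ev_mulVec_of_cube (ρ : RationalRep n l) {a : Fin n → ℂ} {w : Fin l → ℂ}
    (h : (ρ.deriv a).mulVec ((ρ.deriv a).mulVec ((ρ.deriv a).mulVec w)) = 0) :
    (ρ.ev a).mulVec w = w + (ρ.deriv a).mulVec w +
      (1 / 2 : ℂ) • (ρ.deriv a).mulVec ((ρ.deriv a).mulVec w) := by
  obtain ⟨N, -, hN, e⟩ := ρ.exists_exp a
  have e1 := e 1
  rw [one_smul] at e1
  rw [e1, Matrix.sum_mulVec]
  have h3 : ∀ k, 3 ≤ k → (ρ.deriv a ^ k).mulVec w = 0 := by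
    intro k hk
    obtain ⟨j, rfl⟩ := Nat.exists_eq_add_of_le' hk
    rw [pow_add, ← Matrix.mulVec_mulVec, show (3 : ℕ) = 1 + 1 + 1 from rfl, pow_add, pow_add,
      pow_one, ← Matrix.mulVec_mulVec, ← Matrix.mulVec_mulVec, h, Matrix.mulVec_zero]
  have hsub : ∀ k, ((1 ^ k * (k.factorial : ℂ)⁻¹) • ρ.deriv a ^ k).mulVec w =
      (k.factorial : ℂ)⁻¹ • (ρ.deriv a ^ k).mulVec w := by
    intro k
    rw [Matrix.smul_mulVec, one_pow, one_mul]
  simp only [hsub]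
  -- `N` may lie on either side of 3, so the sums up to `N` and up to 3 are both compared with the
  -- sum up to `N + 3`.
  have hA : ∑ k ∈ Finset.range N, (k.factorial : ℂ)⁻¹ • (ρ.deriv a ^ k).mulVec w =
      ∑ k ∈ Finset.range (N + 3), (k.factorial : ℂ)⁻¹ • (ρ.deriv a ^ k).mulVec w := by
    refine Finset.sum_subset (Finset.range_subset_range.2 (by omega)) fun k _ hk => ?_
    rw [Finset.mem_range, not_lt] at hk
    rw [pow_eq_zero_of_le hk hN, Matrix.zero_mulVec, smul_zero]
  have hB : ∑ k ∈ Finset.range 3, (k.factorial : ℂ)⁻¹ • (ρ.deriv a ^ k).mulVec w =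
      ∑ k ∈ Finset.range (N + 3), (k.factorial : ℂ)⁻¹ • (ρ.deriv a ^ k).mulVec w := by
    refine Finset.sum_subset (Finset.range_subset_range.2 (by omega)) fun k _ hk => ?_
    rw [Finset.mem_range, not_lt] at hk
    rw [h3 k hk, smul_zero]
  rw [hA, ← hB]
  simp [Finset.sum_range_succ, pow_succ, ← Matrix.mulVec_mulVec]

/-- The closure of the orbit of the line of `v` is the quadric `q = 0`. -/
structure OrbitDense (ρ : RationalRep n l) (v : Fin l → ℂ) (q : QuadraticForm ℂ (Fin l → ℂ)) :
    Prop where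
  orbit : ∀ a, q ((ρ.ev a).mulVec v) = 0
  dense : ∀ (d : ℕ) (f : MvPolynomial (Fin l) ℂ), f.IsHomogeneous d →
    (∀ a, MvPolynomial.eval ((ρ.ev a).mulVec v) f = 0) → ∀ x, q x = 0 → MvPolynomial.eval x f = 0

namespace OrbitDense

variable {ρ : RationalRep n l} {v : Fin l → ℂ} {q : QuadraticForm ℂ (Fin l → ℂ)}

lemma form_v (h : ρ.OrbitDense v q) : q v = 0 := by
  simpa using h.orbit 0

lemma dense_quadraticForm (h : ρ.OrbitDense v q) (q' : QuadraticForm ℂ (Fin l → ℂ))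
    (hq' : ∀ a, q' ((ρ.ev a).mulVec v) = 0) {x : Fin l → ℂ} (hx : q x = 0) : q' x = 0 := by
  obtain ⟨f, hf, e⟩ := exists_isHomogeneous_quadraticForm q'
  rw [← e]
  exact h.dense 2 f hf (fun a => by rw [e, hq']) x hx

/-- The vector `v` is cyclic. -/
lemma eq_top_of_invariant (h : ρ.OrbitDense v q) (F : Frame n q)
    {W : Submodule ℂ (Fin l → ℂ)} (hv : v ∈ W) (hW : ∀ a, ∀ w ∈ W, (ρ.deriv a).mulVec w ∈ W) :
    W = ⊤ := by
  by_contra hne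
  obtain ⟨Λ, hΛ, hΛW⟩ := Submodule.exists_le_ker_of_lt_top W (lt_top_iff_ne_top.2 hne)
  apply hΛ
  refine F.eq_zero_of_vanish fun x hx => ?_
  obtain ⟨f, hf, e⟩ := exists_isHomogeneous_linear Λ
  rw [← e]
  exact h.dense 1 f hf (fun a => by rw [e]; exact hΛW (ρ.ev_mulVec_mem hW a hv)) x hx

/-- The representation preserves the quadratic form. -/
lemma form_ev (h : ρ.OrbitDense v q) (F : Frame n q) (a : Fin n → ℂ) (x : Fin l → ℂ) :
    q ((ρ.ev a).mulVec x) = q x := by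
  -- `ρ(a)` maps the orbit to itself, so the pullback of `q` vanishes on the orbit and then on its
  -- closure, the quadric.
  have key : ∀ a, ∃ c : ℂ, ∀ x, q ((ρ.ev a).mulVec x) = c * q x := by
    intro a
    refine F.exists_eq_mul_of_vanish (q.comp (ρ.ev a).mulVecLin) fun x hx => ?_
    refine h.dense_quadraticForm _ (fun b => ?_) hx
    change q ((ρ.ev a).mulVec ((ρ.ev b).mulVec v)) = 0
    rw [Matrix.mulVec_mulVec, ← ev_add, h.orbit]
  choose c hc using key
  -- A vector with `q u = 1`, from which the factor `c a` can be read off as a polynomial in `a`. It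
  -- has no zeros, so it equals its value 1 at `0`.
  set u := F.equiv (1, -(1 / 2), 0) with hu
  have hqu : q u = 1 := by
    rw [hu, F.form]
    simp
  have hcu : ∀ a, c a = q ((ρ.ev a).mulVec u) := by
    intro a
    rw [hc, hqu, mul_one]
  have hpoly : IsPolyFun c := by
    rw [funext hcu]
    obtain ⟨f, -, e⟩ := exists_isHomogeneous_quadraticForm q
    exact IsPolyFun.comp ⟨f, e⟩
      (IsPolyFun.mulVec ρ.isPolyFun_ev fun i => IsPolyFun.const (u i))
  have hc0 : ∀ a, c a ≠ 0 := by
    intro a ha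
    have h1 := hc (-a) ((ρ.ev a).mulVec u)
    rw [Matrix.mulVec_mulVec, ev_neg_mul, Matrix.one_mulVec, hqu, ← hcu, ha, mul_zero] at h1
    exact one_ne_zero h1
  rw [hc, hpoly.const_of_ne_zero hc0 a 0, hcu 0, ev_zero, Matrix.one_mulVec, hqu, one_mul]

lemma polar_ev (h : ρ.OrbitDense v q) (F : Frame n q) (a : Fin n → ℂ) (x y : Fin l → ℂ) :
    QuadraticMap.polar q ((ρ.ev a).mulVec x) ((ρ.ev a).mulVec y) = QuadraticMap.polar q x y := by
  simp only [QuadraticMap.polar, ← Matrix.mulVec_add, h.form_ev F]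

/-- The derivative is skew-symmetric. -/
lemma polar_deriv (h : ρ.OrbitDense v q) (F : Frame n q) (a : Fin n → ℂ) (x y : Fin l → ℂ) :
    QuadraticMap.polar q ((ρ.deriv a).mulVec x) y =
      -QuadraticMap.polar q x ((ρ.deriv a).mulVec y) := by
  -- Invariance in the form `⟨ρ(ta) x, y⟩ = ⟨x, ρ(-ta) y⟩`, differentiated at `t = 0`.
  have := deriv_relation ρ ρ (a := a) (b := -a)
    (Λ := (QuadraticMap.polarBilin q).flip y ∘ₗ (Matrix.mulVecBilin ℂ ℂ).flip x)
    (Λ' := QuadraticMap.polarBilin q x ∘ₗ (Matrix.mulVecBilin ℂ ℂ).flip y) (fun t => by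
      change QuadraticMap.polar q ((ρ.ev (t • a)).mulVec x) y =
        QuadraticMap.polar q x ((ρ.ev (t • -a)).mulVec y)
      rw [← h.polar_ev F (t • a) x, Matrix.mulVec_mulVec, smul_neg, ev_mul_neg,
        Matrix.one_mulVec])
  change QuadraticMap.polar q ((ρ.deriv a).mulVec x) y =
    QuadraticMap.polar q x ((ρ.deriv (-a)).mulVec y) at this
  rw [this, ← neg_one_smul ℂ a, deriv_smul, neg_one_smul, Matrix.neg_mulVec,
    QuadraticMap.polar_neg_right]

/-- A nilpotent self-adjoint operator `D` commuting with `ρ` vanishes if `v` is orthogonal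
to `D v`, since the quadric is the only one which contains the orbit. -/
lemma eq_zero_of_selfAdjoint (h : ρ.OrbitDense v q) (F : Frame n q)
    {D : Matrix (Fin l) (Fin l) ℂ} (hD : IsNilpotent D) (hc : ∀ a, Commute D (ρ.deriv a))
    (hs : ∀ x y, QuadraticMap.polar q (D.mulVec x) y = QuadraticMap.polar q x (D.mulVec y))
    (hv : QuadraticMap.polar q v (D.mulVec v) = 0) : D = 0 := by
  -- `q' x = ⟨x, D x⟩` is constant on the orbit, because `D` commutes with `ρ` and `ρ` preserves the
  -- polar form; by `hv` the constant is 0.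
  set q' : QuadraticForm ℂ (Fin l → ℂ) :=
    LinearMap.BilinMap.toQuadraticMap
      ((QuadraticMap.polarBilin q).compl₂ D.mulVecLin) with hq'
  have hq'a : ∀ x, q' x = QuadraticMap.polar q x (D.mulVec x) := fun x => rfl
  obtain ⟨c, hc'⟩ := F.exists_eq_mul_of_vanish q' fun x hx => by
    refine h.dense_quadraticForm q' (fun a => ?_) hx
    rw [hq'a, Matrix.mulVec_mulVec, (ρ.commute_ev_of_commute_deriv (hc a)).eq,
      ← Matrix.mulVec_mulVec, h.polar_ev F, hv]
  -- Polarization of `q' = c q`; self-adjointness makes the two mixed terms equal.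
  have hpol : ∀ x y, QuadraticMap.polar q x (D.mulVec y) = c / 2 * QuadraticMap.polar q x y := by
    intro x y
    have h1 := hc' (x + y)
    have h2 := hc' x
    have h3 := hc' y
    have h4 : QuadraticMap.polar q y (D.mulVec x) = QuadraticMap.polar q x (D.mulVec y) := by
      rw [QuadraticMap.polar_comm, hs]
    rw [hq'a] at h1 h2 h3
    rw [QuadraticMap.map_add q, Matrix.mulVec_add, QuadraticMap.polar_add_left,
      QuadraticMap.polar_add_right, QuadraticMap.polar_add_right, h4] at h1
    linear_combination (h1 - h2 - h3) / 2
  have hscal : ∀ y, D.mulVec y = (c / 2) • y := by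
    intro y
    rw [← sub_eq_zero]
    refine F.polar_nondegenerate fun w => ?_
    rw [QuadraticMap.polar_comm, QuadraticMap.polar_sub_right, hpol,
      QuadraticMap.polar_smul_right, smul_eq_mul, sub_self]
  have hD' : D = (c / 2) • 1 := by
    refine Matrix.ext_of_mulVec_single fun i => ?_
    rw [hscal, Matrix.smul_mulVec, Matrix.one_mulVec]
  obtain ⟨N, hN⟩ := hD
  rw [hD', smul_pow, one_pow] at hN
  rcases smul_eq_zero.1 hN with h0 | h0
  · rw [hD', eq_zero_of_pow_eq_zero h0, zero_smul]
  · rw [hD', h0, smul_zero]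

end OrbitDense

end RationalRep

end

/-! ### Normal form: translations of an affine chart -/

noncomputable section

variable {n : ℕ}

/-- The standard unipotent action of `𝔾ₐⁿ` in the coordinates `(x, y, z)`; on the affine part
`x = 1` of the quadric `∑ zᵢ² = 2xy` it is given by the translations of `z`. -/
def translate (a : Fin n → ℂ) : (ℂ × ℂ × (Fin n → ℂ)) →ₗ[ℂ] (ℂ × ℂ × (Fin n → ℂ)) where
  toFun w := (w.1, w.2.1 + (∑ i, a i * w.2.2 i) + w.1 * (∑ i, a i ^ 2) / 2, w.2.2 + w.1 • a)
  map_add' u w := by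
    refine Prod.ext (by simp) (Prod.ext ?_ ?_)
    · simp [mul_add, Finset.sum_add_distrib]
      ring
    · simp [add_smul]
      abel
  map_smul' c w := by
    refine Prod.ext (by simp) (Prod.ext ?_ ?_)
    · simp only [Prod.smul_snd, Prod.smul_fst, Pi.smul_apply, smul_eq_mul, RingHom.id_apply,
        mul_left_comm _ c, ← Finset.mul_sum]
      ring
    · simp [mul_smul]

lemma translate_apply (a : Fin n → ℂ) (x y : ℂ) (z : Fin n → ℂ) : translate a (x, y, z) =
    (x, y + (∑ i, a i * z i) + x * (∑ i, a i ^ 2) / 2, z + x • a) := rfl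

lemma translate_zero (w : ℂ × ℂ × (Fin n → ℂ)) : translate 0 w = w := by
  obtain ⟨x, y, z⟩ := w
  simp [translate_apply]

lemma translate_add (a b : Fin n → ℂ) (w : ℂ × ℂ × (Fin n → ℂ)) :
    translate (a + b) w = translate a (translate b w) := by
  obtain ⟨x, y, z⟩ := w
  simp only [translate_apply]
  refine Prod.ext rfl (Prod.ext ?_ ?_)
  · simp only [Pi.add_apply, Pi.smul_apply, smul_eq_mul, add_sq, add_mul, mul_add,
      Finset.sum_add_distrib, mul_left_comm _ x, ← Finset.mul_sum, mul_assoc]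
    ring
  · simp only [smul_add]
    abel

namespace RationalRep.OrbitDense

variable {l : ℕ} {ρ : RationalRep n l} {v : Fin l → ℂ} {q : QuadraticForm ℂ (Fin l → ℂ)}

/-- By skewness, the number which `eq_zero_of_selfAdjoint` tests on a product `dρ(a) dρ(b)` is a
symmetric bilinear form on the Lie algebra. -/
lemma polar_v_mul (h : ρ.OrbitDense v q) (F : Frame n q) (a b : Fin n → ℂ) :
    QuadraticMap.polar q v ((ρ.deriv a * ρ.deriv b).mulVec v) =
      -QuadraticMap.polar q ((ρ.deriv a).mulVec v) ((ρ.deriv b).mulVec v) := by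
  rw [← Matrix.mulVec_mulVec, h.polar_deriv F, neg_neg]

lemma isNilpotent_deriv_mul (ρ : RationalRep n l) (a b : Fin n → ℂ) :
    IsNilpotent (ρ.deriv a * ρ.deriv b) :=
  Commute.isNilpotent_mul_right (ρ.deriv_comm a b) (ρ.isNilpotent_deriv a)

lemma commute_deriv_mul (ρ : RationalRep n l) (a b c : Fin n → ℂ) :
    Commute (ρ.deriv a * ρ.deriv b) (ρ.deriv c) :=
  Commute.mul_left (ρ.deriv_comm a c) (ρ.deriv_comm b c)

lemma selfAdjoint_deriv_mul (h : ρ.OrbitDense v q) (F : Frame n q) (a b : Fin n → ℂ)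
    (x y : Fin l → ℂ) : QuadraticMap.polar q ((ρ.deriv a * ρ.deriv b).mulVec x) y =
      QuadraticMap.polar q x ((ρ.deriv a * ρ.deriv b).mulVec y) := by
  rw [← Matrix.mulVec_mulVec, h.polar_deriv F, h.polar_deriv F, neg_neg, Matrix.mulVec_mulVec,
    ρ.deriv_comm]

end RationalRep.OrbitDense

namespace RationalRep.OrbitDense

variable {ρ : RationalRep n (n + 2)} {v : Fin (n + 2) → ℂ}
  {q : QuadraticForm ℂ (Fin (n + 2) → ℂ)}

/-- Otherwise rigidity kills all products `dρ(a) dρ(b)`, and `v` with the `dρ(a) v` spans an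
invariant subspace. It would be everything by cyclicity, but its dimension is at most `n + 1`. -/
lemma exists_polar_deriv_ne_zero (h : ρ.OrbitDense v q) (F : Frame n q) :
    ∃ a b, QuadraticMap.polar q ((ρ.deriv a).mulVec v) ((ρ.deriv b).mulVec v) ≠ 0 := by
  by_contra! H
  have h0 : ∀ a b, ρ.deriv a * ρ.deriv b = 0 := fun a b =>
    h.eq_zero_of_selfAdjoint F (isNilpotent_deriv_mul ρ a b) (commute_deriv_mul ρ a b)
      (h.selfAdjoint_deriv_mul F a b) (by rw [h.polar_v_mul F, H, neg_zero])
  let G : ℂ × (Fin n → ℂ) →ₗ[ℂ] (Fin (n + 2) → ℂ) :=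
    { toFun := fun w => w.1 • v + (ρ.deriv w.2).mulVec v
      map_add' := fun u w => by
        simp only [Prod.fst_add, Prod.snd_add, deriv_add, Matrix.add_mulVec, add_smul]
        abel
      map_smul' := fun c w => by
        simp [deriv_smul, Matrix.smul_mulVec, mul_smul] }
  have htop : LinearMap.range G = ⊤ := by
    refine h.eq_top_of_invariant F ⟨(1, 0), by simp [G, deriv]⟩ ?_
    rintro a _ ⟨⟨x, b⟩, rfl⟩
    refine ⟨(0, x • a), ?_⟩
    simp [G, Matrix.mulVec_add, Matrix.mulVec_smul, deriv_smul, Matrix.smul_mulVec,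
      Matrix.mulVec_mulVec, h0]
  have := LinearMap.finrank_range_le G
  rw [htop] at this
  simp at this
  omega

/-- The products of the infinitesimal generators span a line. -/
lemma exists_socle (h : ρ.OrbitDense v q) (F : Frame n q) :
    ∃ s : Matrix (Fin (n + 2)) (Fin (n + 2)) ℂ, s ≠ 0 ∧ IsNilpotent s ∧
      (∀ a, Commute s (ρ.deriv a)) ∧
      (∀ x y, QuadraticMap.polar q (s.mulVec x) y = QuadraticMap.polar q x (s.mulVec y)) ∧
      QuadraticMap.polar q v (s.mulVec v) = -2 ∧
      ∀ a b, ρ.deriv a * ρ.deriv b =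
        (QuadraticMap.polar q ((ρ.deriv a).mulVec v) ((ρ.deriv b).mulVec v) / 2) • s := by
  obtain ⟨a, b, hab⟩ := h.exists_polar_deriv_ne_zero F
  set r := fun a b => QuadraticMap.polar q ((ρ.deriv a).mulVec v) ((ρ.deriv b).mulVec v) / 2
  -- Chosen to make `⟨v, s v⟩ = -2`, the pairing of `(1, 0, 0)` and `(0, 1, 0)` in a frame.
  set c := (r a b)⁻¹ with hc
  have hrab : r a b ≠ 0 := div_ne_zero hab two_ne_zero
  have hc0 : c ≠ 0 := inv_ne_zero hrab
  have hr : ∀ a b, QuadraticMap.polar q v ((ρ.deriv a * ρ.deriv b).mulVec v) = -2 * r a b := by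
    intro a b
    rw [h.polar_v_mul F]
    simp only [r]
    ring
  have hnil : IsNilpotent (c • (ρ.deriv a * ρ.deriv b)) := (isNilpotent_deriv_mul ρ a b).smul c
  have hcomm : ∀ e, Commute (c • (ρ.deriv a * ρ.deriv b)) (ρ.deriv e) := fun e =>
    (commute_deriv_mul ρ a b e).smul_left c
  have hself : ∀ x y, QuadraticMap.polar q ((c • (ρ.deriv a * ρ.deriv b)).mulVec x) y =
      QuadraticMap.polar q x ((c • (ρ.deriv a * ρ.deriv b)).mulVec y) := by
    intro x y
    rw [Matrix.smul_mulVec, Matrix.smul_mulVec, QuadraticMap.polar_smul_left,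
      QuadraticMap.polar_smul_right, h.selfAdjoint_deriv_mul F]
  have hval : QuadraticMap.polar q v ((c • (ρ.deriv a * ρ.deriv b)).mulVec v) = -2 := by
    rw [Matrix.smul_mulVec, QuadraticMap.polar_smul_right, hr, smul_eq_mul, hc]
    field_simp
  refine ⟨c • (ρ.deriv a * ρ.deriv b), ?_, hnil, hcomm, hself, hval, fun e f => ?_⟩
  · intro h0
    rw [h0, Matrix.zero_mulVec, QuadraticMap.polar_zero_right] at hval
    norm_num at hval
  -- The product and `r e f • s` pair equally with `v`, so rigidity applies to their difference.
  · rw [← sub_eq_zero]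
    change ρ.deriv e * ρ.deriv f - r e f • _ = 0
    refine h.eq_zero_of_selfAdjoint F ?_ (fun g => ?_) (fun x y => ?_) ?_
    · refine Commute.isNilpotent_sub ?_ (isNilpotent_deriv_mul ρ e f) (hnil.smul _)
      exact Commute.smul_right (Commute.mul_left (hcomm e).symm (hcomm f).symm) _
    · exact (commute_deriv_mul ρ e f g).sub_left ((hcomm g).smul_left _)
    · rw [Matrix.sub_mulVec, Matrix.sub_mulVec, QuadraticMap.polar_sub_left,
        QuadraticMap.polar_sub_right, Matrix.smul_mulVec (r e f), Matrix.smul_mulVec (r e f),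
        QuadraticMap.polar_smul_left, QuadraticMap.polar_smul_right, hself,
        h.selfAdjoint_deriv_mul F]
    · rw [Matrix.sub_mulVec, QuadraticMap.polar_sub_right, Matrix.smul_mulVec,
        QuadraticMap.polar_smul_right, hval, hr, smul_eq_mul]
      ring

/-- Coordinates in which a representation with a dense orbit on a quadric acts by translations. -/
theorem exists_frame_translate (h : ρ.OrbitDense v q) (F : Frame n q) :
    ∃ (σ : (Fin n → ℂ) ≃ₗ[ℂ] (Fin n → ℂ)) (G : Frame n q), G.equiv (1, 0, 0) = v ∧
      ∀ a w, (ρ.ev (σ a)).mulVec (G.equiv w) = G.equiv (translate a w) := by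
  obtain ⟨s, hs0, hsnil, hscomm, hsself, hsv, hsr⟩ := h.exists_socle F
  -- By rigidity `s * s` is a multiple of `s`, and nilpotency of `s` forces the factor to be 0.
  have hss : s * s = 0 := by
    set β := QuadraticMap.polar q v ((s * s).mulVec v) / (-2) with hβ
    have e : s * s = β • s := by
      rw [← sub_eq_zero]
      refine h.eq_zero_of_selfAdjoint F ?_ (fun g => ?_) (fun x y => ?_) ?_
      · refine Commute.isNilpotent_sub ?_ (Commute.isNilpotent_mul_right rfl hsnil)
          (hsnil.smul _)
        exact Commute.smul_right (Commute.mul_left rfl rfl) _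
      · exact ((hscomm g).mul_left (hscomm g)).sub_left ((hscomm g).smul_left _)
      · simp only [Matrix.sub_mulVec, QuadraticMap.polar_sub_left, QuadraticMap.polar_sub_right,
          Matrix.smul_mulVec, QuadraticMap.polar_smul_left, QuadraticMap.polar_smul_right,
          hsself, ← Matrix.mulVec_mulVec]
      · rw [Matrix.sub_mulVec, QuadraticMap.polar_sub_right, Matrix.smul_mulVec,
          QuadraticMap.polar_smul_right, hsv, smul_eq_mul, hβ]
        ring
    have hpow : ∀ k, s ^ (k + 1) = β ^ k • s := by
      intro k
      induction k with
      | zero => simp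
      | succ k ih => rw [pow_succ, ih, Matrix.smul_mul, e, smul_smul, pow_succ]
    obtain ⟨N, hN⟩ := hsnil
    have h1 := hpow N
    rw [pow_succ, hN, zero_mul] at h1
    have hβ0 : β = 0 :=
      eq_zero_of_pow_eq_zero ((smul_eq_zero.1 h1.symm).resolve_right hs0)
    rw [e, hβ0, zero_smul]
  have hMs : ∀ a w, (ρ.deriv a).mulVec (s.mulVec w) = s.mulVec ((ρ.deriv a).mulVec w) := by
    intro a w
    rw [Matrix.mulVec_mulVec, Matrix.mulVec_mulVec, (hscomm a).eq]
  have hs2 : ∀ w, s.mulVec (s.mulVec w) = 0 := by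
    intro w
    rw [Matrix.mulVec_mulVec, hss, Matrix.zero_mulVec]
  have hMM : ∀ a b w, (ρ.deriv a).mulVec ((ρ.deriv b).mulVec w) =
      (QuadraticMap.polar q ((ρ.deriv a).mulVec v) ((ρ.deriv b).mulVec v) / 2) • s.mulVec w := by
    intro a b w
    rw [Matrix.mulVec_mulVec, hsr, Matrix.smul_mulVec]
  -- `s` is self-adjoint, `dρ(b)` is skew and they commute, so this number is its own negative.
  have hvM : ∀ b, QuadraticMap.polar q v (s.mulVec ((ρ.deriv b).mulVec v)) = 0 := by
    intro b
    have h1 : QuadraticMap.polar q v (s.mulVec ((ρ.deriv b).mulVec v)) =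
        -QuadraticMap.polar q v (s.mulVec ((ρ.deriv b).mulVec v)) := by
      conv_lhs => rw [← hsself, QuadraticMap.polar_comm, h.polar_deriv F, hMs]
    linear_combination h1 / 2
  -- The vectors `v`, `s v`, `dρ(a) v`, `s dρ(c) v` span an invariant subspace, hence everything by
  -- cyclicity. `s dρ(b) v` is orthogonal to all of them.
  have hsM : ∀ b, s.mulVec ((ρ.deriv b).mulVec v) = 0 := by
    let G : ℂ × ℂ × (Fin n → ℂ) × (Fin n → ℂ) →ₗ[ℂ] (Fin (n + 2) → ℂ) :=
      { toFun := fun w => w.1 • v + w.2.1 • s.mulVec v + (ρ.deriv w.2.2.1).mulVec v +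
          s.mulVec ((ρ.deriv w.2.2.2).mulVec v)
        map_add' := fun u w => by
          simp only [Prod.fst_add, Prod.snd_add, deriv_add, Matrix.add_mulVec, add_smul,
            Matrix.mulVec_add]
          abel
        map_smul' := fun c w => by
          simp [deriv_smul, Matrix.smul_mulVec, mul_smul, Matrix.mulVec_smul] }
    have htop : LinearMap.range G = ⊤ := by
      refine h.eq_top_of_invariant F ⟨(1, 0, 0, 0), by simp [G, deriv]⟩ ?_
      rintro a _ ⟨⟨x, y, b, c⟩, rfl⟩
      refine ⟨(0, QuadraticMap.polar q ((ρ.deriv a).mulVec v) ((ρ.deriv b).mulVec v) / 2,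
        x • a, y • a), ?_⟩
      simp only [G, LinearMap.coe_mk, AddHom.coe_mk, Matrix.mulVec_add, Matrix.mulVec_smul,
        deriv_smul, Matrix.smul_mulVec, hMs, hMM, hs2, smul_zero]
      module
    intro b
    refine F.polar_nondegenerate fun w => ?_
    obtain ⟨⟨x, y, a, c⟩, rfl⟩ : w ∈ LinearMap.range G := by rw [htop]; trivial
    simp only [G, LinearMap.coe_mk, AddHom.coe_mk, QuadraticMap.polar_add_right,
      QuadraticMap.polar_smul_right]
    rw [← hsself, ← hsself, hs2, QuadraticMap.polar_zero_left, QuadraticMap.polar_zero_left,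
      QuadraticMap.polar_comm q _ v, hvM]
    have h2 := h.polar_deriv F a (s.mulVec ((ρ.deriv b).mulVec v)) v
    rw [hMs, hMM, Matrix.mulVec_smul, hs2, smul_zero, QuadraticMap.polar_zero_left] at h2
    rw [neg_eq_zero.1 h2.symm]
    simp
  -- With `s dρ(b) v = 0` the last family is superfluous; the remaining `n + 2` parameters are
  -- coordinates by a dimension count.
  let G : ℂ × ℂ × (Fin n → ℂ) →ₗ[ℂ] (Fin (n + 2) → ℂ) :=
    { toFun := fun w => w.1 • v + w.2.1 • s.mulVec v + (ρ.deriv w.2.2).mulVec v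
      map_add' := fun u w => by
        simp only [Prod.fst_add, Prod.snd_add, deriv_add, Matrix.add_mulVec, add_smul]
        abel
      map_smul' := fun c w => by
        simp [deriv_smul, Matrix.smul_mulVec, mul_smul] }
  have hGa : ∀ x y z, G (x, y, z) = x • v + y • s.mulVec v + (ρ.deriv z).mulVec v :=
    fun x y z => rfl
  have htop : LinearMap.range G = ⊤ := by
    refine h.eq_top_of_invariant F ⟨(1, 0, 0), by simp [G, deriv]⟩ ?_
    rintro a _ ⟨⟨x, y, b⟩, rfl⟩
    refine ⟨(0, QuadraticMap.polar q ((ρ.deriv a).mulVec v) ((ρ.deriv b).mulVec v) / 2, x • a), ?_⟩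
    simp only [G, LinearMap.coe_mk, AddHom.coe_mk, Matrix.mulVec_add, Matrix.mulVec_smul,
      deriv_smul, Matrix.smul_mulVec, hMs, hMM, hsM, smul_zero]
    module
  have hfin : Module.finrank ℂ (ℂ × ℂ × (Fin n → ℂ)) = Module.finrank ℂ (Fin (n + 2) → ℂ) := by
    simp
    omega
  have hsurj : Function.Surjective G := LinearMap.range_eq_top.1 htop
  have hinj : Function.Injective G :=
    (LinearMap.injective_iff_surjective_of_finrank_eq_finrank hfin).2 hsurj
  let E : (ℂ × ℂ × (Fin n → ℂ)) ≃ₗ[ℂ] (Fin (n + 2) → ℂ) := LinearEquiv.ofBijective G ⟨hinj, hsurj⟩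
  have hEa : ∀ w, E w = G w := fun w => rfl
  have hvMz : ∀ z, QuadraticMap.polar q v ((ρ.deriv z).mulVec v) = 0 := by
    intro z
    have h1 := h.polar_deriv F z v v
    rw [QuadraticMap.polar_comm] at h1
    linear_combination h1 / 2
  have hsMz : ∀ z, QuadraticMap.polar q (s.mulVec v) ((ρ.deriv z).mulVec v) = 0 := by
    intro z
    rw [hsself, hsM, QuadraticMap.polar_zero_right]
  have hqs : q (s.mulVec v) = 0 := by
    have h1 := QuadraticMap.polar_self q (s.mulVec v)
    rw [hsself, hs2, QuadraticMap.polar_zero_right] at h1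
    simpa using h1.symm
  have hform : ∀ x y z, q (G (x, y, z)) = q ((ρ.deriv z).mulVec v) - 2 * x * y := by
    intro x y z
    rw [hGa, QuadraticMap.map_add q, QuadraticMap.map_add q, QuadraticMap.polar_add_left,
      QuadraticMap.map_smul, QuadraticMap.map_smul, hqs, h.form_v]
    simp only [QuadraticMap.polar_smul_left, QuadraticMap.polar_smul_right, hvMz, hsMz, hsv,
      smul_eq_mul]
    ring
  let D : (Fin n → ℂ) →ₗ[ℂ] (Fin (n + 2) → ℂ) := G ∘ₗ LinearMap.inr ℂ ℂ _ ∘ₗ LinearMap.inr ℂ ℂ _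
  have hDa : ∀ z, D z = (ρ.deriv z).mulVec v := fun z => by
    change G (0, 0, z) = _
    simp [hGa]
  let R : QuadraticForm ℂ (Fin n → ℂ) := q.comp D
  have hRpolar : ∀ z w, QuadraticMap.polar R z w =
      QuadraticMap.polar q ((ρ.deriv z).mulVec v) ((ρ.deriv w).mulVec v) := by
    intro z w
    simp only [QuadraticMap.polar, R, QuadraticMap.comp_apply, hDa, deriv_add, Matrix.add_mulVec]
  -- For `z` in the radical, `dρ(z) v` is orthogonal to `v`, `s v` and all `dρ(w) v`, so it is zero;
  -- injectivity of `G` gives `z = 0`.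
  have hR : R.Nondegenerate := by
    rw [← QuadraticMap.nondegenerate_polar_iff, LinearMap.IsRefl.nondegenerate_iff_separatingLeft]
    · intro z hz
      have h0 : (ρ.deriv z).mulVec v = 0 := by
        refine F.polar_nondegenerate fun u => ?_
        obtain ⟨⟨x, y, w⟩, rfl⟩ := hsurj u
        rw [hGa, QuadraticMap.polar_add_right, QuadraticMap.polar_add_right,
          QuadraticMap.polar_smul_right, QuadraticMap.polar_smul_right,
          QuadraticMap.polar_comm q _ v, hvMz, QuadraticMap.polar_comm q _ (s.mulVec v), hsMz,
          ← hRpolar]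
        simpa using hz w
      have h1 : G (0, 0, z) = G 0 := by rw [hGa, h0]; simp
      simpa using congrArg (fun w => w.2.2) (hinj h1)
    · intro x y hxy
      rw [QuadraticMap.polarBilin_apply_apply, QuadraticMap.polar_comm]
      exact hxy
  -- Bringing `R` to a sum of squares is the change of parameter `σ`.
  obtain ⟨e⟩ := QuadraticForm.equivalent_of_isAlgClosed
    (QuadraticMap.weightedSumSquares ℂ (1 : Fin n → ℂ)) R
    (QuadraticMap.nondegenerate_associated_iff.2 (sumSquares_nondegenerate _)).1
    (QuadraticMap.nondegenerate_associated_iff.2 hR).1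
  have heR : ∀ z, q ((ρ.deriv (e z)).mulVec v) = ∑ i, z i ^ 2 := by
    intro z
    have h1 : R (e z) = _ := e.map_app z
    rw [← hDa]
    refine h1.trans ?_
    simp [QuadraticMap.weightedSumSquares_apply, pow_two]
  have hep : ∀ a z, QuadraticMap.polar q ((ρ.deriv (e a)).mulVec v) ((ρ.deriv (e z)).mulVec v) =
      2 * ∑ i, a i * z i := by
    intro a z
    rw [QuadraticMap.polar, ← Matrix.add_mulVec, ← deriv_add, ← _root_.map_add, heR, heR, heR,
      Finset.mul_sum, ← Finset.sum_sub_distrib, ← Finset.sum_sub_distrib]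
    exact Finset.sum_congr rfl fun i _ => by simp; ring
  let σ : (Fin n → ℂ) ≃ₗ[ℂ] (Fin n → ℂ) := e.toLinearEquiv
  have hσ : ∀ z, σ z = e z := fun z => rfl
  refine ⟨σ, ⟨((LinearEquiv.refl ℂ ℂ).prodCongr ((LinearEquiv.refl ℂ ℂ).prodCongr σ)).trans E,
    fun x y z => ?_⟩, ?_, ?_⟩
  · change q (G (x, y, σ z)) = _
    rw [hform, hσ, heR]
  · change G (1, 0, σ 0) = v
    rw [_root_.map_zero, hGa]
    simp [deriv]
  · rintro a ⟨x, y, z⟩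
    change (ρ.ev (e a)).mulVec (G (x, y, e z)) =
      G (x, y + (∑ i, a i * z i) + x * (∑ i, a i ^ 2) / 2, e (z + x • a))
    -- The exponential on the three kinds of coordinate vectors: two steps `v → dρ v → s v`, none
    -- from `s v`, one from `dρ(z) v`.
    have h1 : (ρ.ev (e a)).mulVec v = v + (ρ.deriv (e a)).mulVec v +
        ((∑ i, a i ^ 2) / 2) • s.mulVec v := by
      rw [ρ.ev_mulVec_of_cube, hMM, hep, smul_smul]
      · simp only [pow_two]
        congr 2
        ring
      · rw [hMM, hsM, smul_zero]
    have h2 : (ρ.ev (e a)).mulVec (s.mulVec v) = s.mulVec v := by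
      rw [ρ.ev_mulVec_of_cube, hMs, hsM]
      · simp
      · simp [hMs, hsM]
    have h3 : (ρ.ev (e a)).mulVec ((ρ.deriv (e z)).mulVec v) = (ρ.deriv (e z)).mulVec v +
        (∑ i, a i * z i) • s.mulVec v := by
      rw [ρ.ev_mulVec_of_cube, hMM, hep, Matrix.mulVec_smul, hMs, hsM]
      · simp
      · rw [hMM, hMM, Matrix.mulVec_smul, hs2, smul_zero, smul_zero]
    rw [hGa, hGa, Matrix.mulVec_add, Matrix.mulVec_add, Matrix.mulVec_smul, Matrix.mulVec_smul,
      h1, h2, h3, _root_.map_add, map_smul, deriv_add, deriv_smul, Matrix.add_mulVec,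
      Matrix.smul_mulVec]
    module

end RationalRep.OrbitDense

end

noncomputable section

variable {n l : ℕ}

/-! ### The representation by translations -/

/-- Makes the polynomial dependence on `a` visible. -/
lemma Frame.equiv_translate {q : QuadraticForm ℂ (Fin l → ℂ)} (G : Frame n q) (a : Fin n → ℂ)
    (w : ℂ × ℂ × (Fin n → ℂ)) : G.equiv (translate a w) = G.equiv w +
      ((∑ i, a i * w.2.2 i) + w.1 * (∑ i, a i ^ 2) * (1 / 2)) • G.equiv (0, 1, 0) +
      w.1 • G.equiv (0, 0, a) := by
  obtain ⟨x, y, z⟩ := w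
  rw [translate_apply, ← map_smul, ← map_smul, ← map_add, ← map_add]
  congr 1
  refine Prod.ext (by simp) (Prod.ext ?_ (by simp))
  simp
  ring

lemma Frame.matrix_ext {q : QuadraticForm ℂ (Fin l → ℂ)} (G : Frame n q)
    {M N : Matrix (Fin l) (Fin l) ℂ}
    (h : ∀ w, M.mulVec (G.equiv w) = N.mulVec (G.equiv w)) : M = N :=
  Matrix.mulVec_injective <| funext fun u => by
    obtain ⟨w, rfl⟩ := G.equiv.surjective u
    exact h w

/-- The representation `ρ` acts by translations in the coordinates of the frame `G`, after the
linear change `σ` of the parameter. -/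
def RationalRep.Translates (ρ : RationalRep n l) (σ : (Fin n → ℂ) ≃ₗ[ℂ] (Fin n → ℂ))
    {q : QuadraticForm ℂ (Fin l → ℂ)} (G : Frame n q) : Prop :=
  ∀ a w, (ρ.ev (σ a)).mulVec (G.equiv w) = G.equiv (translate a w)

theorem Frame.exists_translates {q : QuadraticForm ℂ (Fin l → ℂ)} (G : Frame n q) :
    ∃ ρ : RationalRep n l, ρ.Translates (LinearEquiv.refl ℂ _) G := by
  set A : (Fin n → ℂ) → Matrix (Fin l) (Fin l) ℂ := fun a => LinearMap.toMatrix'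
    (G.equiv.toLinearMap ∘ₗ translate a ∘ₗ G.equiv.symm.toLinearMap) with hA
  have hAe : ∀ a w, (A a).mulVec (G.equiv w) = G.equiv (translate a w) := fun a w => by
    rw [hA, ← Matrix.toLin'_apply, Matrix.toLin'_toMatrix']
    simp
  have hpoly : ∀ i j, IsPolyFun fun a => A a i j := by
    intro i j
    obtain ⟨w, hw⟩ := G.equiv.surjective (Pi.single j 1)
    have e : (fun a => A a i j) = fun a =>
        G.equiv w i + ((∑ k, a k * w.2.2 k) + w.1 * (∑ k, a k ^ 2) * (1 / 2)) *
          G.equiv (0, 1, 0) i + w.1 *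
          (LinearMap.proj i ∘ₗ G.equiv.toLinearMap ∘ₗ LinearMap.inr ℂ ℂ _ ∘ₗ
            LinearMap.inr ℂ ℂ _) a := by
      funext a
      have h1 : A a i j = (A a).mulVec (Pi.single j 1) i := by simp
      rw [h1, ← hw, hAe, G.equiv_translate]
      simp
    rw [e]
    exact ((IsPolyFun.const _).add (((IsPolyFun.sum _ fun k _ => (IsPolyFun.coord k).mul
      (IsPolyFun.const _)).add (((IsPolyFun.const _).mul (IsPolyFun.sum _ fun k _ =>
      (IsPolyFun.coord k).pow 2)).mul (IsPolyFun.const _))).mul (IsPolyFun.const _))).add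
      ((IsPolyFun.const _).mul (IsPolyFun.linear _))
  obtain ⟨ρ, hρ⟩ := RationalRep.exists_of_isPolyFun hpoly
    (G.matrix_ext fun w => by rw [hAe, translate_zero, Matrix.one_mulVec])
    fun a b => G.matrix_ext fun w => by
      rw [← Matrix.mulVec_mulVec, hAe, hAe, hAe, translate_add]
  exact ⟨ρ, fun a w => by rw [LinearEquiv.refl_apply, hρ, hAe]⟩

namespace RationalRep

/-- The homomorphism to the projective linear group. -/
def toProj (ρ : RationalRep n l) : Multiplicative (Fin n → ℂ) →* PGL(Fin l, ℂ) where
  toFun a := Matrix.ProjGenLinGroup.mk (ρ.toGL a.toAdd)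
  map_one' := by
    rw [← _root_.map_one (Matrix.ProjGenLinGroup.mk (n := Fin l) (R := ℂ))]
    congr 1
    exact Units.ext ρ.ev_zero
  map_mul' a b := by
    rw [← _root_.map_mul]
    congr 1
    exact Units.ext (ρ.ev_add _ _)

lemma lifts_toProj (ρ : RationalRep n l) : ρ.Lifts ρ.toProj := lifts_iff.2 fun _ => rfl

lemma isRegularToPGL {ρ : RationalRep n l} {φ : Multiplicative (Fin n → ℂ) →* PGL(Fin l, ℂ)}
    (h : ρ.Lifts φ) : IsRegularToPGL φ := by
  rw [lifts_iff] at h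
  intro a₀
  refine ⟨ρ.mat, ((Matrix.isUnit_iff_isUnit_det _).1 (ρ.toGL a₀).isUnit).ne_zero, fun a ha => ?_⟩
  rw [← h]
  congr 1
  exact Units.ext rfl

lemma ev_mulVec_ne_zero (ρ : RationalRep n l) (a : Fin n → ℂ) {x : Fin l → ℂ} (hx : x ≠ 0) :
    (ρ.ev a).mulVec x ≠ 0 :=
  GL_mulVec_ne_zero (ρ.toGL a) hx

lemma smul_mk_of_lifts {ρ : RationalRep n l} {φ : Multiplicative (Fin n → ℂ) →* PGL(Fin l, ℂ)}
    (h : ρ.Lifts φ) (a : Fin n → ℂ) {x : Fin l → ℂ} (hx : x ≠ 0) :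
    φ (Multiplicative.ofAdd a) • Projectivization.mk ℂ x hx =
      Projectivization.mk ℂ ((ρ.ev a).mulVec x) (ρ.ev_mulVec_ne_zero a hx) := by
  rw [← lifts_iff.1 h, mk_smul_mk]
  rfl

namespace Translates

variable {ρ : RationalRep n l} {σ : (Fin n → ℂ) ≃ₗ[ℂ] (Fin n → ℂ)}
  {q : QuadraticForm ℂ (Fin l → ℂ)} {G : Frame n q}

lemma ev_mulVec (h : ρ.Translates σ G) (a : Fin n → ℂ) :
    (ρ.ev (σ a)).mulVec (G.equiv (1, 0, 0)) = G.chart a := by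
  rw [h, Frame.chart, translate_apply]
  simp

/-- The orbit of `(1, 0, 0)` is the whole affine chart, which is dense in the quadric. -/
lemma orbitDense (h : ρ.Translates σ G) (hn : 1 ≤ n) : ρ.OrbitDense (G.equiv (1, 0, 0)) q where
  orbit a := by
    obtain ⟨a, rfl⟩ := σ.surjective a
    rw [h.ev_mulVec, G.form_chart]
  dense d f hf hv x hx := by
    have hv' : ∀ a, MvPolynomial.eval (G.chart a) f = 0 := fun a => by
      rw [← h.ev_mulVec]; exact hv _
    rcases eq_or_ne x 0 with rfl | hx0
    -- Scaling a zero of `f` by 0 also covers degree 0, where `f` is a constant.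
    · have := eval_smul_of_isHomogeneous hf 0 (G.chart 0)
      rwa [hv', zero_smul, mul_zero] at this
    · by_contra H
      obtain ⟨z, hz⟩ := G.exists_chart_ne_zero hn (f := fun v => MvPolynomial.eval v f)
        (IsPolyFun.eval f) (eval_smul_of_isHomogeneous hf) hx hx0 H
      exact hz (hv' z)

lemma deriv_mulVec (h : ρ.Translates σ G) (a : Fin n → ℂ) (x y : ℂ) (z : Fin n → ℂ) :
    (ρ.deriv (σ a)).mulVec (G.equiv (x, y, z)) = G.equiv (0, ∑ i, a i * z i, x • a) := by
  refine ρ.deriv_mulVec_eq_of_expansion (z := G.equiv (0, x * (∑ i, a i ^ 2) / 2, 0)) fun t => ?_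
  rw [← map_smul σ, h, translate_apply, ← map_smul, ← map_smul, ← _root_.map_add,
    ← _root_.map_add]
  congr 1
  refine Prod.ext (by simp) (Prod.ext ?_ ?_)
  · simp [mul_pow, mul_assoc, ← Finset.mul_sum]
    ring
  · funext i
    simp
    ring

/-- Two representations by translations are equivalent. -/
theorem exists_intertwiner (h : ρ.Translates σ G) {ρ' : RationalRep n l}
    {σ' : (Fin n → ℂ) ≃ₗ[ℂ] (Fin n → ℂ)} {q' : QuadraticForm ℂ (Fin l → ℂ)} {G' : Frame n q'}
    (h' : ρ'.Translates σ' G') :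
    ∃ (g : GL (Fin l) ℂ) (τ : (Fin n → ℂ) ≃ₗ[ℂ] (Fin n → ℂ)),
      (∀ w, g.1.mulVec (G.equiv w) = G'.equiv w) ∧ ∀ a, ρ'.ev (τ a) * g.1 = g.1 * ρ.ev a := by
  set E := G.equiv.symm.trans G'.equiv with hE
  have hg : ∀ w, (LinearMap.toMatrix' E.toLinearMap).mulVec (G.equiv w) = G'.equiv w := fun w => by
    rw [← Matrix.toLin'_apply, Matrix.toLin'_toMatrix']
    simp [hE]
  refine ⟨⟨LinearMap.toMatrix' E.toLinearMap, LinearMap.toMatrix' E.symm.toLinearMap, ?_, ?_⟩,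
    σ.symm.trans σ', hg, fun a => ?_⟩
  · rw [← LinearMap.toMatrix'_comp]
    simp
  · rw [← LinearMap.toMatrix'_comp]
    simp
  · refine G.matrix_ext fun w => ?_
    obtain ⟨a, rfl⟩ := σ.surjective a
    rw [← Matrix.mulVec_mulVec, ← Matrix.mulVec_mulVec, hg, h, hg, LinearEquiv.trans_apply,
      LinearEquiv.symm_apply_apply, h']

end Translates

end RationalRep

/-! ### The annihilator of the vector with dense orbit -/

/-- Modulo the ideal mixed products vanish, squares agree and cubes vanish, so the span of `1`, the
`Sᵢ` and one square is stable under multiplication by each variable. These `n + 2` elements will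
match the coordinates of the frame. -/
lemma exists_normal_form (i₀ : Fin n) (f : MvPolynomial (Fin n) ℂ) :
    ∃ (c d : ℂ) (b : Fin n → ℂ), f - (MvPolynomial.C c + ∑ i, b i • MvPolynomial.X i +
      d • MvPolynomial.X i₀ ^ 2) ∈ quadricIdeal n := by
  have hne : ∀ i j : Fin n, i ≠ j →
      (MvPolynomial.X i * MvPolynomial.X j : MvPolynomial (Fin n) ℂ) ∈ quadricIdeal n :=
    fun i j hij => Ideal.subset_span (Or.inl (Or.inr ⟨i, j, hij, rfl⟩))
  have hsq : ∀ i : Fin n, (MvPolynomial.X i ^ 2 - MvPolynomial.X i₀ ^ 2 :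
      MvPolynomial (Fin n) ℂ) ∈ quadricIdeal n :=
    fun i => Ideal.subset_span (Or.inl (Or.inl ⟨i, i₀, rfl⟩))
  have hcube : ∀ k : Fin n,
      (MvPolynomial.X i₀ ^ 2 * MvPolynomial.X k : MvPolynomial (Fin n) ℂ) ∈ quadricIdeal n := by
    intro k
    rcases eq_or_ne i₀ k with rfl | hk
    · rw [← pow_succ]
      exact Ideal.subset_span (Or.inr ⟨i₀, rfl⟩)
    · rw [pow_two, mul_assoc]
      exact Ideal.mul_mem_left _ _ (hne _ _ hk)
  simp only [← Ideal.Quotient.eq] at hsq ⊢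
  simp only [← Ideal.Quotient.eq_zero_iff_mem] at hne hcube
  set π := Ideal.Quotient.mk (quadricIdeal n)
  have hs : ∀ (c : ℂ) p, π (c • p) = c • π p := fun _ _ => rfl
  induction f using MvPolynomial.induction_on with
  | C c => exact ⟨c, 0, 0, by simp⟩
  | add f g hf hg =>
    obtain ⟨c, d, b, h⟩ := hf
    obtain ⟨c', d', b', h'⟩ := hg
    refine ⟨c + c', d + d', b + b', ?_⟩
    rw [_root_.map_add, h, h', ← _root_.map_add]
    congr 1
    simp only [_root_.map_add, Pi.add_apply, add_smul, Finset.sum_add_distrib]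
    ring
  | mul_X f k hf =>
    obtain ⟨c, d, b, h⟩ := hf
    -- `(c + ∑ bᵢ Sᵢ + d S²) S_k ≡ c S_k + b_k S²`.
    refine ⟨0, b k, Pi.single k c, ?_⟩
    have hX : ∀ i, π (b i • MvPolynomial.X i) * π (MvPolynomial.X k) =
        if i = k then b k • π (MvPolynomial.X i₀ ^ 2) else 0 := by
      intro i
      rw [← _root_.map_mul, smul_mul_assoc]
      split_ifs with hik
      · rw [hik, ← pow_two, hs, hsq]
      · rw [hs, hne i k hik, smul_zero]
    have hk : ∑ i, Pi.single (M := fun _ => ℂ) k c i • (MvPolynomial.X i : MvPolynomial (Fin n) ℂ) =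
        MvPolynomial.C c * MvPolynomial.X k := by
      simp [Pi.single_apply, MvPolynomial.smul_eq_C_mul]
    have hc : π (d • MvPolynomial.X i₀ ^ 2) * π (MvPolynomial.X k) = 0 := by
      rw [← _root_.map_mul, smul_mul_assoc, hs, hcube, smul_zero]
    rw [_root_.map_mul, h, hk]
    simp only [_root_.map_add, add_mul, map_sum, Finset.sum_mul, hX, hc, _root_.map_mul]
    simp [hs]

/-- The annihilator of the vector `(1, 0, 0)` for the operators
`(x, y, z) ↦ (0, zᵢ, x eᵢ)`. -/
theorem mulVec_eq_zero_iff_mem_quadricIdeal (hn : 1 ≤ n) {q : QuadraticForm ℂ (Fin l → ℂ)}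
    (G : Frame n q) (T : MvPolynomial (Fin n) ℂ →ₐ[ℂ] Matrix (Fin l) (Fin l) ℂ)
    (hT : ∀ i x y z, (T (MvPolynomial.X i)).mulVec (G.equiv (x, y, z)) =
      G.equiv (0, z i, Pi.single i x)) (f : MvPolynomial (Fin n) ℂ) :
    (T f).mulVec (G.equiv (1, 0, 0)) = 0 ↔ f ∈ quadricIdeal n := by
  have hext : ∀ {M : Matrix (Fin l) (Fin l) ℂ}, (∀ x y z, M.mulVec (G.equiv (x, y, z)) = 0) →
      M = 0 := by
    intro M hM
    refine G.matrix_ext fun ⟨x, y, z⟩ => ?_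
    rw [hM, Matrix.zero_mulVec]
  have hker : quadricIdeal n ≤ RingHom.ker T := by
    refine Ideal.span_le.2 ?_
    rintro _ ((⟨k, m, rfl⟩ | ⟨i, j, hij, rfl⟩) | ⟨k, rfl⟩)
    · refine hext fun x y z => ?_
      simp [pow_two, Matrix.sub_mulVec, ← Matrix.mulVec_mulVec, hT]
    · refine hext fun x y z => ?_
      simp [← Matrix.mulVec_mulVec, hT, hij]
    · refine hext fun x y z => ?_
      simp [pow_succ, ← Matrix.mulVec_mulVec, hT]
  constructor
  · intro hf
    obtain ⟨c, d, b, h⟩ := exists_normal_form ⟨0, hn⟩ f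
    have h1 : T f = T _ := sub_eq_zero.1 ((_root_.map_sub T _ _).symm.trans (hker h))
    -- The coefficients of the normal form are the coordinates of the resulting vector, so if it
    -- vanishes then `f` lies in the ideal.
    have h2 : (T f).mulVec (G.equiv (1, 0, 0)) = G.equiv (c, d, b) := by
      rw [h1]
      have e : G.equiv (c, d, b) = c • G.equiv (1, 0, 0) +
          ∑ i, b i • G.equiv (0, 0, Pi.single i 1) + d • G.equiv (0, 1, 0) := by
        simp only [← map_smul, ← map_sum, ← _root_.map_add]
        congr 1
        refine Prod.ext (by simp [Prod.fst_sum]) (Prod.ext ?_ ?_)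
        · simp [Prod.fst_sum, Prod.snd_sum]
        · simp only [Prod.snd_add, Prod.smul_snd, Prod.snd_sum, smul_zero, zero_add, add_zero]
          exact pi_eq_sum_univ' b
      rw [e]
      simp [Matrix.add_mulVec, Matrix.sum_mulVec, Matrix.smul_mulVec, hT, pow_two,
        ← Matrix.mulVec_mulVec, MvPolynomial.algHom_C, Algebra.algebraMap_eq_smul_one]
    rw [hf] at h2
    have h3 := G.equiv.map_eq_zero_iff.1 h2.symm
    simp only [Prod.mk_eq_zero] at h3
    obtain ⟨rfl, rfl, rfl⟩ := h3
    simpa using h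
  · intro hf
    rw [show T f = 0 from hker hf, Matrix.zero_mulVec]

end

noncomputable section

variable {n l : ℕ}

/-! ### Pairs with a given quadric as orbit closure -/

lemma iSup_submodule_eq_top {ι : Type*} {γ : ι → Fin l → ℂ} (hγ : ∀ a, γ a ≠ 0)
    (h : ∀ Λ : (Fin l → ℂ) →ₗ[ℂ] ℂ, (∀ a, Λ (γ a) = 0) → Λ = 0) :
    (⨆ a, (Projectivization.mk ℂ (γ a) (hγ a)).submodule) = ⊤ := by
  by_contra hne
  obtain ⟨Λ, hΛ, hΛW⟩ := Submodule.exists_le_ker_of_lt_top _ (lt_top_iff_ne_top.2 hne)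
  refine hΛ (h Λ fun a => hΛW ?_)
  refine Submodule.mem_iSup_of_mem a ?_
  rw [Projectivization.submodule_mk]
  exact Submodule.mem_span_singleton_self _

lemma subset_zariskiClosure (S : Set (ℙ ℂ (Fin l → ℂ))) : S ⊆ zariskiClosure S :=
  fun x hx _ _ _ h => h x hx

theorem orbitClosure_eq_quadric_iff {p : CyclicPair n l} {ρ : RationalRep n l}
    (h : ρ.Lifts p.ρ) {q : QuadraticForm ℂ (Fin l → ℂ)} :
    p.orbitClosure = quadric q ↔ ρ.OrbitDense p.v q := by
  have hγ : ∀ a, (ρ.ev a).mulVec p.v ≠ 0 := fun a => ρ.ev_mulVec_ne_zero a p.v_ne_zero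
  have e : p.orbitClosure =
      zariskiClosure (Set.range fun a => Projectivization.mk ℂ ((ρ.ev a).mulVec p.v) (hγ a)) := by
    refine congrArg zariskiClosure (congrArg Set.range (funext fun a => ?_))
    exact ρ.smul_mk_of_lifts h a p.v_ne_zero
  rw [e]
  constructor
  · intro hq
    refine ⟨fun a => ?_, fun d f hf hv x hx => ?_⟩
    · rw [← mk_mem_quadric (hγ a), ← hq]
      exact subset_zariskiClosure _ ⟨a, rfl⟩
    · rcases eq_or_ne x 0 with rfl | hx0
      · have := eval_smul_of_isHomogeneous hf 0 p.v
        rwa [show MvPolynomial.eval p.v f = 0 by simpa using hv 0, zero_smul, mul_zero] at this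
      · rw [← mk_mem_quadric hx0, ← hq, mk_mem_zariskiClosure_range hγ] at hx
        exact hx d f hf hv
  · intro hd
    ext x
    induction x using Projectivization.ind with
    | h x hx =>
      rw [mk_mem_zariskiClosure_range hγ, mk_mem_quadric]
      refine ⟨fun H => ?_, fun H d f hf hv => hd.dense d f hf hv x H⟩
      obtain ⟨f, hf, hfq⟩ := exists_isHomogeneous_quadraticForm q
      rw [← hfq]
      exact H 2 f hf fun a => by rw [hfq, hd.orbit]

/-- Cyclicity is automatic: a linear form vanishing on the orbit vanishes on the quadric, which
spans the space. -/
theorem RationalRep.OrbitDense.exists_cyclicPair {ρ : RationalRep n l} {v : Fin l → ℂ}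
    {q : QuadraticForm ℂ (Fin l → ℂ)} (h : ρ.OrbitDense v q) (F : Frame n q) (hv : v ≠ 0)
    {φ : Multiplicative (Fin n → ℂ) →* PGL(Fin l, ℂ)} (hφ : ρ.Lifts φ) :
    ∃ p : CyclicPair n l, p.ρ = φ ∧ p.v = v ∧ p.orbitClosure = quadric q := by
  have hγ : ∀ a, (ρ.ev a).mulVec v ≠ 0 := fun a => ρ.ev_mulVec_ne_zero a hv
  have hc : (⨆ a, (φ a • Projectivization.mk ℂ v hv).submodule) = ⊤ := by
    refine Eq.trans ?_ (iSup_submodule_eq_top hγ fun Λ hΛ => F.eq_zero_of_vanish fun x hx => ?_)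
    · exact iSup_congr fun a => congrArg _ (ρ.smul_mk_of_lifts hφ a hv)
    · obtain ⟨f, hf, e⟩ := exists_isHomogeneous_linear Λ
      rw [← e]
      exact h.dense 1 f hf (fun a => by rw [e, hΛ]) x hx
  exact ⟨⟨φ, RationalRep.isRegularToPGL hφ, v, hv, hc⟩, rfl, rfl,
    (orbitClosure_eq_quadric_iff (p := ⟨φ, RationalRep.isRegularToPGL hφ, v, hv, hc⟩) hφ).2 h⟩

lemma Frame.equiv_e_ne_zero {q : QuadraticForm ℂ (Fin l → ℂ)} (G : Frame n q) :
    G.equiv (1, 0, 0) ≠ 0 := by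
  rw [Ne, G.equiv.map_eq_zero_iff]
  simp

theorem Frame.exists_cyclicPair {q : QuadraticForm ℂ (Fin l → ℂ)} (G : Frame n q) (hn : 1 ≤ n) :
    ∃ (p : CyclicPair n l) (ρ : RationalRep n l), p.orbitClosure = quadric q ∧ ρ.Lifts p.ρ ∧
      p.v = G.equiv (1, 0, 0) ∧ ρ.Translates (LinearEquiv.refl ℂ _) G := by
  obtain ⟨ρ, hρ⟩ := G.exists_translates
  obtain ⟨p, hp, hpv, hpq⟩ :=
    (hρ.orbitDense hn).exists_cyclicPair G G.equiv_e_ne_zero ρ.lifts_toProj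
  exact ⟨p, ρ, hpq, hp ▸ ρ.lifts_toProj, hpv, hρ⟩

/-- A pair whose orbit closure is a nondegenerate quadric lifts to a representation by
translations. -/
theorem CyclicPair.exists_translates (p : CyclicPair n (n + 2))
    {q : QuadraticForm ℂ (Fin (n + 2) → ℂ)} (hq : q.Nondegenerate)
    (h : p.orbitClosure = quadric q) :
    ∃ (ρ : RationalRep n (n + 2)) (σ : (Fin n → ℂ) ≃ₗ[ℂ] (Fin n → ℂ)) (G : Frame n q),
      ρ.Lifts p.ρ ∧ G.equiv (1, 0, 0) = p.v ∧ ρ.Translates σ G := by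
  obtain ⟨ρ, hρ⟩ := RationalRep.exists_lifts (Nat.succ_pos _) p.ρ p.regular
  obtain ⟨F⟩ := exists_frame hq
  obtain ⟨σ, G, hv, hG⟩ := ((orbitClosure_eq_quadric_iff hρ).1 h).exists_frame_translate F
  exact ⟨ρ, σ, G, hρ, hv, hG⟩

lemma mk_mul_eq_of_intertwine {ρ ρ' : RationalRep n l}
    {φ φ' : Multiplicative (Fin n → ℂ) →* PGL(Fin l, ℂ)} (h : ρ.Lifts φ) (h' : ρ'.Lifts φ')
    {g : GL (Fin l) ℂ} {a b : Fin n → ℂ} (e : ρ'.ev b * g.1 = g.1 * ρ.ev a) :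
    φ' (Multiplicative.ofAdd b) * Matrix.ProjGenLinGroup.mk g =
      Matrix.ProjGenLinGroup.mk g * φ (Multiplicative.ofAdd a) := by
  rw [← RationalRep.lifts_iff.1 h, ← RationalRep.lifts_iff.1 h', ← map_mul, ← map_mul]
  congr 1
  exact Units.ext e

/-- Both pairs become the same translations in suitable frames with `v = (1, 0, 0)`; the map between
the frames intertwines them. -/
theorem CyclicPair.iso_of_hasQuadricClosure {p p' : CyclicPair n (n + 2)}
    (h : p.HasQuadricClosure) (h' : p'.HasQuadricClosure) : p.Iso p' := by
  obtain ⟨q, hq, e⟩ := h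
  obtain ⟨q', hq', e'⟩ := h'
  obtain ⟨ρ, σ, G, hρ, hv, hG⟩ := p.exists_translates hq e
  obtain ⟨ρ', σ', G', hρ', hv', hG'⟩ := p'.exists_translates hq' e'
  obtain ⟨g, τ, hg, hgτ⟩ := hG.exists_intertwiner hG'
  exact ⟨g, τ, by rw [← hv, hg, hv'], fun a => mk_mul_eq_of_intertwine hρ hρ' (hgτ a)⟩

/-! ### The algebra of a pair -/

/-- The linear substitution of the variables `S_i` given by a linear map. -/
def linearSubst (σ : (Fin n → ℂ) →ₗ[ℂ] (Fin n → ℂ)) :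
    MvPolynomial (Fin n) ℂ →ₐ[ℂ] MvPolynomial (Fin n) ℂ :=
  MvPolynomial.aeval fun i => ∑ j, σ (Pi.single i 1) j • MvPolynomial.X j

lemma linearSubst_linear (σ : (Fin n → ℂ) →ₗ[ℂ] (Fin n → ℂ)) (a : Fin n → ℂ) :
    linearSubst σ (∑ i, a i • MvPolynomial.X i) = ∑ j, σ a j • MvPolynomial.X j := by
  conv_rhs => rw [pi_eq_sum_univ' a]
  simp only [map_sum, map_smul, linearSubst, MvPolynomial.aeval_X, Finset.smul_sum,
    Finset.sum_apply, Finset.sum_smul, Pi.smul_apply, smul_smul, smul_eq_mul]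
  exact Finset.sum_comm

lemma linearSubst_comp_eq_id {σ τ : (Fin n → ℂ) →ₗ[ℂ] (Fin n → ℂ)} (h : ∀ a, σ (τ a) = a) :
    (linearSubst σ).comp (linearSubst τ) = AlgHom.id ℂ _ := by
  refine MvPolynomial.algHom_ext fun i => ?_
  have e : linearSubst τ (MvPolynomial.X i) =
      ∑ j, τ (Pi.single i 1) j • MvPolynomial.X j := MvPolynomial.aeval_X _ _
  rw [AlgHom.comp_apply, e, linearSubst_linear, h]
  simp [Pi.single_apply]

def linearSubstEquiv (σ : (Fin n → ℂ) ≃ₗ[ℂ] (Fin n → ℂ)) :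
    MvPolynomial (Fin n) ℂ ≃ₐ[ℂ] MvPolynomial (Fin n) ℂ :=
  AlgEquiv.ofAlgHom (linearSubst σ.toLinearMap) (linearSubst σ.symm.toLinearMap)
    (linearSubst_comp_eq_id σ.apply_symm_apply) (linearSubst_comp_eq_id σ.symm_apply_apply)

/-- The substitution absorbs `σ`: after it, `Sᵢ` acts by the standard operator `(x, y, z) ↦ (0, zᵢ,
x eᵢ)`. -/
lemma RationalRep.Translates.mem_annIdeal_iff {ρ : RationalRep n l}
    {σ : (Fin n → ℂ) ≃ₗ[ℂ] (Fin n → ℂ)} {q : QuadraticForm ℂ (Fin l → ℂ)} {G : Frame n q}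
    (h : ρ.Translates σ G) (hn : 1 ≤ n) (f : MvPolynomial (Fin n) ℂ) :
    linearSubst σ.toLinearMap f ∈ ρ.annIdeal (G.equiv (1, 0, 0)) ↔ f ∈ quadricIdeal n := by
  refine mulVec_eq_zero_iff_mem_quadricIdeal hn G (ρ.tau.comp (linearSubst σ.toLinearMap))
    (fun i x y z => ?_) f
  have e : (ρ.tau.comp (linearSubst σ.toLinearMap)) (MvPolynomial.X i) =
      ρ.deriv (σ (Pi.single i 1)) := by
    simp [linearSubst, ρ.tau_X, RationalRep.deriv]
  rw [e, h.deriv_mulVec]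
  congr 1
  refine Prod.ext rfl (Prod.ext ?_ ?_)
  · simp [Pi.single_apply]
  · simp [← Pi.single_smul]

lemma RationalRep.Translates.annIdeal_eq {ρ : RationalRep n l}
    {q : QuadraticForm ℂ (Fin l → ℂ)} {G : Frame n q}
    (h : ρ.Translates (LinearEquiv.refl ℂ _) G) (hn : 1 ≤ n) :
    ρ.annIdeal (G.equiv (1, 0, 0)) = quadricIdeal n := by
  ext f
  rw [← h.mem_annIdeal_iff hn]
  have : linearSubst (LinearEquiv.refl ℂ (Fin n → ℂ)).toLinearMap f = f := by
    refine DFunLike.congr_fun (f := linearSubst _) (g := AlgHom.id ℂ _) ?_ f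
    refine MvPolynomial.algHom_ext fun i => ?_
    simp [linearSubst, Pi.single_apply]
  rw [this]

theorem RationalRep.Translates.nonempty_algEquiv {ρ : RationalRep n l}
    {σ : (Fin n → ℂ) ≃ₗ[ℂ] (Fin n → ℂ)} {q : QuadraticForm ℂ (Fin l → ℂ)} {G : Frame n q}
    (h : ρ.Translates σ G) (hn : 1 ≤ n) :
    Nonempty ((MvPolynomial (Fin n) ℂ ⧸ ρ.annIdeal (G.equiv (1, 0, 0))) ≃ₐ[ℂ]
      (MvPolynomial (Fin n) ℂ ⧸ quadricIdeal n)) := by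
  refine ⟨(Ideal.quotientEquivAlg _ _ (linearSubstEquiv σ) ?_).symm⟩
  ext f
  refine Iff.trans ?_ (Ideal.mem_map_of_equiv (linearSubstEquiv σ) f).symm
  constructor
  · intro hf
    refine ⟨(linearSubstEquiv σ).symm f, (h.mem_annIdeal_iff hn _).1 ?_, by simp⟩
    have : linearSubst σ.toLinearMap ((linearSubstEquiv σ).symm f) = f :=
      (linearSubstEquiv σ).apply_symm_apply f
    rwa [this]
  · rintro ⟨g, hg, rfl⟩
    exact (h.mem_annIdeal_iff hn g).2 hg

/-! ### Actions on the quadric which are restrictions of linear actions -/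

lemma isZariskiClosed_setOf_linear (Λ : (Fin l → ℂ) →ₗ[ℂ] ℂ) :
    IsZariskiClosed {y : ℙ ℂ (Fin l → ℂ) | Λ y.rep = 0} := by
  refine Set.Subset.antisymm (fun x hx => ?_) (subset_zariskiClosure _)
  obtain ⟨f, hf, h⟩ := exists_isHomogeneous_linear Λ
  have := hx 1 f hf fun s hs => by rw [h]; exact hs
  rwa [h] at this

/-- The linear maps preserve `q`, and the orbit of `⟨(1, 0, 0)⟩` is the complement of the hyperplane
section `x = 0`. -/
theorem RationalRep.Translates.exists_algAction {ρ : RationalRep n l}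
    {σ : (Fin n → ℂ) ≃ₗ[ℂ] (Fin n → ℂ)} {q : QuadraticForm ℂ (Fin l → ℂ)} {G : Frame n q}
    (h : ρ.Translates σ G) (hn : 1 ≤ n) {φ : Multiplicative (Fin n → ℂ) →* PGL(Fin l, ℂ)}
    (hφ : ρ.Lifts φ) : ∃ A : AlgAction n (quadric q), A.LocallyTransitive ∧
      ∀ a x, (A.act a x).1 = φ (Multiplicative.ofAdd a) • x.1 := by
  have hφ' : ∀ a (x : ℙ ℂ (Fin l → ℂ)), φ (Multiplicative.ofAdd a) • x =
      Projectivization.mk ℂ ((ρ.ev a).mulVec x.rep)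
        (ρ.ev_mulVec_ne_zero a x.rep_nonzero) := fun a x => by
    rw [← ρ.smul_mk_of_lifts hφ a x.rep_nonzero, Projectivization.mk_rep]
  let A : AlgAction n (quadric q) :=
    { act := fun a x => ⟨φ (Multiplicative.ofAdd a) • x.1, by
        rw [hφ', mk_mem_quadric, (h.orbitDense hn).form_ev G]
        exact x.2⟩
      zero_act := fun x => Subtype.ext (by simp)
      add_act := fun a b x => Subtype.ext (by simp [mul_smul])
      regular := by
        have e : ∀ a y, (fun j => evalTwo a y (∑ k, MvPolynomial.C (ρ.mat j k) *
            MvPolynomial.X k)) = (ρ.ev a).mulVec y := by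
          intro a y
          funext j
          simp [evalTwo, Matrix.mulVec, dotProduct, RationalRep.ev]
        intro a₀ x₀
        refine ⟨1, fun j => ∑ k, MvPolynomial.C (ρ.mat j k) * MvPolynomial.X k, fun j => ?_, ?_,
          fun a x hx => ?_⟩
        · refine MvPolynomial.IsHomogeneous.sum _ _ _ fun i _ => ?_
          simpa using (MvPolynomial.isHomogeneous_C (Fin l) (ρ.mat j i)).mul
            (MvPolynomial.isHomogeneous_X _ i)
        · rw [e]
          exact ρ.ev_mulVec_ne_zero a₀ x₀.1.rep_nonzero
        · simp only [hφ']
          congr 1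
          exact (e _ _).symm }
  refine ⟨A, ⟨⟨Projectivization.mk ℂ _ G.equiv_e_ne_zero,
    (mk_mem_quadric _).2 (h.orbitDense hn).form_v⟩, {y | G.X y.rep = 0},
    isZariskiClosed_setOf_linear G.X, ?_⟩, fun a x => rfl⟩
  ext y
  have horb : ∀ a, (A.act (σ a) ⟨Projectivization.mk ℂ _ G.equiv_e_ne_zero,
      (mk_mem_quadric _).2 (h.orbitDense hn).form_v⟩).1 =
      Projectivization.mk ℂ (G.chart a) (G.chart_ne_zero a) := by
    intro a
    refine (ρ.smul_mk_of_lifts hφ _ G.equiv_e_ne_zero).trans ?_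
    congr 1
    exact h.ev_mulVec a
  constructor
  · rintro ⟨a, rfl⟩
    obtain ⟨a, rfl⟩ := σ.surjective a
    refine ⟨Subtype.property _, ?_⟩
    rw [horb]
    obtain ⟨c, hc, e⟩ := exists_rep_eq_smul (G.chart_ne_zero a)
    simpa [e] using hc
  · rintro ⟨hy, hyX⟩
    obtain ⟨z, hz⟩ := G.exists_eq_smul_chart hy hyX
    refine ⟨σ z, ?_⟩
    rw [horb, ← y.mk_rep]
    exact mk_eq_mk_of_smul _ _ hz

lemma isRegularMap_of_linear {X Y : Set (ℙ ℂ (Fin l → ℂ))} {f : X → Y} (g : GL (Fin l) ℂ)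
    (h : ∀ x, (f x).1 = Matrix.ProjGenLinGroup.mk g • x.1) : IsRegularMap f := by
  have e : ∀ y, (fun j => MvPolynomial.eval y (∑ k, MvPolynomial.C (g.1 j k) *
      MvPolynomial.X k)) = g.1.mulVec y := by
    intro y
    funext j
    simp [Matrix.mulVec, dotProduct]
  intro x₀
  refine ⟨1, fun j => ∑ k, MvPolynomial.C (g.1 j k) * MvPolynomial.X k, fun j => ?_, ?_,
    fun x hx => ?_⟩
  · refine MvPolynomial.IsHomogeneous.sum _ _ _ fun i _ => ?_
    simpa using (MvPolynomial.isHomogeneous_C (Fin l) (g.1 j i)).mul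
      (MvPolynomial.isHomogeneous_X _ i)
  · rw [e]
    exact GL_mulVec_ne_zero g x₀.1.rep_nonzero
  · rw [h]
    conv_lhs => rw [← x.1.mk_rep]
    rw [mk_smul_mk]
    congr 1
    exact (e _).symm

/-- Both frames belong to the same form `q`, so the intertwiner is an isometry and restricts to the
quadric. -/
theorem AlgAction.iso_of_translates {ρ ρ' : RationalRep n l}
    {σ σ' : (Fin n → ℂ) ≃ₗ[ℂ] (Fin n → ℂ)} {q : QuadraticForm ℂ (Fin l → ℂ)} {G G' : Frame n q}
    (h : ρ.Translates σ G) (h' : ρ'.Translates σ' G')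
    {φ φ' : Multiplicative (Fin n → ℂ) →* PGL(Fin l, ℂ)} (hφ : ρ.Lifts φ) (hφ' : ρ'.Lifts φ')
    {A B : AlgAction n (quadric q)}
    (hA : ∀ a x, (A.act a x).1 = φ (Multiplicative.ofAdd a) • x.1)
    (hB : ∀ a x, (B.act a x).1 = φ' (Multiplicative.ofAdd a) • x.1) : A.Iso B := by
  obtain ⟨g, τ, hg, hgτ⟩ := h.exists_intertwiner h'
  have hq : ∀ x, q (g.1.mulVec x) = q x := by
    intro x
    obtain ⟨⟨x, y, z⟩, rfl⟩ := G.equiv.surjective x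
    rw [hg, G.form, G'.form]
  have hmem : ∀ x : ℙ ℂ (Fin l → ℂ), Matrix.ProjGenLinGroup.mk g • x ∈ quadric q ↔
      x ∈ quadric q := by
    intro x
    induction x using Projectivization.ind with
    | h x hx => rw [mk_smul_mk, mk_mem_quadric, mk_mem_quadric, hq]
  refine ⟨(MulAction.toPerm (Matrix.ProjGenLinGroup.mk g)).subtypeEquiv
    fun x => (hmem x).symm, τ, ?_, ?_, fun a x => ?_⟩
  · exact isRegularMap_of_linear g fun x => rfl
  · exact isRegularMap_of_linear g⁻¹ fun x => rfl
  · refine Subtype.ext ?_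
    rw [hB]
    change Matrix.ProjGenLinGroup.mk g • (A.act a x).1 =
      _ • Matrix.ProjGenLinGroup.mk g • x.1
    rw [hA, smul_smul, smul_smul, mk_mul_eq_of_intertwine hφ hφ' (hgτ a)]

end

noncomputable section

variable {n l : ℕ}

/-! ### Algebraic actions in homogeneous coordinates -/

lemma evalTwo_smul {d : ℕ} {F : MvPolynomial (Fin l) (MvPolynomial (Fin n) ℂ)}
    (hF : F.IsHomogeneous d) (a : Fin n → ℂ) (c : ℂ) (v : Fin l → ℂ) :
    evalTwo a (c • v) F = c ^ d * evalTwo a v F :=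
  eval_smul_of_isHomogeneous (hF.map _) c v

lemma IsPolyFun.evalTwo {σ : Type*} (F : MvPolynomial (Fin l) (MvPolynomial (Fin n) ℂ))
    {α : (σ → ℂ) → Fin n → ℂ} {β : (σ → ℂ) → Fin l → ℂ} (hα : ∀ i, IsPolyFun fun w => α w i)
    (hβ : ∀ j, IsPolyFun fun w => β w j) :
    IsPolyFun fun w => QuadricAction.evalTwo (α w) (β w) F := by
  induction F using MvPolynomial.induction_on with
  | C p => simpa [QuadricAction.evalTwo] using (IsPolyFun.eval p).comp hα
  | add p q hp hq => simpa [QuadricAction.evalTwo] using hp.add hq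
  | mul_X p j hp => simpa [QuadricAction.evalTwo] using hp.mul (hβ j)

namespace AlgAction

variable {q : QuadraticForm ℂ (Fin l → ℂ)} (A : AlgAction n (quadric q))

/-- The action of `a` sends the line of `v` to the line of `w`. -/
def Sends (a : Fin n → ℂ) (v w : Fin l → ℂ) : Prop :=
  ∃ (hv : v ≠ 0) (hq : Projectivization.mk ℂ v hv ∈ quadric q) (hw : w ≠ 0),
    (A.act a ⟨_, hq⟩).1 = Projectivization.mk ℂ w hw

variable {A} {a b : Fin n → ℂ} {u v w : Fin l → ℂ}

lemma Sends.form_right (h : A.Sends a v w) : q w = 0 := by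
  obtain ⟨hv, hq, hw, e⟩ := h
  rw [← mk_mem_quadric hw, ← e]
  exact Subtype.property _

lemma Sends.ne_zero (h : A.Sends a v w) : w ≠ 0 := h.2.2.1

lemma exists_sends (A : AlgAction n (quadric q)) (a : Fin n → ℂ) (hv : v ≠ 0) (hq : q v = 0) :
    ∃ w, A.Sends a v w :=
  ⟨_, hv, (mk_mem_quadric hv).2 hq, Projectivization.rep_nonzero _,
    (Projectivization.mk_rep _).symm⟩

lemma sends_zero (A : AlgAction n (quadric q)) (hv : v ≠ 0) (hq : q v = 0) : A.Sends 0 v v :=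
  ⟨hv, (mk_mem_quadric hv).2 hq, hv, by rw [A.zero_act]⟩

lemma Sends.exists_eq_smul (h : A.Sends a v u) (h' : A.Sends a v w) :
    ∃ c : ℂ, c ≠ 0 ∧ w = c • u := by
  obtain ⟨hv, hq, hu, e⟩ := h
  obtain ⟨_, _, hw, e'⟩ := h'
  obtain ⟨c, hc⟩ := (Projectivization.mk_eq_mk_iff ℂ _ _ hw hu).1 (e'.symm.trans e)
  exact ⟨c, c.ne_zero, hc.symm⟩

lemma Sends.smul_right (h : A.Sends a v w) {c : ℂ} (hc : c ≠ 0) : A.Sends a v (c • w) := by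
  obtain ⟨hv, hq, hw, e⟩ := h
  exact ⟨hv, hq, smul_ne_zero hc hw, e.trans (mk_eq_mk_of_smul _ _ (c := c⁻¹)
    (by rw [smul_smul, inv_mul_cancel₀ hc, one_smul]))⟩

lemma Sends.smul_left (h : A.Sends a v w) {c : ℂ} (hc : c ≠ 0) : A.Sends a (c • v) w := by
  obtain ⟨hv, hq, hw, e⟩ := h
  have e' : Projectivization.mk ℂ (c • v) (smul_ne_zero hc hv) = Projectivization.mk ℂ v hv :=
    mk_eq_mk_of_smul _ _ rfl
  refine ⟨smul_ne_zero hc hv, e' ▸ hq, hw, ?_⟩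
  rw [← e]
  simp only [e']

lemma Sends.trans (h : A.Sends b u v) (h' : A.Sends a v w) : A.Sends (a + b) u w := by
  obtain ⟨hu, hq, hv, e⟩ := h
  obtain ⟨_, hq', hw, e'⟩ := h'
  refine ⟨hu, hq, hw, ?_⟩
  rw [A.add_act, ← e']
  congr 2
  exact Subtype.ext e

/-- The action of `a` is given by homogeneous polynomials near every point. -/
lemma exists_local_polynomial (A : AlgAction n (quadric q)) (a₀ : Fin n → ℂ) {v₀ : Fin l → ℂ}
    (hv₀ : v₀ ≠ 0) (hq₀ : q v₀ = 0) :
    ∃ (d : ℕ) (F : Fin l → MvPolynomial (Fin l) (MvPolynomial (Fin n) ℂ)),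
      (∀ j, (F j).IsHomogeneous d) ∧ (fun j => evalTwo a₀ v₀ (F j)) ≠ 0 ∧
      ∀ a v, v ≠ 0 → q v = 0 → (fun j => evalTwo a v (F j)) ≠ 0 →
        A.Sends a v fun j => evalTwo a v (F j) := by
  obtain ⟨d, F, hF, h0, h⟩ := A.regular a₀ ⟨_, (mk_mem_quadric hv₀).2 hq₀⟩
  have hrep : ∀ {v : Fin l → ℂ} (hv : v ≠ 0), ∃ c : ℂ, c ≠ 0 ∧ ∀ a,
      (fun j => evalTwo a (Projectivization.mk ℂ v hv).rep (F j)) =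
        c • fun j => evalTwo a v (F j) := by
    intro v hv
    obtain ⟨c, hc, e⟩ := exists_rep_eq_smul hv
    refine ⟨c ^ d, pow_ne_zero _ hc, fun a => funext fun j => ?_⟩
    rw [e, evalTwo_smul (hF j)]
    rfl
  refine ⟨d, F, hF, fun e => h0 ?_, fun a v hv hq hne => ?_⟩
  · obtain ⟨c, -, hc⟩ := hrep hv₀
    simp only [hc, e, smul_zero]
  · obtain ⟨c, hc0, hc⟩ := hrep hv
    refine ⟨hv, (mk_mem_quadric hv).2 hq, hne, ?_⟩
    rw [h a ⟨_, (mk_mem_quadric hv).2 hq⟩ (by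
      simp only [hc]
      exact smul_ne_zero hc0 hne)]
    exact mk_eq_mk_of_smul _ _ (hc a)

/-- In the affine part given by a frame, the action is given by polynomials without common
divisor. -/
theorem exists_coprime_chart_rep (A : AlgAction n (quadric q)) (F : Frame n q) :
    ∃ f : Fin l → MvPolynomial (Fin n ⊕ Fin n) ℂ, (∀ d, (∀ j, d ∣ f j) → IsUnit d) ∧
      ∀ a z, A.Sends a (F.chart z) fun j => MvPolynomial.eval (Sum.elim a z) (f j) := by
  choose φ hφ using fun w : Fin n ⊕ Fin n → ℂ =>
    A.exists_sends (w ∘ Sum.inl) (F.chart_ne_zero (w ∘ Sum.inr)) (F.form_chart _)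
  obtain ⟨f, hf, h⟩ := exists_coprime_polynomial_rep φ (fun w => (hφ w).ne_zero) fun w₀ => by
    obtain ⟨d, G, hG, h0, h⟩ := A.exists_local_polynomial (w₀ ∘ Sum.inl)
      (F.chart_ne_zero (w₀ ∘ Sum.inr)) (F.form_chart _)
    choose P hP using fun j => IsPolyFun.evalTwo (G j)
      (α := fun w : Fin n ⊕ Fin n → ℂ => w ∘ Sum.inl) (β := fun w => F.chart (w ∘ Sum.inr))
      (fun i => IsPolyFun.coord (Sum.inl i))
      (fun j => (F.isPolyFun_chart j).comp fun i => IsPolyFun.coord (Sum.inr i))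
    obtain ⟨j₀, hj₀⟩ := Function.ne_iff.1 h0
    -- Wherever the coordinate `j₀` is nonzero the whole tuple is nonzero, so it can serve as the
    -- denominator of the neighbourhood.
    refine ⟨P j₀, P, by rw [hP]; exact hj₀, fun w hw => ?_⟩
    rw [hP] at hw
    obtain ⟨c, hc, e⟩ := (hφ w).exists_eq_smul
      (h _ _ (F.chart_ne_zero _) (F.form_chart _) fun e => hw (congrFun e j₀))
    refine ⟨c, hc, fun k => ?_⟩
    rw [hP]
    exact congrFun e k
  refine ⟨f, hf, fun a z => ?_⟩
  obtain ⟨c, hc, e⟩ := h (Sum.elim a z)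
  rw [show (fun j => MvPolynomial.eval (Sum.elim a z) (f j)) = c • φ (Sum.elim a z) from
    funext e]
  exact (hφ (Sum.elim a z)).smul_right hc

end AlgAction

end

noncomputable section

variable {n l : ℕ}

/-! ### Linearity of the action in the affine coordinates -/

/-- Stated for all large exponents, so that one exponent serves all members of a finite tuple. -/
lemma exists_clear_denominators {σ τ : Type*} {θ : τ → (σ → ℂ) → ℂ} {s : (σ → ℂ) → ℂ}
    (hθ : ∀ i, IsPolyFun (θ i)) (hs : IsPolyFun s) (p : MvPolynomial τ ℂ) :
    ∃ e₀ : ℕ, ∀ e ≥ e₀, ∃ P : MvPolynomial σ ℂ, ∀ w, s w ≠ 0 →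
      MvPolynomial.eval w P = s w ^ e * MvPolynomial.eval (fun i => θ i w / s w) p := by
  suffices ∃ e₀ : ℕ, ∀ e ≥ e₀, ∃ P : (σ → ℂ) → ℂ, IsPolyFun P ∧ ∀ w, s w ≠ 0 →
      P w = s w ^ e * MvPolynomial.eval (fun i => θ i w / s w) p by
    obtain ⟨e₀, h⟩ := this
    refine ⟨e₀, fun e he => ?_⟩
    obtain ⟨P, ⟨P', hP'⟩, hP⟩ := h e he
    exact ⟨P', fun w hw => by rw [hP', hP w hw]⟩
  induction p using MvPolynomial.induction_on with
  | C c => exact ⟨0, fun e _ => ⟨_, (hs.pow e).mul (IsPolyFun.const c), fun w _ => by simp⟩⟩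
  | add p p' hp hp' =>
    obtain ⟨e₁, h₁⟩ := hp
    obtain ⟨e₂, h₂⟩ := hp'
    refine ⟨max e₁ e₂, fun e he => ?_⟩
    obtain ⟨P, hP, h⟩ := h₁ e (le_of_max_le_left he)
    obtain ⟨P', hP', h'⟩ := h₂ e (le_of_max_le_right he)
    exact ⟨_, hP.add hP', fun w hw => by rw [h w hw, h' w hw, map_add, mul_add]⟩
  | mul_X p i hp =>
    obtain ⟨e₁, h₁⟩ := hp
    refine ⟨e₁ + 1, fun e he => ?_⟩
    obtain ⟨k, rfl⟩ : ∃ k, e = k + 1 := ⟨e - 1, by omega⟩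
    obtain ⟨P, hP, h⟩ := h₁ k (by omega)
    refine ⟨_, hP.mul (hθ i), fun w hw => ?_⟩
    rw [h w hw, map_mul, MvPolynomial.eval_X, pow_succ]
    field_simp

/-- Half the sum of the squares of the coordinates. -/
def halfSq (z : Fin n → ℂ) : ℂ := (∑ i, z i ^ 2) / 2

lemma halfSq_smul (t : ℂ) (z : Fin n → ℂ) : halfSq (t • z) = t ^ 2 * halfSq z := by
  simp [halfSq, mul_pow, ← Finset.mul_sum, mul_div_assoc]

lemma isPolyFun_halfSq : IsPolyFun (halfSq (n := n)) := by
  have := (IsPolyFun.sum Finset.univ fun (i : Fin n) _ => (IsPolyFun.coord i).pow 2).mul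
    (IsPolyFun.const (1 / 2))
  convert this using 2
  rw [halfSq]
  ring

lemma exists_halfSq_ne_zero (hn : 1 ≤ n) : ∃ z : Fin n → ℂ, halfSq z ≠ 0 :=
  ⟨Pi.single ⟨0, hn⟩ 1, by simp [halfSq, Pi.single_apply]⟩

/-- On the line `t ↦ t z` the hypothesis reads `p(t) = t² G(1/t)` with a polynomial `G`. So the
degree in `t` is at most 2, with top coefficient `G(0)`; then `t = 1`. The locus `halfSq z = 0` is
reached by density. -/
lemma eval_eq_quadratic {p g : MvPolynomial (Fin n ⊕ Fin n) ℂ} (hn : 1 ≤ n) {γ : ℂ}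
    (h : ∀ a z, halfSq z ≠ 0 → MvPolynomial.eval (Sum.elim a z) p =
      γ * halfSq z * MvPolynomial.eval (Sum.elim a ((halfSq z)⁻¹ • z)) g) (a z : Fin n → ℂ) :
    MvPolynomial.eval (Sum.elim a z) p = MvPolynomial.eval (Sum.elim a 0) p +
      ∑ i, z i * MvPolynomial.eval (Sum.elim a 0) (MvPolynomial.pderiv (Sum.inr i) p) +
      halfSq z * (γ * MvPolynomial.eval (Sum.elim a 0) g) := by
  have hz₁ : ∀ (a z : Fin n → ℂ) (t : ℂ),
      Sum.elim a (0 : Fin n → ℂ) + t • Sum.elim (0 : Fin n → ℂ) z = Sum.elim a (t • z) := by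
    intro a z t
    funext i
    cases i <;> simp
  obtain ⟨z₀, hz₀⟩ := exists_halfSq_ne_zero hn
  have hcoord : ∀ k, IsPolyFun fun z : Fin n → ℂ => Sum.elim a z k := by
    rintro (i | i)
    · exact IsPolyFun.const _
    · exact IsPolyFun.coord i
  refine IsPolyFun.eq_of_forall_ne_zero ((IsPolyFun.eval p).comp hcoord)
    (((IsPolyFun.const _).add (IsPolyFun.sum _ fun i _ => (IsPolyFun.coord i).mul
      (IsPolyFun.const _))).add (isPolyFun_halfSq.mul (IsPolyFun.const _)))
    isPolyFun_halfSq hz₀ (fun z hz => ?_) z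
  obtain ⟨P, hP, hP1⟩ := exists_line_coeff_one p (Sum.elim a 0) (Sum.elim 0 z)
  obtain ⟨Q, hQ⟩ := (IsPolyFun.eval g).exists_line (Sum.elim a 0)
    (Sum.elim 0 ((halfSq z)⁻¹ • z))
  simp only [hz₁] at hP hQ
  obtain ⟨h2, h3⟩ := coeff_of_eval_eq_sq_mul_eval_inv (p := P)
    (g := Polynomial.C (γ * halfSq z) * Q) fun t ht => by
      rw [hP, h _ _ (by rw [halfSq_smul]; exact mul_ne_zero (pow_ne_zero _ ht) hz),
        Polynomial.eval_mul, Polynomial.eval_C, hQ, halfSq_smul, smul_smul, smul_smul]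
      have : (t ^ 2 * halfSq z)⁻¹ * t = t⁻¹ * (halfSq z)⁻¹ := by field_simp
      rw [this]
      ring
  have hdeg : P.natDegree < 3 := by
    rw [Nat.lt_succ_iff]
    exact Polynomial.natDegree_le_iff_coeff_eq_zero.2 fun k hk => h3 k hk
  have hP0 := hP 0
  have hP1' := hP 1
  have hQ0 := hQ 0
  rw [zero_smul] at hP0 hQ0
  rw [one_smul, Polynomial.eval_eq_sum_range' hdeg] at hP1'
  rw [← hP1', ← hP0, ← hQ0, ← Polynomial.coeff_zero_eq_eval_zero,
    ← Polynomial.coeff_zero_eq_eval_zero]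
  rw [Fintype.sum_sum_type] at hP1
  simp [Finset.sum_range_succ, h2, hP1]
  ring

namespace Frame

variable {q : QuadraticForm ℂ (Fin l → ℂ)} (F : Frame n q)

/-- The frame with the two hyperbolic coordinates exchanged. -/
def swap : Frame n q where
  equiv := ((LinearEquiv.prodAssoc ℂ ℂ ℂ (Fin n → ℂ)).symm.trans
    ((LinearEquiv.prodComm ℂ ℂ ℂ).prodCongr (LinearEquiv.refl ℂ _))).trans
      ((LinearEquiv.prodAssoc ℂ ℂ ℂ (Fin n → ℂ)).trans F.equiv)
  form x y z := by
    change q (F.equiv (y, x, z)) = _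
    rw [F.form]
    ring

/-- The transition between the charts `x ≠ 0` and `y ≠ 0`. -/
lemma chart_eq_smul_swap {z : Fin n → ℂ} (hz : halfSq z ≠ 0) :
    F.chart z = halfSq z • F.swap.chart ((halfSq z)⁻¹ • z) := by
  change F.equiv (1, halfSq z, z) =
    halfSq z • F.equiv (halfSq ((halfSq z)⁻¹ • z), 1, (halfSq z)⁻¹ • z)
  rw [← map_smul, halfSq_smul]
  congr 1
  refine Prod.ext ?_ (Prod.ext ?_ ?_)
  · simp
    field_simp
  · simp
  · simp [smul_smul, hz]

end Frame

namespace AlgAction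

variable {q : QuadraticForm ℂ (Fin l → ℂ)} {A : AlgAction n (quadric q)}

/-- The factor is the `X`-coordinate, a polynomial in `z` without zeros. -/
lemma exists_eval_zero_eq_smul {F : Frame n q} {f : Fin l → MvPolynomial (Fin n ⊕ Fin n) ℂ}
    (hf : ∀ a z, A.Sends a (F.chart z) fun j => MvPolynomial.eval (Sum.elim a z) (f j)) :
    ∃ α : ℂ, α ≠ 0 ∧ ∀ z, (fun j => MvPolynomial.eval (Sum.elim 0 z) (f j)) = α • F.chart z := by
  choose α hα0 hα using fun z =>
    (A.sends_zero (F.chart_ne_zero z) (F.form_chart z)).exists_eq_smul (hf 0 z)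
  have hcoord : ∀ k, IsPolyFun fun z : Fin n → ℂ => Sum.elim (0 : Fin n → ℂ) z k := by
    rintro (i | i)
    · exact IsPolyFun.const _
    · exact IsPolyFun.coord i
  have hpoly : IsPolyFun α := by
    have e : α = fun z => F.X fun j => MvPolynomial.eval (Sum.elim 0 z) (f j) := by
      funext z
      rw [hα, map_smul, F.X_chart, smul_eq_mul, mul_one]
    rw [e]
    exact (IsPolyFun.linear F.X).comp fun j => (IsPolyFun.eval (f j)).comp hcoord
  exact ⟨α 0, hα0 0, fun z => by rw [hα, hpoly.const_of_ne_zero hα0 z 0]⟩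

/-- Both tuples describe the same point. Once denominators are cleared, coprimality of `f` makes the
ratio a polynomial `h`. For fixed `z` it has no zeros in `a`, so it can be computed at `a = 0`,
where the action is trivial. -/
lemma exists_eval_eq_mul_swap (hn : 1 ≤ n) {F : Frame n q}
    {f g : Fin l → MvPolynomial (Fin n ⊕ Fin n) ℂ} (hfc : ∀ d, (∀ j, d ∣ f j) → IsUnit d)
    (hf : ∀ a z, A.Sends a (F.chart z) fun j => MvPolynomial.eval (Sum.elim a z) (f j))
    (hg : ∀ a z, A.Sends a (F.swap.chart z) fun j => MvPolynomial.eval (Sum.elim a z) (g j)) :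
    ∃ γ : ℂ, ∀ a z, halfSq z ≠ 0 → ∀ j, MvPolynomial.eval (Sum.elim a z) (f j) =
      γ * halfSq z * MvPolynomial.eval (Sum.elim a ((halfSq z)⁻¹ • z)) (g j) := by
  obtain ⟨α, hα0, hα⟩ := exists_eval_zero_eq_smul hf
  obtain ⟨β, hβ0, hβ⟩ := exists_eval_zero_eq_smul hg
  have hfg : ∀ a z, halfSq z ≠ 0 → ∃ c : ℂ, c ≠ 0 ∧ ∀ j,
      MvPolynomial.eval (Sum.elim a ((halfSq z)⁻¹ • z)) (g j) =
        c * MvPolynomial.eval (Sum.elim a z) (f j) := by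
    intro a z hz
    have h1 := (hg a ((halfSq z)⁻¹ • z)).smul_left hz
    rw [← F.chart_eq_smul_swap hz] at h1
    obtain ⟨c, hc, e⟩ := (hf a z).exists_eq_smul h1
    exact ⟨c, hc, fun j => congrFun e j⟩
  have hs : IsPolyFun fun w : Fin n ⊕ Fin n → ℂ => halfSq (w ∘ Sum.inr) :=
    isPolyFun_halfSq.comp fun i => IsPolyFun.coord (Sum.inr i)
  obtain ⟨m, G, hG⟩ : ∃ (m : ℕ) (G : Fin l → MvPolynomial (Fin n ⊕ Fin n) ℂ),
      ∀ a z, halfSq z ≠ 0 → ∀ j, MvPolynomial.eval (Sum.elim a z) (G j) = halfSq z ^ (m + 1) *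
        MvPolynomial.eval (Sum.elim a ((halfSq z)⁻¹ • z)) (g j) := by
    choose e he using fun j => exists_clear_denominators
      -- The coordinates of `a` are multiplied by `halfSq`, so that all arguments have the same
      -- denominator.
      (θ := Sum.elim (fun i w => w (Sum.inl i) * halfSq (w ∘ Sum.inr)) fun i w => w (Sum.inr i))
      (by
        rintro (i | i)
        · exact (IsPolyFun.coord _).mul hs
        · exact IsPolyFun.coord _) hs (g j)
    choose G hG using fun j => he j (Finset.univ.sup e + 1)
      ((Finset.le_sup (Finset.mem_univ j)).trans (Nat.le_succ _))
    refine ⟨Finset.univ.sup e, G, fun a z hz j => (hG j (Sum.elim a z) hz).trans ?_⟩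
    congr 3
    funext i
    rcases i with i | i
    · exact mul_div_cancel_right₀ _ hz
    · simp [div_eq_inv_mul]
  obtain ⟨z₀, hz₀⟩ := exists_halfSq_ne_zero hn
  obtain ⟨h, hh⟩ := exists_mul_of_proportional hfc (G := G) fun j k => by
    refine MvPolynomial.funext fun w => IsPolyFun.eq_of_forall_ne_zero (IsPolyFun.eval _)
      (IsPolyFun.eval _) hs (b := Sum.elim 0 z₀) hz₀ (fun w hw => ?_) w
    obtain ⟨c, -, hc⟩ := hfg (w ∘ Sum.inl) (w ∘ Sum.inr) hw
    have hw' := hG (w ∘ Sum.inl) (w ∘ Sum.inr) hw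
    simp only [hc, Sum.elim_comp_inl_inr] at hw'
    rw [map_mul, map_mul, hw', hw']
    ring
  have hG' : ∀ a z, halfSq z ≠ 0 → ∀ j, halfSq z ^ (m + 1) *
      MvPolynomial.eval (Sum.elim a ((halfSq z)⁻¹ • z)) (g j) =
      MvPolynomial.eval (Sum.elim a z) h * MvPolynomial.eval (Sum.elim a z) (f j) := by
    intro a z hz j
    rw [← hG a z hz, hh, map_mul]
  have hconst : ∀ a z, halfSq z ≠ 0 →
      MvPolynomial.eval (Sum.elim a z) h = MvPolynomial.eval (Sum.elim 0 z) h := by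
    intro a z hz
    refine IsPolyFun.const_of_ne_zero (f := fun a => MvPolynomial.eval (Sum.elim a z) h)
      ((IsPolyFun.eval h).comp ?_) (fun a ha => ?_) a 0
    · rintro (i | i)
      · exact IsPolyFun.coord i
      · exact IsPolyFun.const _
    · refine (hg a ((halfSq z)⁻¹ • z)).ne_zero (funext fun j => ?_)
      have := hG' a z hz j
      rw [ha, zero_mul] at this
      exact (mul_eq_zero.1 this).resolve_left (pow_ne_zero _ hz)
  -- At `a = 0` the tuples are `α` and `β` times the two charts, which themselves differ by the
  -- factor `halfSq z`.
  refine ⟨α / β, fun a z hz j => ?_⟩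
  have h0 : halfSq z ^ m * β = MvPolynomial.eval (Sum.elim 0 z) h * α := by
    have e : (halfSq z ^ (m + 1) * β) • F.swap.chart ((halfSq z)⁻¹ • z) =
        (MvPolynomial.eval (Sum.elim 0 z) h * α) • F.chart z := by
      rw [mul_smul, mul_smul, ← hα, ← hβ]
      exact funext fun j => hG' 0 z hz j
    have e' := congrArg F.X (F.chart_eq_smul_swap hz)
    have e2 := congrArg F.X e
    rw [map_smul, F.X_chart, smul_eq_mul] at e'
    rw [map_smul, map_smul, F.X_chart, smul_eq_mul, smul_eq_mul] at e2
    linear_combination e2 + halfSq z ^ m * β * e'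
  have h1 := hG' a z hz j
  rw [hconst a z hz] at h1
  have h2 : halfSq z ^ m ≠ 0 := pow_ne_zero _ hz
  have h3 : halfSq z ^ m * (β * MvPolynomial.eval (Sum.elim a z) (f j)) = halfSq z ^ m *
      (α * halfSq z * MvPolynomial.eval (Sum.elim a ((halfSq z)⁻¹ • z)) (g j)) := by
    linear_combination MvPolynomial.eval (Sum.elim a z) (f j) * h0 - α * h1
  have h4 := mul_left_cancel₀ h2 h3
  rw [div_mul_eq_mul_div, div_mul_eq_mul_div, eq_div_iff hβ0]
  linear_combination h4

/-- In the affine part given by a frame, the action is given by a matrix of polynomials. -/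
theorem exists_matrix_chart (hn : 1 ≤ n) (A : AlgAction n (quadric q)) (F : Frame n q) :
    ∃ P : (Fin n → ℂ) → Matrix (Fin l) (Fin l) ℂ, (∀ i j, IsPolyFun fun a => P a i j) ∧
      ∀ a z, A.Sends a (F.chart z) ((P a).mulVec (F.chart z)) := by
  obtain ⟨f, hfc, hf⟩ := A.exists_coprime_chart_rep F
  obtain ⟨g, -, hg⟩ := A.exists_coprime_chart_rep F.swap
  obtain ⟨γ, hγ⟩ := exists_eval_eq_mul_swap hn hfc hf hg
  -- The formula of `eval_eq_quadratic` is linear in `(1, halfSq z, z)`, the coordinates of `chart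
  -- z`; replacing these by arbitrary `(x, y, z)` gives a linear map.
  set Φ : (Fin n → ℂ) → (ℂ × ℂ × (Fin n → ℂ)) → Fin l → ℂ := fun a w j =>
    w.1 * MvPolynomial.eval (Sum.elim a 0) (f j) +
      ∑ i, w.2.2 i * MvPolynomial.eval (Sum.elim a 0) (MvPolynomial.pderiv (Sum.inr i) (f j)) +
      w.2.1 * (γ * MvPolynomial.eval (Sum.elim a 0) (g j)) with hΦ
  let L : (Fin n → ℂ) → (Fin l → ℂ) →ₗ[ℂ] (Fin l → ℂ) := fun a =>
    { toFun := fun u => Φ a (F.equiv.symm u)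
      map_add' := fun u v => by
        funext j
        simp only [hΦ, map_add, Prod.fst_add, Prod.snd_add, Pi.add_apply, add_mul,
          Finset.sum_add_distrib]
        ring
      map_smul' := fun c u => by
        funext j
        simp only [hΦ, map_smul, Prod.smul_fst, Prod.smul_snd, Pi.smul_apply, smul_eq_mul,
          RingHom.id_apply, mul_assoc, mul_add, Finset.mul_sum] }
  have hcoord : ∀ k, IsPolyFun fun a : Fin n → ℂ => Sum.elim a (0 : Fin n → ℂ) k := by
    rintro (i | i)
    · exact IsPolyFun.coord i
    · exact IsPolyFun.const _
  have hev : ∀ p : MvPolynomial (Fin n ⊕ Fin n) ℂ,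
      IsPolyFun fun a => MvPolynomial.eval (Sum.elim a 0) p :=
    fun p => (IsPolyFun.eval p).comp hcoord
  refine ⟨fun a => LinearMap.toMatrix' (L a), fun i j => ?_, fun a z => ?_⟩
  · have e : (fun a => LinearMap.toMatrix' (L a) i j) =
        fun a => Φ a (F.equiv.symm (Pi.single j 1)) i := by
      funext a
      have h1 : LinearMap.toMatrix' (L a) i j =
        (LinearMap.toMatrix' (L a)).mulVec (Pi.single j 1) i := by simp
      rw [h1, ← Matrix.toLin'_apply, Matrix.toLin'_toMatrix']
      rfl
    rw [e]
    exact (((IsPolyFun.const _).mul (hev _)).add (IsPolyFun.sum _ fun k _ =>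
      (IsPolyFun.const _).mul (hev _))).add ((IsPolyFun.const _).mul
        ((IsPolyFun.const _).mul (hev _)))
  · rw [← Matrix.toLin'_apply, Matrix.toLin'_toMatrix']
    convert hf a z using 1
    funext j
    rw [eval_eq_quadratic hn (fun a z hz => hγ a z hz j)]
    change Φ a (F.equiv.symm (F.equiv (1, halfSq z, z))) j = _
    rw [F.equiv.symm_apply_apply, hΦ]
    simp

end AlgAction

end

noncomputable section

variable {n l : ℕ}

/-! ### Linearization of the action -/

lemma exists_eq_smul_of_forall_mul_eq {u w : Fin l → ℂ} (hu : u ≠ 0)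
    (h : ∀ j k, u j * w k = u k * w j) : ∃ c : ℂ, w = c • u := by
  obtain ⟨j, hj⟩ := Function.ne_iff.1 hu
  refine ⟨w j / u j, funext fun k => ?_⟩
  have hj' : u j ≠ 0 := hj
  rw [Pi.smul_apply, smul_eq_mul, div_mul_eq_mul_div, eq_div_iff hj']
  linear_combination h j k

/-- A homogeneous function which vanishes on the affine part of the quadric vanishes on the
quadric. -/
lemma Frame.eq_zero_of_forall_chart {q : QuadraticForm ℂ (Fin l → ℂ)} (F : Frame n q) (hn : 1 ≤ n)
    {f : (Fin l → ℂ) → ℂ} (hf : IsPolyFun f) {d : ℕ} (hd : ∀ (c : ℂ) v, f (c • v) = c ^ d * f v)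
    (h : ∀ z, f (F.chart z) = 0) {x : Fin l → ℂ} (hx : q x = 0) (hx0 : x ≠ 0) : f x = 0 := by
  by_contra H
  obtain ⟨z, hz⟩ := F.exists_chart_ne_zero hn hf hd hx hx0 H
  exact hz (h z)

lemma isPolyFun_mulVec (M : Matrix (Fin l) (Fin l) ℂ) (j : Fin l) :
    IsPolyFun fun v => M.mulVec v j :=
  IsPolyFun.linear (LinearMap.proj j ∘ₗ M.mulVecLin)

namespace AlgAction

variable {q : QuadraticForm ℂ (Fin l → ℂ)} {A : AlgAction n (quadric q)} {F : Frame n q}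
  {P : (Fin n → ℂ) → Matrix (Fin l) (Fin l) ℂ}

lemma exists_local_homogeneous (A : AlgAction n (quadric q)) (a : Fin n → ℂ) {v₀ : Fin l → ℂ}
    (hv₀ : v₀ ≠ 0) (hq₀ : q v₀ = 0) :
    ∃ (d : ℕ) (G : (Fin l → ℂ) → Fin l → ℂ), (∀ j, IsPolyFun fun v => G v j) ∧
      (∀ (c : ℂ) v, G (c • v) = c ^ d • G v) ∧ G v₀ ≠ 0 ∧
      ∀ v, v ≠ 0 → q v = 0 → G v ≠ 0 → A.Sends a v (G v) := by
  obtain ⟨d, f, hf, h0, h⟩ := A.exists_local_polynomial a hv₀ hq₀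
  exact ⟨d, fun v j => evalTwo a v (f j),
    fun j => IsPolyFun.evalTwo (f j) (fun i => IsPolyFun.const _) fun i => IsPolyFun.coord i,
    fun c v => funext fun j => evalTwo_smul (hf j) a c v, h0, h a⟩

/-- A matrix which describes the action of `a` on the affine part of the quadric describes it on
the whole quadric. -/
lemma sends_mulVec (hn : 1 ≤ n) (a : Fin n → ℂ) {M : Matrix (Fin l) (Fin l) ℂ}
    (hM : ∀ z, A.Sends a (F.chart z) (M.mulVec (F.chart z))) {v : Fin l → ℂ} (hv : v ≠ 0)
    (hq : q v = 0) (hMv : M.mulVec v ≠ 0) : A.Sends a v (M.mulVec v) := by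
  obtain ⟨d, G, hG, hd, h0, h⟩ := A.exists_local_homogeneous a hv hq
  -- Proportionality is a homogeneous condition of degree `d + 1`. It holds on the chart, trivially
  -- where `G` vanishes, and so on the whole quadric.
  have key : ∀ j k, G v j * M.mulVec v k = G v k * M.mulVec v j := by
    intro j k
    rw [← sub_eq_zero]
    refine F.eq_zero_of_forall_chart hn (d := d + 1)
      (f := fun v => G v j * M.mulVec v k - G v k * M.mulVec v j)
      (((hG j).mul (isPolyFun_mulVec M k)).sub ((hG k).mul (isPolyFun_mulVec M j)))
      (fun c v => ?_) (fun z => ?_) hq hv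
    · simp only [hd, Matrix.mulVec_smul, Pi.smul_apply, smul_eq_mul]
      ring
    · by_cases hz : G (F.chart z) = 0
      · simp [hz]
      · obtain ⟨c, -, hc⟩ := (h _ (F.chart_ne_zero z) (F.form_chart z) hz).exists_eq_smul (hM z)
        rw [hc]
        simp only [Pi.smul_apply, smul_eq_mul]
        ring
  obtain ⟨c, hc⟩ := exists_eq_smul_of_forall_mul_eq h0 key
  have hc0 : c ≠ 0 := by
    rintro rfl
    exact hMv (by rw [hc, zero_smul])
  rw [hc]
  exact (h v hv hq h0).smul_right hc0

/-- The point that `a` carries to `chart 0` has image off the hyperplane `X = 0`. By density some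
point of the chart has this property too. -/
lemma exists_X_mulVec_ne_zero (hn : 1 ≤ n) (a : Fin n → ℂ) {M : Matrix (Fin l) (Fin l) ℂ}
    (hM : ∀ z, A.Sends a (F.chart z) (M.mulVec (F.chart z))) :
    ∃ z, F.X (M.mulVec (F.chart z)) ≠ 0 := by
  obtain ⟨u, hu⟩ := A.exists_sends (-a) (F.chart_ne_zero 0) (F.form_chart 0)
  obtain ⟨d, G, hG, hd, h0, h⟩ := A.exists_local_homogeneous a hu.ne_zero hu.form_right
  have h1 := hu.trans (h u hu.ne_zero hu.form_right h0)
  rw [add_neg_cancel] at h1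
  obtain ⟨c, hc0, hc⟩ := (A.sends_zero (F.chart_ne_zero 0) (F.form_chart 0)).exists_eq_smul h1
  obtain ⟨z, hz⟩ := F.exists_chart_ne_zero hn (f := fun v => F.X (G v)) (d := d)
    ((IsPolyFun.linear F.X).comp hG) (fun c v => by rw [hd, map_smul, smul_eq_mul])
    hu.form_right hu.ne_zero (by rw [hc, map_smul, F.X_chart]; simpa using hc0)
  have hGz : G (F.chart z) ≠ 0 := fun e => hz (by rw [e, map_zero])
  obtain ⟨b, hb0, hb⟩ := (h _ (F.chart_ne_zero z) (F.form_chart z) hGz).exists_eq_smul (hM z)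
  refine ⟨z, ?_⟩
  rw [hb, map_smul]
  exact mul_ne_zero hb0 hz

/-- `P (-a) * P a` fixes the point of `chart z` whenever `a` keeps it in the chart. This is generic
in `z`, so it extends to the chart and then to the quadric, and the matrix is scalar. It yields the
invertibility of `P a`. -/
lemma exists_neg_mul_eq_smul (hn : 1 ≤ n)
    (hP : ∀ a z, A.Sends a (F.chart z) ((P a).mulVec (F.chart z))) (a : Fin n → ℂ) :
    ∃ c : ℂ, c ≠ 0 ∧ P (-a) * P a = c • 1 := by
  have hz : ∀ z, F.X ((P a).mulVec (F.chart z)) ≠ 0 →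
      ∃ c : ℂ, c ≠ 0 ∧ (P (-a) * P a).mulVec (F.chart z) = c • F.chart z := by
    intro z hz
    obtain ⟨z', hz'⟩ := F.exists_eq_smul_chart (hP a z).form_right hz
    have h1 := (hP (-a) z').smul_left hz
    rw [← hz'] at h1
    have h2 := ((hP a z).trans h1).smul_right hz
    rw [neg_add_cancel, ← Matrix.mulVec_smul, ← hz', Matrix.mulVec_mulVec] at h2
    exact (A.sends_zero (F.chart_ne_zero z) (F.form_chart z)).exists_eq_smul h2
  obtain ⟨z₀, hz₀⟩ := exists_X_mulVec_ne_zero hn a (hP a)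
  have hchart : ∀ z, ∃ c : ℂ, (P (-a) * P a).mulVec (F.chart z) = c • F.chart z := by
    intro z
    refine exists_eq_smul_of_forall_mul_eq (F.chart_ne_zero z) fun j k => ?_
    have hp : ∀ j, IsPolyFun fun z => (P (-a) * P a).mulVec (F.chart z) j := fun j =>
      (isPolyFun_mulVec _ j).comp F.isPolyFun_chart
    refine IsPolyFun.eq_of_forall_ne_zero ((F.isPolyFun_chart j).mul (hp k))
      ((F.isPolyFun_chart k).mul (hp j)) ((IsPolyFun.linear F.X).comp fun i =>
        (isPolyFun_mulVec (P a) i).comp F.isPolyFun_chart) hz₀ (fun z hz' => ?_) z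
    obtain ⟨c, -, hc⟩ := hz z hz'
    rw [hc]
    simp only [Pi.smul_apply, smul_eq_mul]
    ring
  have hall : ∀ x, q x = 0 → ∃ μ : ℂ, (P (-a) * P a).mulVecLin x = μ • x := by
    intro x hx
    rcases eq_or_ne x 0 with rfl | hx0
    · exact ⟨0, by simp⟩
    refine exists_eq_smul_of_forall_mul_eq hx0 fun j k => ?_
    rw [← sub_eq_zero]
    refine F.eq_zero_of_forall_chart hn (d := 2) (f := fun v =>
      v j * (P (-a) * P a).mulVec v k - v k * (P (-a) * P a).mulVec v j)
      (((IsPolyFun.coord j).mul (isPolyFun_mulVec _ k)).sub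
        ((IsPolyFun.coord k).mul (isPolyFun_mulVec _ j))) (fun c v => ?_) (fun z => ?_) hx hx0
    · simp only [Matrix.mulVec_smul, Pi.smul_apply, smul_eq_mul]
      ring
    · obtain ⟨c, hc⟩ := hchart z
      rw [hc]
      simp only [Pi.smul_apply, smul_eq_mul]
      ring
  obtain ⟨c, hc⟩ := F.exists_eq_smul_of_eigen hn _ hall
  refine ⟨c, ?_, Matrix.mulVec_injective (funext fun x => ?_)⟩
  · rintro rfl
    obtain ⟨b, hb0, hb⟩ := hz z₀ hz₀
    have h1 := hc (F.chart z₀)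
    rw [Matrix.mulVecLin_apply, hb, zero_smul] at h1
    exact smul_ne_zero hb0 (F.chart_ne_zero z₀) h1
  · rw [Matrix.smul_mulVec, Matrix.one_mulVec]
    exact hc x

/-- An algebraic action on a nondegenerate quadric is the restriction of an action on the ambient
projective space. -/
theorem exists_projective_extension (hn : 1 ≤ n) (A : AlgAction n (quadric q)) (F : Frame n q) :
    ∃ φ : Multiplicative (Fin n → ℂ) →* PGL(Fin l, ℂ), IsRegularToPGL φ ∧
      ∀ a x, (A.act a x).1 = φ (Multiplicative.ofAdd a) • x.1 := by
  obtain ⟨P, hPpoly, hP⟩ := A.exists_matrix_chart hn F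
  have hdet : ∀ a, (P a).det ≠ 0 := by
    intro a h
    obtain ⟨c, hc, e⟩ := exists_neg_mul_eq_smul hn hP a
    have h1 := congrArg Matrix.det e
    rw [Matrix.det_mul, h, mul_zero, Matrix.det_smul, Matrix.det_one, mul_one] at h1
    exact pow_ne_zero _ hc h1.symm
  let g : (Fin n → ℂ) → GL (Fin l) ℂ := fun a =>
    Matrix.GeneralLinearGroup.mkOfDetNeZero (P a) (hdet a)
  have hg : ∀ a, (g a).1 = P a := fun a => rfl
  have hne : ∀ a {v : Fin l → ℂ}, v ≠ 0 → (P a).mulVec v ≠ 0 := fun a v hv =>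
    GL_mulVec_ne_zero (g a) hv
  have hS : ∀ a {v : Fin l → ℂ}, v ≠ 0 → q v = 0 → A.Sends a v ((P a).mulVec v) :=
    fun a v hv hq => sends_mulVec hn a (hP a) hv hq (hne a hv)
  have hmul : ∀ a b, Matrix.ProjGenLinGroup.mk (g (a + b)) =
      Matrix.ProjGenLinGroup.mk (g a) * Matrix.ProjGenLinGroup.mk (g b) := by
    intro a b
    -- The matrix `(g a * g b)⁻¹ * g (a + b)` fixes every point of the quadric, so it is scalar.
    obtain ⟨c, hc⟩ := F.exists_eq_smul_of_eigen hn
      (((g a * g b)⁻¹ * g (a + b)).1.mulVecLin) fun x hx => by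
        rcases eq_or_ne x 0 with rfl | hx0
        · exact ⟨0, by simp⟩
        have h1 := hS b hx0 hx
        obtain ⟨c, -, hc⟩ := (h1.trans (hS a h1.ne_zero h1.form_right)).exists_eq_smul
          (hS (a + b) hx0 hx)
        refine ⟨c, ?_⟩
        rw [Matrix.mulVecLin_apply, Units.val_mul, ← Matrix.mulVec_mulVec, hg, hc,
          Matrix.mulVec_smul, Matrix.mulVec_mulVec, ← hg, ← hg, ← Units.val_mul,
          Matrix.mulVec_mulVec, ← Units.val_mul, mul_assoc, inv_mul_cancel, Units.val_one,
          Matrix.one_mulVec]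
    have e : ((g a * g b)⁻¹ * g (a + b)).1 = c • (1 : GL (Fin l) ℂ).1 :=
      Matrix.mulVec_injective (funext fun x => by
        rw [Units.val_one, Matrix.smul_mulVec, Matrix.one_mulVec]
        exact hc x)
    have hc0 : c ≠ 0 := by
      rintro rfl
      rw [zero_smul] at e
      refine GL_mulVec_ne_zero ((g a * g b)⁻¹ * g (a + b)) (F.chart_ne_zero 0) ?_
      rw [e, Matrix.zero_mulVec]
    have h1 := mk_eq_mk_of_eq_smul hc0 e
    rw [map_mul, map_inv, map_one, inv_mul_eq_one, map_mul] at h1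
    exact h1.symm
  let φ : Multiplicative (Fin n → ℂ) →* PGL(Fin l, ℂ) :=
    MonoidHom.mk' (fun a => Matrix.ProjGenLinGroup.mk (g a.toAdd)) fun a b => hmul _ _
  refine ⟨φ, ?_, fun a x => ?_⟩
  · choose M hM using hPpoly
    have e : ∀ a, (Matrix.of M).map (MvPolynomial.eval a) = P a := fun a => by
      ext i j
      exact hM i j a
    refine fun a₀ => ⟨Matrix.of M, by rw [e]; exact hdet a₀, fun a h => ?_⟩
    change Matrix.ProjGenLinGroup.mk (g a) = _
    congr 1
    exact Units.ext (e a).symm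
  · obtain ⟨hv, hq, hw, e⟩ := hS a x.1.rep_nonzero x.2
    have hx : x = ⟨Projectivization.mk ℂ x.1.rep hv, hq⟩ := Subtype.ext (x.1.mk_rep).symm
    rw [hx, e]
    rfl

/-- A locally transitive action on a nondegenerate quadric is the restriction of the action given
by a projective representation with a cyclic vector. -/
theorem exists_cyclicPair (hn : 1 ≤ n) {q : QuadraticForm ℂ (Fin (n + 2) → ℂ)}
    (hq : q.Nondegenerate) (A : AlgAction n (quadric q)) (hA : A.LocallyTransitive) :
    ∃ p : CyclicPair n (n + 2), p.orbitClosure = quadric q ∧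
      ∀ a x, (A.act a x).1 = p.ρ (Multiplicative.ofAdd a) • x.1 := by
  obtain ⟨F⟩ := exists_frame hq
  obtain ⟨φ, hφ, hAφ⟩ := A.exists_projective_extension hn F
  obtain ⟨ρ, hρ⟩ := RationalRep.exists_lifts (Nat.succ_pos _) φ hφ
  obtain ⟨x, Z, hZ, horb⟩ := hA
  have hact : ∀ a, (A.act a x).1 = Projectivization.mk ℂ ((ρ.ev a).mulVec x.1.rep)
      (ρ.ev_mulVec_ne_zero a x.1.rep_nonzero) := fun a => by
    rw [hAφ, ← ρ.smul_mk_of_lifts hρ a x.1.rep_nonzero, Projectivization.mk_rep]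
  have hxZ : x.1 ∉ Z := by
    have : x.1 ∈ quadric q \ Z := horb ▸ ⟨0, by rw [A.zero_act]⟩
    exact this.2
  -- As `Z` is closed and misses `x`, some homogeneous `h` vanishes on `Z` but not at `x`; the
  -- points of the quadric with `h ≠ 0` lie in the orbit.
  obtain ⟨e, h, hh, hhZ, hhx⟩ : ∃ (e : ℕ) (h : MvPolynomial (Fin (n + 2)) ℂ),
      h.IsHomogeneous e ∧ (∀ s ∈ Z, MvPolynomial.eval s.rep h = 0) ∧
        MvPolynomial.eval x.1.rep h ≠ 0 := by
    by_contra! H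
    exact hxZ (hZ ▸ fun d f hf hfZ => H d f hf hfZ)
  have hdense : ρ.OrbitDense x.1.rep q := by
    refine ⟨fun a => ?_, fun d f hf hv y hy => ?_⟩
    · rw [← mk_mem_quadric (ρ.ev_mulVec_ne_zero a x.1.rep_nonzero), ← hact]
      exact Subtype.property _
    rcases eq_or_ne y 0 with rfl | hy0
    · have := eval_smul_of_isHomogeneous hf 0 x.1.rep
      rwa [show MvPolynomial.eval x.1.rep f = 0 by simpa using hv 0, zero_smul, mul_zero] at this
    by_contra H
    obtain ⟨z₁, h₁⟩ := F.exists_chart_ne_zero hn (f := fun v => MvPolynomial.eval v f)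
      (IsPolyFun.eval f) (eval_smul_of_isHomogeneous hf) hy hy0 H
    obtain ⟨z₂, h₂⟩ := F.exists_chart_ne_zero hn (f := fun v => MvPolynomial.eval v h)
      (IsPolyFun.eval h) (eval_smul_of_isHomogeneous hh) x.2 x.1.rep_nonzero hhx
    -- If `f` did not vanish on the quadric, irreducibility of the chart would give a point with `f
    -- ≠ 0` and `h ≠ 0`. It lies in the orbit, where `f` vanishes.
    obtain ⟨z, hzf, hzh⟩ := ((IsPolyFun.eval f).comp F.isPolyFun_chart).exists_mul_ne_zero
      ((IsPolyFun.eval h).comp F.isPolyFun_chart) h₁ h₂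
    have hz : Projectivization.mk ℂ _ (F.chart_ne_zero z) ∈ quadric q \ Z :=
      ⟨(mk_mem_quadric _).2 (F.form_chart z), fun hmem =>
        hzh ((eval_rep_eq_zero_iff hh (F.chart_ne_zero z)).1 (hhZ _ hmem))⟩
    rw [← horb] at hz
    obtain ⟨a, ha⟩ := hz
    refine hzf ((eval_rep_eq_zero_iff hf (F.chart_ne_zero z)).1 ?_)
    rw [ha, hact, eval_rep_eq_zero_iff hf]
    exact hv a
  obtain ⟨p, hp, -, hpq⟩ := hdense.exists_cyclicPair F x.1.rep_nonzero hρ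
  exact ⟨p, hpq, fun a y => by rw [hp, hAφ]⟩

end AlgAction

end

end QuadricAction

/-! ### The classification theorem -/

theorem mainTheorem1 (n : ℕ) (hn : 1 ≤ n) :
    -- existence, realised by the pair with the algebra `ℂ[S_1, …, S_n] / quadricIdeal n`
    (∃ p : QuadricAction.CyclicPair n (n + 2), p.HasQuadricClosure ∧
      ∃ ρ : QuadricAction.RationalRep n (n + 2),
        ρ.Lifts p.ρ ∧ ρ.annIdeal p.v = QuadricAction.quadricIdeal n) ∧
    -- uniqueness up to isomorphism
    (∀ p p' : QuadricAction.CyclicPair n (n + 2),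
      p.HasQuadricClosure → p'.HasQuadricClosure → p.Iso p') ∧
    -- the algebra that corresponds to such a pair
    (∀ p : QuadricAction.CyclicPair n (n + 2), p.HasQuadricClosure →
      ∃ ρ : QuadricAction.RationalRep n (n + 2), ρ.Lifts p.ρ ∧
        (∀ ρ' : QuadricAction.RationalRep n (n + 2), ρ'.Lifts p.ρ → ρ' = ρ) ∧
        Nonempty ((MvPolynomial (Fin n) ℂ ⧸ ρ.annIdeal p.v) ≃ₐ[ℂ]
          (MvPolynomial (Fin n) ℂ ⧸ QuadricAction.quadricIdeal n))) ∧
    -- locally transitive actions on a nondegenerate quadric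
    (∀ q : QuadraticForm ℂ (Fin (n + 2) → ℂ), q.Nondegenerate →
      (∃ A : QuadricAction.AlgAction n (QuadricAction.quadric q), A.LocallyTransitive) ∧
      (∀ A B : QuadricAction.AlgAction n (QuadricAction.quadric q),
        A.LocallyTransitive → B.LocallyTransitive → A.Iso B) ∧
      -- these actions are the restrictions of the projective representations above
      (∀ A : QuadricAction.AlgAction n (QuadricAction.quadric q), A.LocallyTransitive →
        ∃ p : QuadricAction.CyclicPair n (n + 2), p.orbitClosure = QuadricAction.quadric q ∧
          ∀ a x, (A.act a x).1 = p.ρ (Multiplicative.ofAdd a) • x.1) ∧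
      (∀ p : QuadricAction.CyclicPair n (n + 2), p.orbitClosure = QuadricAction.quadric q →
        ∃ A : QuadricAction.AlgAction n (QuadricAction.quadric q), A.LocallyTransitive ∧
          ∀ a x, (A.act a x).1 = p.ρ (Multiplicative.ofAdd a) • x.1)) := by
  refine ⟨?_, fun p p' => QuadricAction.CyclicPair.iso_of_hasQuadricClosure, ?_, ?_⟩
  · obtain ⟨F⟩ := QuadricAction.exists_frame (QuadricAction.sumSquares_nondegenerate (n + 2))
    obtain ⟨p, ρ, hp, hρ, hv, h⟩ := F.exists_cyclicPair hn
    exact ⟨p, ⟨_, QuadricAction.sumSquares_nondegenerate _, hp⟩, ρ, hρ,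
      by rw [hv, h.annIdeal_eq hn]⟩
  · rintro p ⟨q, hq, hp⟩
    obtain ⟨ρ, σ, G, hρ, hv, h⟩ := p.exists_translates hq hp
    refine ⟨ρ, hρ, fun ρ' hρ' =>
      QuadricAction.RationalRep.lifts_unique (Nat.succ_pos _) hρ' hρ, ?_⟩
    rw [← hv]
    exact h.nonempty_algEquiv hn
  · intro q hq
    refine ⟨?_, fun A B hA hB => ?_, fun A => A.exists_cyclicPair hn hq, fun p hp => ?_⟩
    · obtain ⟨F⟩ := QuadricAction.exists_frame hq
      obtain ⟨ρ, hρ⟩ := F.exists_translates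
      obtain ⟨A, hA, -⟩ := hρ.exists_algAction hn ρ.lifts_toProj
      exact ⟨A, hA⟩
    · obtain ⟨p, hp, hpA⟩ := A.exists_cyclicPair hn hq hA
      obtain ⟨p', hp', hpB⟩ := B.exists_cyclicPair hn hq hB
      obtain ⟨ρ, σ, G, hρ, -, h⟩ := p.exists_translates hq hp
      obtain ⟨ρ', σ', G', hρ', -, h'⟩ := p'.exists_translates hq hp'
      exact QuadricAction.AlgAction.iso_of_translates h h' hρ hρ' hpA hpB
    · obtain ⟨ρ, σ, G, hρ, -, h⟩ := p.exists_translates hq hp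
      exact h.exists_algAction hn hρ
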